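/- Let $\Bbbk$ be a field and let $(S,L)$ be a Lie--Rinehart algebra over $\Bbbk$: $S$ is a commutative $\Bbbk$-algebra and $L$ is a Lie algebra over $\Bbbk$ that is also an $S$-module and acts on $S$ by derivations through a morphism of Lie algebras $L\to\operatorname{Der}_\Bbbk(S)$, $\alpha\mapsto\alpha_S$, with $(s\alpha)_S(t)=s\,\alpha_S(t)$ and $[\alpha,s\beta]=s[\alpha,\beta]+\alpha_S(s)\beta$ for $s,t\in S$ and $\alpha,\beta\in L$. Let $U$ be its universal enveloping algebra, that is, the universal associative $\Bbbk$-algebra with a morphism of algebras $S\to U$ and a morphism of Lie algebras $L\to U$ (both omitted from the notation) such that the product of $s$ and $\alpha$ in $U$ is the image of $s\alpha\in L$, and $\alpha s-s\alpha=\alpha_S(s)$ in $U$. For an algebra $A$ put $A^e=A\otimes_\Bbbk A^{\mathrm{op}}$, and let $H^q(S,M)=\operatorname{Ext}^q_{S^e}(S,M)$ denote Hochschild cohomology. Assume that $L$ is projective as an $S$-module, let $N$ be a left $U$-module and let $M$ be a $U^e$-module, regarded also as an $S^e$-module. For each $U^e$-module $X$ the space $G(X)=\operatorname{Hom}_{S^e}(S,X)$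 is a left $U$-module with $(t\cdot\varphi)(s)=(t\otimes1)\varphi(s)$ and $(\alpha\cdot\varphi)(s)=(\alpha\otimes 1)\varphi(s)-(1\otimes\alpha)\varphi(s)-\varphi(\alpha_S(s))$ for $s,t\in S$ and $\alpha\in L$. The space $F(N)=U\otimes_S N$ (where $S$ acts on $U$ by right multiplication) is a $U^e$-module with $(v\otimes1)(u\otimes n)=vu\otimes n$, $(1\otimes s)(u\otimes n)=u\otimes sn$ and $(1\otimes\alpha)(u\otimes n)=u\alpha\otimes n-u\otimes\alpha n$ for $u,v\in U$, $n\in N$, $s\in S$ and $\alpha\in L$. Then: (1) For each $q\ge0$ there is exactly one structure of $U$-module on $H^q(S,M)$ such that, for every injective resolution $M\to I^\bullet$ of $U^e$-modules, every $u\in U$ and every $q$-cocycle $\varphi$ of the complex $G(I^\bullet)$, the product of $u$ with the class of $\varphi$ in $H^q(S,M)$ is the class of $u\cdot\varphi$. Here the class of $\varphi$ is that of the cocycle $f^q\circ\varphi$ of $\operatorname{Hom}_{S^e}(S,J^\bullet)$, for any injective resolution $M\to J^\bullet$ of $S^e$-modules and any morphism $f:I^\bullet\to J^\bullet$ of complexes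 of $S^e$-modules that lifts the identity of $M$. (2) With this $U$-module structure on $H^q(S,M)$, there is a first-quadrant cohomological spectral sequence of $\Bbbk$-vector spaces with second page $$E_2^{p,q}\cong\operatorname{Ext}_U^p(N,H^q(S,M))$$ that converges to $\operatorname{Ext}_{U^e}^{\bullet}(F(N),M)$: for each $n\ge 0$ the space $\operatorname{Ext}^n_{U^e}(F(N),M)$ has a filtration $\operatorname{Ext}^n_{U^e}(F(N),M)=\Phi^0\supseteq\Phi^1\supseteq\cdots\supseteq\Phi^{n+1}=0$ with $\Phi^p/\Phi^{p+1}\cong E_\infty^{p,n-p}$ for $0\le p\le n$. -/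

import Mathlib

open CategoryTheory
open scoped TensorProduct

universe u v

noncomputable section

namespace LieRinehart

/-- The enveloping algebra `Aᵉ = A ⊗ Aᵒᵖ` of an associative `k`-algebra `A`, with product
`(a₁ ⊗ a₂) (b₁ ⊗ b₂) = a₁ b₁ ⊗ b₂ a₂` (the product `b₂ a₂` being taken in `A`).
Left `Aᵉ`-modules are `A`-bimodules. -/
abbrev Env (k A : Type u) [Field k] [Ring A] [Algebra k A] : Type u := A ⊗[k] Aᵐᵒᵖ

/-- `A` as an `Aᵉ`-module: `(a ⊗ b) • x = a * x * b`. -/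
def diagonalModule (k A : Type u) [Field k] [Ring A] [Algebra k A] : ModuleCat.{u} (Env k A) :=
  letI : Module (Env k A) A := instModuleTensorProductMop k A
  ModuleCat.of (Env k A) A

/-- The Hochschild cohomology `H^q(A, X) = Ext_{Aᵉ}^q(A, X)`. -/
abbrev HochschildCohomology (k A : Type u) [Field k] [Ring A] [Algebra k A]
    (X : ModuleCat.{u} (Env k A)) (q : ℕ) : Type u :=
  Abelian.Ext.{u} (diagonalModule k A) X q

section Enveloping

variable (k S L : Type u) [Field k] [CommRing S] [Algebra k S] [LieRing L] [LieAlgebra k L]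
  [Module S L] [LieRingModule L S]

/-- The relations that define the universal enveloping algebra of a Lie-Rinehart algebra `(S, L)`
as a quotient of the free algebra on the disjoint union of `S` and `L`: they say that the
map on `S` is a morphism of algebras, that the map on `L` is a morphism of Lie algebras, and that
`s α = (s • α)` and `α s - s α = α_S(s)`. -/
inductive Rel : FreeAlgebra k (S ⊕ L) → FreeAlgebra k (S ⊕ L) → Prop
  | scalar (c : k) :
      Rel (FreeAlgebra.ι k (.inl (algebraMap k S c))) (algebraMap k (FreeAlgebra k (S ⊕ L)) c)
  | add_left (s t : S) : Rel (FreeAlgebra.ι k (.inl (s + t)))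
      (FreeAlgebra.ι k (.inl s) + FreeAlgebra.ι k (.inl t))
  | mul_left (s t : S) : Rel (FreeAlgebra.ι k (.inl (s * t)))
      (FreeAlgebra.ι k (.inl s) * FreeAlgebra.ι k (.inl t))
  | add_right (α β : L) : Rel (FreeAlgebra.ι k (.inr (α + β)))
      (FreeAlgebra.ι k (.inr α) + FreeAlgebra.ι k (.inr β))
  | smul_right (c : k) (α : L) : Rel (FreeAlgebra.ι k (.inr (c • α)))
      (c • FreeAlgebra.ι k (.inr α))
  | lie (α β : L) : Rel (FreeAlgebra.ι k (.inr ⁅α, β⁆))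
      (FreeAlgebra.ι k (.inr α) * FreeAlgebra.ι k (.inr β) -
        FreeAlgebra.ι k (.inr β) * FreeAlgebra.ι k (.inr α))
  | smul (s : S) (α : L) : Rel (FreeAlgebra.ι k (.inl s) * FreeAlgebra.ι k (.inr α))
      (FreeAlgebra.ι k (.inr (s • α)))
  | anchor (α : L) (s : S) :
      Rel (FreeAlgebra.ι k (.inr α) * FreeAlgebra.ι k (.inl s) -
        FreeAlgebra.ι k (.inl s) * FreeAlgebra.ι k (.inr α)) (FreeAlgebra.ι k (.inl ⁅α, s⁆))

/-- The universal enveloping algebra `U = U(S, L)` of a Lie-Rinehart algebra. -/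
def Enveloping : Type u := RingQuot (Rel k S L)

instance : Ring (Enveloping k S L) := inferInstanceAs (Ring (RingQuot (Rel k S L)))

instance : Algebra k (Enveloping k S L) := inferInstanceAs (Algebra k (RingQuot (Rel k S L)))

namespace Enveloping

/-- The quotient map from the free algebra. -/
def mk : FreeAlgebra k (S ⊕ L) →ₐ[k] Enveloping k S L := RingQuot.mkAlgHom k (Rel k S L)

variable {k S L} in
lemma mk_rel {x y : FreeAlgebra k (S ⊕ L)} (h : Rel k S L x y) : mk k S L x = mk k S L y :=
  RingQuot.mkAlgHom_rel k h

/-- The canonical morphism of algebras `i : S → U`. -/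
def i : S →ₐ[k] Enveloping k S L :=
  AlgHom.ofLinearMap
    { toFun := fun s => mk k S L (FreeAlgebra.ι k (.inl s))
      map_add' := fun s t => by rw [mk_rel (Rel.add_left s t), map_add]
      map_smul' := fun c s => by
        rw [Algebra.smul_def, mk_rel (Rel.mul_left _ _), map_mul, mk_rel (Rel.scalar c),
          AlgHom.commutes, RingHom.id_apply, Algebra.smul_def] }
    (by
      have h := mk_rel (Rel.scalar (S := S) (L := L) (1 : k))
      simpa using h)
    (fun s t => by
      change mk k S L _ = mk k S L _ * mk k S L _
      rw [mk_rel (Rel.mul_left s t), map_mul])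

/-- The canonical morphism of Lie algebras `j : L → U`, as a linear map. -/
def j : L →ₗ[k] Enveloping k S L where
  toFun α := mk k S L (FreeAlgebra.ι k (.inr α))
  map_add' α β := by rw [mk_rel (Rel.add_right α β), map_add]
  map_smul' c α := by rw [mk_rel (Rel.smul_right c α), map_smul, RingHom.id_apply]

lemma j_lie (α β : L) :
    j k S L ⁅α, β⁆ = j k S L α * j k S L β - j k S L β * j k S L α := by
  change mk k S L _ = mk k S L _ * mk k S L _ - mk k S L _ * mk k S L _
  rw [mk_rel (Rel.lie α β), map_sub, map_mul, map_mul]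

lemma i_mul_j (s : S) (α : L) : i k S L s * j k S L α = j k S L (s • α) := by
  change mk k S L _ * mk k S L _ = mk k S L _
  rw [← mk_rel (Rel.smul s α), map_mul]

lemma j_mul_i_sub (α : L) (s : S) :
    j k S L α * i k S L s - i k S L s * j k S L α = i k S L ⁅α, s⁆ := by
  change mk k S L _ * mk k S L _ - mk k S L _ * mk k S L _ = mk k S L _
  rw [← mk_rel (Rel.anchor α s), map_sub, map_mul, map_mul]

section lift

variable {k S L} {A : Type v} [Ring A] [Algebra k A] (f : S →ₐ[k] A) (g : L →ₗ[k] A)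
  (hlie : ∀ α β, g ⁅α, β⁆ = g α * g β - g β * g α)
  (hsmul : ∀ s α, f s * g α = g (s • α))
  (hanchor : ∀ α s, g α * f s - f s * g α = f ⁅α, s⁆)

/-- The universal property of `U(S, L)`, existence. -/
def lift : Enveloping k S L →ₐ[k] A :=
  RingQuot.liftAlgHom k ⟨FreeAlgebra.lift k (Sum.elim f g), fun x y h => by
    cases h with
    | scalar c => simp
    | add_left s t => simp
    | mul_left s t => simp
    | add_right α β => simp
    | smul_right c α => simp
    | lie α β => simp [hlie]
    | smul s α => simp [hsmul]
    | anchor α s => simp [hanchor]⟩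

@[simp]
lemma lift_i (s : S) : lift f g hlie hsmul hanchor (i k S L s) = f s := by
  refine (RingQuot.liftAlgHom_mkAlgHom_apply k _ _ _).trans ?_
  simp

@[simp]
lemma lift_j (α : L) : lift f g hlie hsmul hanchor (j k S L α) = g α := by
  refine (RingQuot.liftAlgHom_mkAlgHom_apply k _ _ _).trans ?_
  simp

end lift

variable {k S L} in
lemma induction {P : Enveloping k S L → Prop} (hi : ∀ s, P (i k S L s)) (hj : ∀ α, P (j k S L α))
    (hadd : ∀ u v, P u → P v → P (u + v)) (hmul : ∀ u v, P u → P v → P (u * v))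
    (u : Enveloping k S L) : P u := by
  obtain ⟨x, rfl⟩ := RingQuot.mkAlgHom_surjective k (Rel k S L) u
  change P (mk k S L x)
  induction x using FreeAlgebra.induction with
  | grade0 c =>
    rw [AlgHom.commutes, ← AlgHom.commutes (i k S L)]
    exact hi _
  | grade1 x =>
    cases x with
    | inl s => exact hi s
    | inr α => exact hj α
  | mul a b ha hb => rw [map_mul]; exact hmul _ _ ha hb
  | add a b ha hb => rw [map_add]; exact hadd _ _ ha hb

end Enveloping

/-- The morphism of algebras `Sᵉ → Uᵉ` induced by `i : S → U`. -/
def envMap : Env k S →ₐ[k] Env k (Enveloping k S L) :=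
  Algebra.TensorProduct.map (Enveloping.i k S L) (AlgHom.op (Enveloping.i k S L))

/-- A `Uᵉ`-module regarded as an `Sᵉ`-module. -/
abbrev res : ModuleCat.{u} (Env k (Enveloping k S L)) ⥤ ModuleCat.{u} (Env k S) :=
  ModuleCat.restrictScalars (envMap k S L).toRingHom

end Enveloping

section FunctorG

open scoped ModuleCat

variable {k S L : Type u} [Field k] [CommRing S] [Algebra k S] [LieRing L] [LieAlgebra k L]
  [Module S L] [LieRingModule L S]

/-- The `k`-vector space `Hom_{Sᵉ}(S, M)` for a `Uᵉ`-module `M`. -/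
abbrev GHom (M : ModuleCat.{u} (Env k (Enveloping k S L))) : Type u :=
  diagonalModule k S →ₗ[Env k S] (res k S L).obj M

/-- The element `s` of `S` as an element of the `Sᵉ`-module `S`. -/
def toDiag (s : S) : diagonalModule k S := s

/-- The element `φ s` of `M`, for `φ : Hom_{Sᵉ}(S, M)` and `s : S`. -/
def GHom.ev {M : ModuleCat.{u} (Env k (Enveloping k S L))} (φ : GHom M) (s : S) : M :=
  φ (toDiag s)

lemma GHom.ext' {M : ModuleCat.{u} (Env k (Enveloping k S L))} {φ ψ : GHom M}
    (h : ∀ s, φ.ev s = ψ.ev s) : φ = ψ :=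
  LinearMap.ext h

open MulOpposite in
lemma GHom.ev_mul {M : ModuleCat.{u} (Env k (Enveloping k S L))} (φ : GHom M) (a s b : S) :
    φ.ev (a * s * b) =
      (Enveloping.i k S L a ⊗ₜ[k] op (Enveloping.i k S L b) : Env k (Enveloping k S L)) •
        φ.ev s := by
  have h := φ.map_smul (a ⊗ₜ[k] op b : Env k S) (toDiag s)
  have h2 : (a ⊗ₜ[k] op b : Env k S) • (toDiag s : diagonalModule k S) =
      toDiag (a * s * b) := by
    rw [mul_assoc]; rfl
  rw [h2] at h
  exact h

lemma tmul_smul_toDiag (a : S) (b : Sᵐᵒᵖ) (s : S) :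
    (a ⊗ₜ[k] b : Env k S) • (toDiag s : diagonalModule k S) = toDiag (a * s * b.unop) := by
  rw [mul_assoc]; rfl

/-- Constructor for `Hom_{Sᵉ}(S, M)`. -/
def GHom.mk {M : ModuleCat.{u} (Env k (Enveloping k S L))} (ψ : S → M)
    (hadd : ∀ s t, ψ (s + t) = ψ s + ψ t)
    (hmul : ∀ a s b : S, ψ (a * s * b) =
      (Enveloping.i k S L a ⊗ₜ[k] MulOpposite.op (Enveloping.i k S L b) :
        Env k (Enveloping k S L)) • ψ s) : GHom M :=
  letI ψ' : diagonalModule k S → (res k S L).obj M := ψ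
  haveI hadd' : ∀ s t, ψ' (s + t) = ψ' s + ψ' t := hadd
  { toFun := ψ'
    map_add' := hadd'
    map_smul' := fun x s => by
      have h0 : ψ' 0 = 0 := by simpa using hadd' 0 0
      rw [RingHom.id_apply]
      induction x using TensorProduct.induction_on with
      | zero =>
        exact ((congrArg ψ' (zero_smul (Env k S) s)).trans h0).trans
          (zero_smul (Env k S) (ψ' s)).symm
      | tmul a b =>
        have h := tmul_smul_toDiag (k := k) a b s
        exact (congrArg ψ' h).trans (hmul a s b.unop)
      | add x y hx hy => rw [add_smul, add_smul, hadd', hx, hy] }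

@[simp]
lemma GHom.mk_ev {M : ModuleCat.{u} (Env k (Enveloping k S L))} (ψ : S → M)
    (hadd) (hmul) (s : S) : (GHom.mk ψ hadd hmul).ev s = ψ s := rfl

@[simp]
lemma GHom.add_ev {M : ModuleCat.{u} (Env k (Enveloping k S L))} (φ ψ : GHom M) (s : S) :
    (φ + ψ).ev s = φ.ev s + ψ.ev s := rfl

@[simp]
lemma GHom.sub_ev {M : ModuleCat.{u} (Env k (Enveloping k S L))} (φ ψ : GHom M) (s : S) :
    (φ - ψ).ev s = φ.ev s - ψ.ev s := rfl

lemma GHom.ev_add {M : ModuleCat.{u} (Env k (Enveloping k S L))} (φ : GHom M) (s t : S) :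
    φ.ev (s + t) = φ.ev s + φ.ev t := φ.map_add _ _

lemma GHom.ev_sub {M : ModuleCat.{u} (Env k (Enveloping k S L))} (φ : GHom M) (s t : S) :
    φ.ev (s - t) = φ.ev s - φ.ev t := φ.map_sub _ _

lemma GHom.smul_ev {M : ModuleCat.{u} (Env k (Enveloping k S L))} (c : k) (φ : GHom M) (s : S) :
    (c • φ).ev s = algebraMap k (Env k (Enveloping k S L)) c • φ.ev s := by
  rw [← (envMap k S L).commutes c]
  rfl

/-- The element `u ⊗ 1` of `Uᵉ`. -/
def lam (u : Enveloping k S L) : Env k (Enveloping k S L) := u ⊗ₜ[k] 1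

/-- The element `1 ⊗ u` of `Uᵉ`. -/
def rho (u : Enveloping k S L) : Env k (Enveloping k S L) := 1 ⊗ₜ[k] MulOpposite.op u

lemma lam_mul (u v : Enveloping k S L) : lam (u * v) = lam u * lam v := by
  simp [lam]

lemma rho_mul (u v : Enveloping k S L) : rho (u * v) = rho v * rho u := by
  simp [rho]

lemma lam_mul_rho (u v : Enveloping k S L) : lam u * rho v = u ⊗ₜ[k] MulOpposite.op v := by
  simp [lam, rho]

lemma rho_mul_lam (u v : Enveloping k S L) : rho v * lam u = lam u * rho v := by
  simp [lam, rho]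

lemma lam_add (u v : Enveloping k S L) : lam (u + v) = lam u + lam v := TensorProduct.add_tmul ..

lemma lam_sub (u v : Enveloping k S L) : lam (u - v) = lam u - lam v := TensorProduct.sub_tmul ..

lemma rho_add (u v : Enveloping k S L) : rho (u + v) = rho u + rho v :=
  TensorProduct.tmul_add ..

lemma rho_sub (u v : Enveloping k S L) : rho (u - v) = rho u - rho v :=
  TensorProduct.tmul_sub ..

lemma GHom.ev_mul' {M : ModuleCat.{u} (Env k (Enveloping k S L))} (φ : GHom M) (a s b : S) :
    φ.ev (a * s * b) =
      (lam (Enveloping.i k S L a) * rho (Enveloping.i k S L b)) • φ.ev s := by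
  rw [lam_mul_rho, GHom.ev_mul]

lemma GHom.ev_mul_left {M : ModuleCat.{u} (Env k (Enveloping k S L))} (φ : GHom M) (a s : S) :
    φ.ev (a * s) = lam (Enveloping.i k S L a) • φ.ev s := by
  have h := φ.ev_mul a s 1
  rw [mul_one, map_one] at h
  exact h

lemma GHom.ev_mul_right {M : ModuleCat.{u} (Env k (Enveloping k S L))} (φ : GHom M) (a s : S) :
    φ.ev (a * s) = rho (Enveloping.i k S L a) • φ.ev s := by
  have h := φ.ev_mul 1 s a
  rw [one_mul, map_one, mul_comm] at h
  exact h

lemma lam_algebraMap (c : k) :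
    lam (algebraMap k (Enveloping k S L) c) = algebraMap k (Env k (Enveloping k S L)) c := rfl

/-- The action of `t : S` on `Hom_{Sᵉ}(S, M)`: `(t • φ)(s) = (t ⊗ 1) • φ(s)`. -/
def actSEnd (M : ModuleCat.{u} (Env k (Enveloping k S L))) (t : S) : Module.End k (GHom M) where
  toFun φ := GHom.mk (fun s => lam (Enveloping.i k S L t) • φ.ev s)
    (fun s s' => by rw [φ.ev_add, smul_add])
    (fun a s b => by
      rw [φ.ev_mul', ← lam_mul_rho, smul_smul, smul_smul, ← mul_assoc, mul_assoc _ (rho _),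
        rho_mul_lam, ← mul_assoc, ← lam_mul, ← lam_mul, ← map_mul, ← map_mul, mul_comm])
  map_add' φ ψ := GHom.ext' fun s => by
    rw [GHom.add_ev, GHom.mk_ev, GHom.mk_ev, GHom.mk_ev, GHom.add_ev, smul_add]
  map_smul' c φ := GHom.ext' fun s => by
    rw [RingHom.id_apply, GHom.smul_ev, GHom.mk_ev, GHom.mk_ev, GHom.smul_ev, smul_smul,
      smul_smul, Algebra.commutes]

lemma actSEnd_ev (M : ModuleCat.{u} (Env k (Enveloping k S L))) (t : S) (φ : GHom M) (s : S) :
    (actSEnd M t φ).ev s = lam (Enveloping.i k S L t) • φ.ev s := rfl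

lemma actSEnd_add (M : ModuleCat.{u} (Env k (Enveloping k S L))) (t t' : S) :
    actSEnd M (t + t') = actSEnd M t + actSEnd M t' :=
  LinearMap.ext fun φ => GHom.ext' fun s => by
    rw [LinearMap.add_apply, GHom.add_ev, actSEnd_ev, actSEnd_ev, actSEnd_ev, map_add,
      lam_add, add_smul]

lemma actSEnd_smul (M : ModuleCat.{u} (Env k (Enveloping k S L))) (c : k) (t : S) :
    actSEnd M (c • t) = c • actSEnd M t :=
  LinearMap.ext fun φ => GHom.ext' fun s => by
    rw [LinearMap.smul_apply, GHom.smul_ev, actSEnd_ev, actSEnd_ev,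
      Algebra.smul_def, map_mul, AlgHom.commutes, lam_mul, mul_smul, lam_algebraMap]

lemma actSEnd_one (M : ModuleCat.{u} (Env k (Enveloping k S L))) : actSEnd M 1 = 1 :=
  LinearMap.ext fun φ => GHom.ext' fun s => by
    rw [actSEnd_ev, map_one, Module.End.one_apply]
    exact one_smul _ _

lemma actSEnd_mul (M : ModuleCat.{u} (Env k (Enveloping k S L))) (t t' : S) :
    actSEnd M (t * t') = actSEnd M t * actSEnd M t' :=
  LinearMap.ext fun φ => GHom.ext' fun s => by
    rw [Module.End.mul_apply, actSEnd_ev, actSEnd_ev, actSEnd_ev, map_mul, lam_mul, mul_smul]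

/-- The action of `S` on `Hom_{Sᵉ}(S, M)`, as a morphism of algebras. -/
def actS (M : ModuleCat.{u} (Env k (Enveloping k S L))) : S →ₐ[k] Module.End k (GHom M) :=
  AlgHom.ofLinearMap
    { toFun := actSEnd M
      map_add' := actSEnd_add M
      map_smul' := actSEnd_smul M }
    (actSEnd_one M) (actSEnd_mul M)

@[simp]
lemma actS_ev (M : ModuleCat.{u} (Env k (Enveloping k S L))) (t : S) (φ : GHom M) (s : S) :
    (actS M t φ).ev s = lam (Enveloping.i k S L t) • φ.ev s := rfl

variable [LieRinehartRing S L] [LieRinehartAlgebra k S L]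

/-- The action of `L` on `Hom_{Sᵉ}(S, M)`:
`(α • φ)(s) = (α ⊗ 1) • φ(s) - (1 ⊗ α) • φ(s) - φ(α_S(s))`. -/
def actL (M : ModuleCat.{u} (Env k (Enveloping k S L))) : L →ₗ[k] Module.End k (GHom M) where
  toFun α :=
    { toFun := fun φ => GHom.mk
        (fun s => lam (Enveloping.j k S L α) • φ.ev s - rho (Enveloping.j k S L α) • φ.ev s -
          φ.ev ⁅α, s⁆)
        (fun s t => by simp only [lie_add, φ.ev_add, smul_add]; abel)
        (fun a s b => by
          have h1 : ⁅α, a * s * b⁆ = ⁅α, a⁆ * s * b + a * ⁅α, s⁆ * b + a * s * ⁅α, b⁆ := by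
            simp only [LieRinehartRing.leibniz_mul_right, smul_eq_mul]; ring
          have h2 := congrArg lam (Enveloping.j_mul_i_sub k S L α a)
          have h3 := congrArg rho (Enveloping.j_mul_i_sub k S L α b)
          rw [lam_sub, lam_mul, lam_mul] at h2
          rw [rho_sub, rho_mul, rho_mul] at h3
          rw [h1, ← lam_mul_rho]
          simp only [φ.ev_add, φ.ev_mul', ← h2, ← h3, smul_sub, smul_smul, mul_sub, sub_mul,
            sub_smul, ← mul_assoc]
          simp only [mul_assoc, rho_mul_lam]
          simp only [← mul_assoc]
          abel)
      map_add' := fun φ ψ => GHom.ext' fun s => by simp; abel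
      map_smul' := fun c φ => GHom.ext' fun s => by
        simp only [RingHom.id_apply, GHom.smul_ev, GHom.mk_ev, smul_sub, smul_smul,
          Algebra.commutes] }
  map_add' α β := LinearMap.ext fun φ => GHom.ext' fun s => by
    simp only [LinearMap.add_apply, LinearMap.coe_mk, AddHom.coe_mk, GHom.add_ev, GHom.mk_ev,
      map_add, lam_add, rho_add, add_smul, add_lie, GHom.ev_add]
    abel
  map_smul' c α := LinearMap.ext fun φ => GHom.ext' fun s => by
    have h1 : lam (Enveloping.j k S L (c • α)) =
        algebraMap k (Env k (Enveloping k S L)) c * lam (Enveloping.j k S L α) := by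
      rw [map_smul, Algebra.smul_def, lam_mul, lam_algebraMap]
    have h2 : rho (Enveloping.j k S L (c • α)) =
        algebraMap k (Env k (Enveloping k S L)) c * rho (Enveloping.j k S L α) := by
      rw [map_smul, ← Algebra.smul_def, rho, rho, MulOpposite.op_smul, TensorProduct.tmul_smul]
    have h3 : φ.ev ⁅c • α, s⁆ = algebraMap k (Env k (Enveloping k S L)) c • φ.ev ⁅α, s⁆ := by
      rw [smul_lie, Algebra.smul_def, GHom.ev_mul_left, AlgHom.commutes, lam_algebraMap]
    simp only [RingHom.id_apply, LinearMap.smul_apply, LinearMap.coe_mk, AddHom.coe_mk,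
      GHom.smul_ev, GHom.mk_ev, h1, h2, h3, smul_sub, smul_smul]

@[simp]
lemma actL_ev (M : ModuleCat.{u} (Env k (Enveloping k S L))) (α : L) (φ : GHom M) (s : S) :
    (actL M α φ).ev s = lam (Enveloping.j k S L α) • φ.ev s -
      rho (Enveloping.j k S L α) • φ.ev s - φ.ev ⁅α, s⁆ := rfl

/-- The action of `U` on `Hom_{Sᵉ}(S, M)` determined by those of `S` and `L`. -/
def actU (M : ModuleCat.{u} (Env k (Enveloping k S L))) :
    Enveloping k S L →ₐ[k] Module.End k (GHom M) :=
  Enveloping.lift (actS M) (actL M)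
    (fun α β => LinearMap.ext fun φ => GHom.ext' fun s => by
      simp only [actL_ev, LinearMap.sub_apply, Module.End.mul_apply, GHom.sub_ev,
        Enveloping.j_lie, lam_sub, rho_sub, lam_mul, rho_mul, smul_sub, sub_smul, smul_smul,
        lie_lie, GHom.ev_sub, rho_mul_lam]
      abel)
    (fun t α => LinearMap.ext fun φ => GHom.ext' fun s => by
      have h : φ.ev ⁅t • α, s⁆ = lam (Enveloping.i k S L t) • φ.ev ⁅α, s⁆ := by
        rw [LieRinehartRing.lie_smul_eq_mul, GHom.ev_mul_left]
      simp only [actL_ev, actS_ev, Module.End.mul_apply, h, ← Enveloping.i_mul_j, smul_sub,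
        lam_mul, rho_mul, mul_smul, ← GHom.ev_mul_right]
      rw [GHom.ev_mul_left]
      simp only [smul_smul, rho_mul_lam])
    (fun α t => LinearMap.ext fun φ => GHom.ext' fun s => by
      simp only [actL_ev, actS_ev, Module.End.mul_apply, LinearMap.sub_apply, GHom.sub_ev,
        ← Enveloping.j_mul_i_sub, smul_sub, lam_sub, lam_mul, sub_smul, smul_smul, rho_mul_lam]
      abel)

instance GHom.instModule (M : ModuleCat.{u} (Env k (Enveloping k S L))) :
    Module (Enveloping k S L) (GHom M) :=
  Module.compHom (GHom M) (actU M).toRingHom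

lemma GHom.i_smul_ev {M : ModuleCat.{u} (Env k (Enveloping k S L))} (t : S) (φ : GHom M) (s : S) :
    (Enveloping.i k S L t • φ).ev s = lam (Enveloping.i k S L t) • φ.ev s := by
  change (actU M (Enveloping.i k S L t) φ).ev s = _
  rw [actU, Enveloping.lift_i, actS_ev]

lemma GHom.j_smul_ev {M : ModuleCat.{u} (Env k (Enveloping k S L))} (α : L) (φ : GHom M) (s : S) :
    (Enveloping.j k S L α • φ).ev s = lam (Enveloping.j k S L α) • φ.ev s -
      rho (Enveloping.j k S L α) • φ.ev s - φ.ev ⁅α, s⁆ := by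
  change (actU M (Enveloping.j k S L α) φ).ev s = _
  rw [actU, Enveloping.lift_j, actL_ev]

/-- The map `Hom_{Sᵉ}(S, f)` for a morphism `f` of `Uᵉ`-modules. -/
def GHom.map {M M' : ModuleCat.{u} (Env k (Enveloping k S L))} (f : M ⟶ M') :
    GHom M →ₗ[Enveloping k S L] GHom M' where
  toFun φ := ((res k S L).map f).hom.comp φ
  map_add' φ ψ := LinearMap.comp_add _ _ _
  map_smul' u φ := by
    have hev : ∀ (ψ : GHom M) (s : S),
        GHom.ev (M := M') (((res k S L).map f).hom.comp ψ) s = f.hom (ψ.ev s) := fun _ _ => rfl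
    rw [RingHom.id_apply]
    induction u using Enveloping.induction generalizing φ with
    | hi t =>
      refine GHom.ext' fun s => ?_
      rw [hev, GHom.i_smul_ev, GHom.i_smul_ev, map_smul, hev]
    | hj α =>
      refine GHom.ext' fun s => ?_
      rw [hev, GHom.j_smul_ev, GHom.j_smul_ev, map_sub, map_sub, map_smul, map_smul, hev, hev]
    | hadd u v hu hv => rw [add_smul, add_smul, ← hu, ← hv]; exact LinearMap.comp_add _ _ _
    | hmul u v hu hv => rw [mul_smul, hu, hv, mul_smul]

variable (k S L) in
/-- The functor `G = Hom_{Sᵉ}(S, -)` from `Uᵉ`-modules to `U`-modules. -/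
def G : ModuleCat.{u} (Env k (Enveloping k S L)) ⥤ ModuleCat.{u} (Enveloping k S L) where
  obj M := ModuleCat.of (Enveloping k S L) (GHom M)
  map f := ModuleCat.ofHom (GHom.map f)
  map_id _ := rfl
  map_comp _ _ := rfl

end FunctorG

section FunctorF

variable (k S L : Type u) [Field k] [CommRing S] [Algebra k S] [LieRing L] [LieAlgebra k L]
  [Module S L] [LieRingModule L S]

/-- A copy of `U` on which `U` acts by left multiplication and `S` by right multiplication. -/
def URight : Type u := Enveloping k S L

namespace URight

instance : AddCommGroup (URight k S L) := inferInstanceAs (AddCommGroup (Enveloping k S L))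

instance : Module k (URight k S L) := inferInstanceAs (Module k (Enveloping k S L))

instance : Module (Enveloping k S L) (URight k S L) :=
  inferInstanceAs (Module (Enveloping k S L) (Enveloping k S L))

instance : IsScalarTower k (Enveloping k S L) (URight k S L) :=
  inferInstanceAs (IsScalarTower k (Enveloping k S L) (Enveloping k S L))

variable {k S L}

/-- An element of `U` regarded in the copy `URight`. -/
def of (u : Enveloping k S L) : URight k S L := u

/-- An element of the copy `URight` regarded in `U`. -/
def val (u : URight k S L) : Enveloping k S L := u

lemma smul_def (v : Enveloping k S L) (u : URight k S L) : v • u = of (v * u.val) := rfl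

instance : Module S (URight k S L) where
  smul s u := of (u.val * Enveloping.i k S L s)
  one_smul u := by
    change u.val * Enveloping.i k S L 1 = u.val
    rw [map_one, mul_one]
  mul_smul s t u := by
    change u.val * Enveloping.i k S L (s * t) =
      u.val * Enveloping.i k S L t * Enveloping.i k S L s
    rw [mul_comm, map_mul, mul_assoc]
  smul_zero s := zero_mul (Enveloping.i k S L s)
  smul_add s u v := add_mul u.val v.val (Enveloping.i k S L s)
  add_smul s t u := by
    change u.val * Enveloping.i k S L (s + t) =
      u.val * Enveloping.i k S L s + u.val * Enveloping.i k S L t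
    rw [map_add, mul_add]
  zero_smul u := by
    change u.val * Enveloping.i k S L 0 = 0
    rw [map_zero, mul_zero]

lemma s_smul_def (s : S) (u : URight k S L) : s • u = of (u.val * Enveloping.i k S L s) := rfl

instance : SMulCommClass S (Enveloping k S L) (URight k S L) where
  smul_comm s v u := mul_assoc v u.val (Enveloping.i k S L s)

instance : SMulCommClass S k (URight k S L) where
  smul_comm s c u := smul_mul_assoc c u.val (Enveloping.i k S L s)

end URight

variable {k S L}

/-- The left `U`-module `U ⊗_S N`, where `S` acts on `U` by right multiplication. -/
abbrev FTensor (N : ModuleCat.{u} (Enveloping k S L)) : Type u :=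
  URight k S L ⊗[S] (ModuleCat.restrictScalars (Enveloping.i k S L).toRingHom).obj N

/-- The element `u ⊗ n` of `U ⊗_S N`. -/
def ftmul {N : ModuleCat.{u} (Enveloping k S L)} (u : Enveloping k S L) (n : N) : FTensor N :=
  TensorProduct.tmul S (URight.of u)
    (show (ModuleCat.restrictScalars (Enveloping.i k S L).toRingHom).obj N from n)

section

variable {N : ModuleCat.{u} (Enveloping k S L)}

lemma ftmul_add (u : Enveloping k S L) (n n' : N) :
    ftmul u (n + n') = ftmul u n + ftmul u n' := TensorProduct.tmul_add _ _ _

lemma ftmul_sub (u : Enveloping k S L) (n n' : N) :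
    ftmul u (n - n') = ftmul u n - ftmul u n' := TensorProduct.tmul_sub _ _ _

lemma add_ftmul (u u' : Enveloping k S L) (n : N) :
    ftmul (u + u') n = ftmul u n + ftmul u' n := TensorProduct.add_tmul _ _ _

lemma sub_ftmul (u u' : Enveloping k S L) (n : N) :
    ftmul (u - u') n = ftmul u n - ftmul u' n := TensorProduct.sub_tmul _ _ _

lemma ftmul_neg (u : Enveloping k S L) (n : N) : ftmul u (-n) = -ftmul u n :=
  TensorProduct.tmul_neg _ _

lemma neg_ftmul (u : Enveloping k S L) (n : N) : ftmul (-u) n = -ftmul u n :=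
  TensorProduct.neg_tmul _ _

lemma ftmul_i_smul (u : Enveloping k S L) (s : S) (n : N) :
    ftmul u (Enveloping.i k S L s • n) = ftmul (u * Enveloping.i k S L s) n :=
  (TensorProduct.smul_tmul s (URight.of u)
    (show (ModuleCat.restrictScalars (Enveloping.i k S L).toRingHom).obj N from n)).symm

lemma smul_ftmul (v u : Enveloping k S L) (n : N) :
    v • ftmul u n = ftmul (v * u) n := rfl

lemma k_smul_ftmul (c : k) (u : Enveloping k S L) (n : N) :
    c • ftmul u n = ftmul (c • u) n := rfl

/-- Constructor for `U`-linear maps out of `U ⊗_S N`. -/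
def FTensor.lift {X : Type u} [AddCommGroup X] [Module (Enveloping k S L) X]
    (b : Enveloping k S L → N → X)
    (h₁ : ∀ u u' n, b (u + u') n = b u n + b u' n)
    (h₂ : ∀ u n n', b u (n + n') = b u n + b u n')
    (h₃ : ∀ u s n, b (u * Enveloping.i k S L s) n = b u (Enveloping.i k S L s • n))
    (h₄ : ∀ v u n, b (v * u) n = v • b u n) :
    FTensor N →ₗ[Enveloping k S L] X where
  toFun := TensorProduct.liftAddHom
    (AddMonoidHom.mk' (fun u : URight k S L => AddMonoidHom.mk'
        (fun n : (ModuleCat.restrictScalars (Enveloping.i k S L).toRingHom).obj N => b u.val n)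
        (fun n n' => h₂ u.val n n'))
      (fun u u' => AddMonoidHom.ext fun n => h₁ u.val u'.val n))
    (fun s u n => h₃ u.val s n)
  map_add' x y := map_add _ x y
  map_smul' v x := by
    induction x using TensorProduct.induction_on with
    | zero => rw [smul_zero, map_zero, smul_zero]
    | tmul u n => exact h₄ v u.val n
    | add x y hx hy => rw [smul_add, map_add, hx, hy, map_add, smul_add]

lemma FTensor.lift_ftmul {X : Type u} [AddCommGroup X] [Module (Enveloping k S L) X]
    (b : Enveloping k S L → N → X) (h₁ h₂ h₃ h₄) (u : Enveloping k S L) (n : N) :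
    FTensor.lift b h₁ h₂ h₃ h₄ (ftmul u n) = b u n := rfl

lemma FTensor.hom_ext {X : Type u} [AddCommGroup X] [Module (Enveloping k S L) X]
    {f g : FTensor N →ₗ[Enveloping k S L] X} (h : ∀ u n, f (ftmul u n) = g (ftmul u n)) :
    f = g := by
  refine LinearMap.ext fun x => ?_
  induction x using TensorProduct.induction_on with
  | zero => rw [map_zero, map_zero]
  | tmul u n => exact h u n
  | add x y hx hy => rw [map_add, map_add, hx, hy]

end

/-- The right action of `t : S` on `U ⊗_S N`: `u ⊗ n ↦ u ⊗ t n`. -/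
def rightSEnd (N : ModuleCat.{u} (Enveloping k S L)) (t : S) :
    Module.End (Enveloping k S L) (FTensor N) :=
  FTensor.lift (fun u n => ftmul u (Enveloping.i k S L t • n))
    (fun u u' n => add_ftmul _ _ _)
    (fun u n n' => by rw [smul_add, ftmul_add])
    (fun u s n => by rw [← ftmul_i_smul, smul_smul, smul_smul, ← map_mul, ← map_mul, mul_comm])
    (fun v u n => (smul_ftmul _ _ _).symm)

lemma rightSEnd_ftmul (N : ModuleCat.{u} (Enveloping k S L)) (t : S) (u : Enveloping k S L)
    (n : N) : rightSEnd N t (ftmul u n) = ftmul u (Enveloping.i k S L t • n) := rfl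

/-- The right action of `α : L` on `U ⊗_S N`: `u ⊗ n ↦ u α ⊗ n - u ⊗ α n`. -/
def rightLEnd (N : ModuleCat.{u} (Enveloping k S L)) (α : L) :
    Module.End (Enveloping k S L) (FTensor N) :=
  FTensor.lift (fun u n => ftmul (u * Enveloping.j k S L α) n - ftmul u (Enveloping.j k S L α • n))
    (fun u u' n => by rw [add_mul, add_ftmul, add_ftmul]; abel)
    (fun u n n' => by rw [smul_add, ftmul_add, ftmul_add]; abel)
    (fun u s n => by
      have h := Enveloping.j_mul_i_sub k S L α s
      rw [ftmul_i_smul, ← ftmul_i_smul u s, smul_smul, smul_smul, sub_eq_sub_iff_sub_eq_sub,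
        ← sub_ftmul, ← ftmul_sub, ← sub_smul,
        mul_assoc, mul_assoc, ← mul_sub, ← neg_sub, h, neg_smul, mul_neg, neg_ftmul, ftmul_neg,
        ftmul_i_smul])
    (fun v u n => by rw [smul_sub, smul_ftmul, smul_ftmul, mul_assoc])

lemma rightLEnd_ftmul (N : ModuleCat.{u} (Enveloping k S L)) (α : L) (u : Enveloping k S L)
    (n : N) : rightLEnd N α (ftmul u n) =
      ftmul (u * Enveloping.j k S L α) n - ftmul u (Enveloping.j k S L α • n) := rfl

lemma i_smul_ofScalar (N : ModuleCat.{u} (Enveloping k S L)) (c : k) (u : Enveloping k S L)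
    (n : N) : ftmul u (algebraMap k (Enveloping k S L) c • n) = c • ftmul u n := by
  rw [← AlgHom.commutes (Enveloping.i k S L), ftmul_i_smul, AlgHom.commutes, k_smul_ftmul,
    Algebra.smul_def, Algebra.commutes]

/-- The right action of `S` on `U ⊗_S N`. -/
def rightS (N : ModuleCat.{u} (Enveloping k S L)) :
    S →ₐ[k] (Module.End (Enveloping k S L) (FTensor N))ᵐᵒᵖ :=
  AlgHom.ofLinearMap
    { toFun := fun t => MulOpposite.op (rightSEnd N t)
      map_add' := fun t t' => congrArg MulOpposite.op <| FTensor.hom_ext fun u n => by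
        change _ = rightSEnd N t (ftmul u n) + rightSEnd N t' (ftmul u n)
        rw [rightSEnd_ftmul, rightSEnd_ftmul, rightSEnd_ftmul, map_add, add_smul, ftmul_add]
      map_smul' := fun c t => congrArg MulOpposite.op <| FTensor.hom_ext fun u n => by
        rw [RingHom.id_apply]
        refine Eq.trans ?_ (LinearMap.smul_apply c (rightSEnd N t) (ftmul u n)).symm
        rw [rightSEnd_ftmul, rightSEnd_ftmul, Algebra.smul_def, map_mul, AlgHom.commutes,
          mul_smul, i_smul_ofScalar] }
    (congrArg MulOpposite.op <| FTensor.hom_ext fun u n => by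
      rw [rightSEnd_ftmul, map_one, one_smul, Module.End.one_apply])
    (fun t t' => congrArg MulOpposite.op <| FTensor.hom_ext fun u n => by
      change _ = rightSEnd N t' (rightSEnd N t (ftmul u n))
      rw [rightSEnd_ftmul, rightSEnd_ftmul, rightSEnd_ftmul, smul_smul, ← map_mul, mul_comm])

/-- The right action of `L` on `U ⊗_S N`. -/
def rightL (N : ModuleCat.{u} (Enveloping k S L)) :
    L →ₗ[k] (Module.End (Enveloping k S L) (FTensor N))ᵐᵒᵖ where
  toFun α := MulOpposite.op (rightLEnd N α)
  map_add' α β := congrArg MulOpposite.op <| FTensor.hom_ext fun u n => by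
    change _ = rightLEnd N α (ftmul u n) + rightLEnd N β (ftmul u n)
    rw [rightLEnd_ftmul, rightLEnd_ftmul, rightLEnd_ftmul, map_add, add_smul, ftmul_add, mul_add, add_ftmul]
    abel
  map_smul' c α := congrArg MulOpposite.op <| FTensor.hom_ext fun u n => by
    rw [RingHom.id_apply]
    refine Eq.trans ?_ (LinearMap.smul_apply c (rightLEnd N α) (ftmul u n)).symm
    rw [rightLEnd_ftmul, rightLEnd_ftmul, map_smul, mul_smul_comm, ← k_smul_ftmul, smul_sub]
    rw [Algebra.smul_def, mul_smul, i_smul_ofScalar]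

lemma rightS_unop (N : ModuleCat.{u} (Enveloping k S L)) (t : S) :
    (rightS N t).unop = rightSEnd N t := rfl

lemma rightL_unop (N : ModuleCat.{u} (Enveloping k S L)) (α : L) :
    (rightL N α).unop = rightLEnd N α := rfl

lemma rightL_lie (N : ModuleCat.{u} (Enveloping k S L)) (α β : L) :
    rightL N ⁅α, β⁆ = rightL N α * rightL N β - rightL N β * rightL N α := by
  refine MulOpposite.unop_injective (FTensor.hom_ext fun u n => ?_)
  simp only [MulOpposite.unop_sub, MulOpposite.unop_mul, rightL_unop, LinearMap.sub_apply,
    Module.End.mul_apply, rightLEnd_ftmul, map_sub, Enveloping.j_lie, mul_sub, sub_smul, sub_ftmul,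
    ftmul_sub, mul_assoc, mul_smul]
  abel

lemma rightS_mul_rightL (N : ModuleCat.{u} (Enveloping k S L)) (s : S) (α : L) :
    rightS N s * rightL N α = rightL N (s • α) := by
  refine MulOpposite.unop_injective (FTensor.hom_ext fun u n => ?_)
  have h := Enveloping.j_mul_i_sub k S L α s
  rw [sub_eq_iff_eq_add] at h
  rw [MulOpposite.unop_mul, Module.End.mul_apply, rightS_unop, rightL_unop, rightL_unop,
    rightSEnd_ftmul, rightLEnd_ftmul, rightLEnd_ftmul, ← Enveloping.i_mul_j, ftmul_i_smul,
    smul_smul, mul_assoc, h, mul_add, add_ftmul, add_smul, ftmul_add, ftmul_i_smul]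
  abel

lemma rightL_mul_rightS_sub (N : ModuleCat.{u} (Enveloping k S L)) (α : L) (s : S) :
    rightL N α * rightS N s - rightS N s * rightL N α = rightS N ⁅α, s⁆ := by
  refine MulOpposite.unop_injective (FTensor.hom_ext fun u n => ?_)
  simp only [MulOpposite.unop_sub, MulOpposite.unop_mul, rightL_unop, rightS_unop,
    LinearMap.sub_apply, Module.End.mul_apply, rightSEnd_ftmul, rightLEnd_ftmul, map_sub,
    ← Enveloping.j_mul_i_sub, sub_smul, ftmul_sub, mul_smul]
  abel

/-- The right action of `U` on `U ⊗_S N` determined by those of `S` and `L`. -/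
def rightU (N : ModuleCat.{u} (Enveloping k S L)) :
    Enveloping k S L →ₐ[k] (Module.End (Enveloping k S L) (FTensor N))ᵐᵒᵖ :=
  Enveloping.lift (rightS N) (rightL N) (rightL_lie N) (rightS_mul_rightL N)
    (rightL_mul_rightS_sub N)

/-- The right action of `U` on `U ⊗_S N`, as a left action of the opposite algebra. -/
def actUop (N : ModuleCat.{u} (Enveloping k S L)) :
    (Enveloping k S L)ᵐᵒᵖ →ₐ[k] Module.End k (FTensor N) where
  toFun v := (rightU N v.unop).unop.restrictScalars k
  map_one' := by rw [MulOpposite.unop_one, map_one]; rfl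
  map_mul' v w := by rw [MulOpposite.unop_mul, map_mul]; rfl
  map_zero' := by rw [MulOpposite.unop_zero, map_zero]; rfl
  map_add' v w := by rw [MulOpposite.unop_add, map_add]; rfl
  commutes' c := by
    rw [MulOpposite.algebraMap_apply, MulOpposite.unop_op, AlgHom.commutes]
    rfl

lemma commute_actUop (N : ModuleCat.{u} (Enveloping k S L)) (u : Enveloping k S L)
    (v : (Enveloping k S L)ᵐᵒᵖ) : Commute (Algebra.lsmul k k (FTensor N) u) (actUop N v) :=
  LinearMap.ext fun x => ((rightU N v.unop).unop.map_smul u x).symm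

/-- The action of `Uᵉ` on `U ⊗_S N`: the first factor acts by left multiplication on `U`, the
second one through the right action of `U`. -/
def actF (N : ModuleCat.{u} (Enveloping k S L)) :
    Env k (Enveloping k S L) →ₐ[k] Module.End k (FTensor N) :=
  Algebra.TensorProduct.lift (Algebra.lsmul k k (FTensor N)) (actUop N) (commute_actUop N)

/-- The `Uᵉ`-module `F(N) = U ⊗_S N`. -/
def F (N : ModuleCat.{u} (Enveloping k S L)) : ModuleCat.{u} (Env k (Enveloping k S L)) :=
  letI : Module (Env k (Enveloping k S L)) (FTensor N) :=
    Module.compHom (FTensor N) (actF N).toRingHom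
  ModuleCat.of (Env k (Enveloping k S L)) (FTensor N)

/-- The element `u ⊗ n` of `F(N)`. -/
def F.tmul {N : ModuleCat.{u} (Enveloping k S L)} (u : Enveloping k S L) (n : N) : F N :=
  ftmul u n

lemma F.lam_smul {N : ModuleCat.{u} (Enveloping k S L)} (v u : Enveloping k S L) (n : N) :
    lam v • (F.tmul u n : F N) = F.tmul (v * u) n := by
  change actF N (lam v) (ftmul u n) = ftmul (v * u) n
  rw [actF, lam, Algebra.TensorProduct.lift_tmul, map_one, mul_one]
  exact smul_ftmul v u n

lemma F.rho_i_smul {N : ModuleCat.{u} (Enveloping k S L)} (s : S) (u : Enveloping k S L) (n : N) :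
    rho (Enveloping.i k S L s) • (F.tmul u n : F N) = F.tmul u (Enveloping.i k S L s • n) := by
  change actF N (rho _) (ftmul u n) = ftmul u _
  rw [actF, rho, Algebra.TensorProduct.lift_tmul, map_one, one_mul]
  change (rightU N (Enveloping.i k S L s)).unop (ftmul u n) = _
  rw [rightU, Enveloping.lift_i]
  rfl

lemma F.rho_j_smul {N : ModuleCat.{u} (Enveloping k S L)} (α : L) (u : Enveloping k S L) (n : N) :
    rho (Enveloping.j k S L α) • (F.tmul u n : F N) =
      F.tmul (u * Enveloping.j k S L α) n - F.tmul u (Enveloping.j k S L α • n) := by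
  change actF N (rho _) (ftmul u n) = ftmul _ _ - ftmul _ _
  rw [actF, rho, Algebra.TensorProduct.lift_tmul, map_one, one_mul]
  change (rightU N (Enveloping.j k S L α)).unop (ftmul u n) = _
  rw [rightU, Enveloping.lift_j]
  rfl

end FunctorF

section Cohomology

variable {k S L : Type u} [Field k] [CommRing S] [Algebra k S] [LieRing L] [LieAlgebra k L]
  [Module S L] [LieRingModule L S] [LieRinehartRing S L] [LieRinehartAlgebra k S L]

/-- The augmentation `Z → R^0` of an injective resolution. -/
def augmentation {C : Type*} [Category C] [Abelian C] {Z : C} (R : InjectiveResolution Z) :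
    Z ⟶ R.cocomplex.X 0 := R.ι.f 0

/-- A comparison of a `Uᵉ`-injective resolution `I` of `M`, regarded as a complex of `Sᵉ`-modules,
with an `Sᵉ`-injective resolution `J` of `M`: a morphism of complexes that lifts the identity
of `M`. -/
structure Comparison {M : ModuleCat.{u} (Env k (Enveloping k S L))} (I : InjectiveResolution M)
    (J : InjectiveResolution ((res k S L).obj M)) where
  f (n : ℕ) : (res k S L).obj (I.cocomplex.X n) ⟶ J.cocomplex.X n
  comm (n : ℕ) : f n ≫ J.cocomplex.d n (n + 1) =
    (res k S L).map (I.cocomplex.d n (n + 1)) ≫ f (n + 1)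
  augmentation_comm : (res k S L).map (augmentation I) ≫ f 0 = augmentation J

/-- An element of `Hom_{Sᵉ}(S, M)` as a morphism of `Sᵉ`-modules. -/
def GHom.toHom {M : ModuleCat.{u} (Env k (Enveloping k S L))} (φ : GHom M) :
    diagonalModule k S ⟶ (res k S L).obj M :=
  ModuleCat.ofHom (X := diagonalModule k S) (Y := (res k S L).obj M) φ

/-- The class in `H^q(S, M) = Ext_{Sᵉ}^q(S, M)` of a `q`-cocycle `φ` of the complex `G(I)`. -/
def Comparison.cls {M : ModuleCat.{u} (Env k (Enveloping k S L))} {I : InjectiveResolution M}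
    {J : InjectiveResolution ((res k S L).obj M)} (f : Comparison I J) (q : ℕ)
    (φ : GHom (I.cocomplex.X q)) (hφ : GHom.map (I.cocomplex.d q (q + 1)) φ = 0) :
    HochschildCohomology k S ((res k S L).obj M) q :=
  J.extMk (GHom.toHom φ ≫ f.f q) (q + 1) rfl (by
    have h : GHom.toHom φ ≫ (res k S L).map (I.cocomplex.d q (q + 1)) = 0 :=
      ModuleCat.hom_ext hφ
    rw [Category.assoc, f.comm, reassoc_of% h, Limits.zero_comp])

/-- The condition that a `U`-module structure `μ` on `H^q(S, M)` is the one induced by that of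
`G(I^q)` for the `Uᵉ`-injective resolutions `M → I`: for each `u : U` and each `q`-cocycle `φ` of
`G(I)`, the product of `u` with the class of `φ` is the class of `u • φ`. -/
def IsInduced (M : ModuleCat.{u} (Env k (Enveloping k S L))) (q : ℕ)
    (μ : Module (Enveloping k S L) (HochschildCohomology k S ((res k S L).obj M) q)) : Prop :=
  ∀ (I : InjectiveResolution M) (J : InjectiveResolution ((res k S L).obj M))
    (f : Comparison I J) (u : Enveloping k S L) (φ : GHom (I.cocomplex.X q))
    (hφ : GHom.map (I.cocomplex.d q (q + 1)) φ = 0),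
    u • f.cls q φ hφ = f.cls q (u • φ) (by rw [map_smul, hφ, smul_zero])

/-- The Hochschild cohomology `H^q(S, M)` with a given structure of `U`-module. -/
def hochschildModule (M : ModuleCat.{u} (Env k (Enveloping k S L))) (q : ℕ)
    (μ : Module (Enveloping k S L) (HochschildCohomology k S ((res k S L).obj M) q)) :
    ModuleCat.{u} (Enveloping k S L) :=
  letI := μ
  ModuleCat.of (Enveloping k S L) (HochschildCohomology k S ((res k S L).obj M) q)

end Cohomology

section SpectralSequence

variable {k : Type u} [Field k]

/-- The limit term `E_∞^{p,q}` of a first-quadrant spectral sequence. For `r ≥ p + q + 2` the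
differentials of the page `E_r` into and out of the position `(p, q)` vanish, because their other
end lies outside the first quadrant, so that `E_r^{p,q}` is the same for all these `r`. -/
abbrev pageInfinity (E : E₂CohomologicalSpectralSequenceNat (ModuleCat.{u} k)) (p q : ℕ) :
    ModuleCat.{u} k :=
  (E.page (p + q + 2)).X (p, q)

/-- A first-quadrant spectral sequence of vector spaces converges to `A` if each `A n` has a
filtration `A n = Φ 0 ⊇ Φ 1 ⊇ ... ⊇ Φ (n + 1) = 0` with `Φ p / Φ (p + 1) ≅ E_∞^{p, n - p}`. -/
def ConvergesTo (E : E₂CohomologicalSpectralSequenceNat (ModuleCat.{u} k)) (A : ℕ → Type u)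
    [∀ n, AddCommGroup (A n)] [∀ n, Module k (A n)] : Prop :=
  ∀ n : ℕ, ∃ Φ : ℕ → Submodule k (A n), Antitone Φ ∧ Φ 0 = ⊤ ∧ Φ (n + 1) = ⊥ ∧
    ∀ p q : ℕ, p + q = n →
      Nonempty ((Φ p ⧸ (Φ (p + 1)).submoduleOf (Φ p)) ≃ₗ[k] pageInfinity E p q)

end SpectralSequence

end LieRinehart

end

/-! The result is a Grothendieck spectral sequence. The functor `G` is right adjoint to `F`
(`homEquiv`), so that Hom(F(N), I) = Hom(N, G(I)) for an injective resolution I of M by Uᵉ-modules.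
Two flatness statements make this useful. As U is flat as a right S-module, `F` preserves
monomorphisms, hence `G` preserves injectives. As Uᵉ is flat as a right Sᵉ-module, I stays an
injective resolution over Sᵉ, so that the cohomology of G(I) is H^q(S, M).

The second fact also gives part (1). The groups H^q(S, M) are cocycles modulo coboundaries of a
complex of U-modules. Comparison maps between Uᵉ-resolutions induce U-linear maps on G, so one
resolution decides the action for all of them (`isInduced_iff`).

For part (2), the complex G(I) is bounded below with injective terms, hence K-injective. Its
truncations for the canonical t-structure form a spectral object, to which Hom(N, -) is applied in
the derived category. A truncation to one degree q is H^q(S, M) placed in that degree, which gives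
Ext^p(N, H^q(S, M)) on the second page (`nonempty_page_two_equiv`). The abutment Hom(N, G(I)[n]) is
the cohomology of Hom(N, G(I)) = Hom(F(N), I), that is, Ext^n(F(N), M) (`homGComplexEquivExt`).
Convergence is read off the spectral object (`convergesTo`).

Flatness rests on a Poincaré-Birkhoff-Witt theorem. If L has an ordered basis, L is made to act on
polynomials by a recursion that imitates reordering in U; compatibility with brackets follows from
the Jacobi identity by induction on the degree (`mon_mem_compatible`). This makes U free over S on
the left, and a unitriangularity argument makes it free on the right on the same monomials. If L is
only projective, the Eilenberg swindle gives a free module P with L ⊕ P free. The semidirect product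
of L with P is again a Lie-Rinehart algebra, and U(L) is a retract of its enveloping algebra,
compatibly with S. Free bases therefore descend to dual bases, which give projectivity. -/

set_option linter.unusedSectionVars false

noncomputable section

namespace LieRinehart

/-! ### Poincaré-Birkhoff-Witt: the action on polynomials when L has an ordered basis -/

namespace PBW

section Multiset

variable {ι : Type*} [LinearOrder ι]

lemma exists_min_of_mem {M : Multiset ι} {a : ι} (ha : a ∈ M) : ∃ j ∈ M, ∀ c ∈ M, j ≤ c := by
  obtain ⟨j, hj, h⟩ := M.toFinset.exists_min_image id ⟨a, by simpa using ha⟩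
  exact ⟨j, by simpa using hj, fun c hc => h c (by simpa using hc)⟩

lemma exists_min_lt {M : Multiset ι} {i : ι} (h : ∃ a ∈ M, a < i) :
    ∃ j ∈ M, (∀ c ∈ M, j ≤ c) ∧ j < i := by
  obtain ⟨a, ha, hai⟩ := h
  obtain ⟨j, hj, hjm⟩ := exists_min_of_mem ha
  exact ⟨j, hj, hjm, (hjm a ha).trans_lt hai⟩

lemma eq_min_cons {M : Multiset ι} (hM : M ≠ 0) :
    ∃ j N, M = j ::ₘ N ∧ ∀ c ∈ N, j ≤ c := by
  obtain ⟨a, ha⟩ := Multiset.exists_mem_of_ne_zero hM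
  obtain ⟨j, hj, h⟩ := exists_min_of_mem ha
  exact ⟨j, M.erase j, (Multiset.cons_erase hj).symm, fun c hc => h c (Multiset.mem_of_mem_erase hc)⟩

end Multiset

variable {S L : Type u} [CommRing S] [LieRing L] [Module S L] [LieRingModule L S]
  {ι : Type u} [LinearOrder ι] (b : Module.Basis ι S L)

variable (S ι) in
/-- The free `S`-module on the ordered monomials in the variables indexed by `ι`. -/
abbrev Poly : Type u := Multiset ι →₀ S

/-- The monomial with given exponents. -/
abbrev mon (M : Multiset ι) : Poly S ι := Finsupp.single M 1

/-- The action of `α : L` on the coefficients of a polynomial. -/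
def coeffLie (α : L) : Poly S ι →+ Poly S ι :=
  Finsupp.mapRange.addMonoidHom (AddMonoidHom.mk' (fun s => ⁅α, s⁆) (lie_add α))

lemma coeffLie_apply (α : L) (p : Poly S ι) (M : Multiset ι) : coeffLie α p M = ⁅α, p M⁆ := rfl

open Classical in
/-- The value on the monomial `M` of the operator by which the basis element `b i` acts on
polynomials. -/
def opMon (M : Multiset ι) (i : ι) : Poly S ι :=
  -- With j the least element of M and M = jN, the value is forced by b_i b_j N = b_j (b_i N) +
  -- [b_i, b_j] N. Here b_i N is the monomial iN plus a remainder w of degree at most |N|, and b_j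
  -- sends iN to the monomial iM. What is left to add is b_j w, computed on coefficients and on
  -- monomials, and the bracket term.
  if h : ∃ a ∈ M, a < i then
    have hj : (exists_min_lt h).choose ∈ M := (exists_min_lt h).choose_spec.1
    mon (i ::ₘ M) +
      (coeffLie (b (exists_min_lt h).choose)
          (opMon (M.erase (exists_min_lt h).choose) i -
            mon (i ::ₘ M.erase (exists_min_lt h).choose)) +
        Finsupp.linearCombination S
          -- The guard is there for termination. It holds for every Q in the support of w by
          -- `opMon_sub_mem`, so the default value 0 never contributes.
          (fun Q => if _hQ : Q.card < M.card then opMon Q (exists_min_lt h).choose else 0)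
          (opMon (M.erase (exists_min_lt h).choose) i -
            mon (i ::ₘ M.erase (exists_min_lt h).choose))) +
      b.constr S (fun l => opMon (M.erase (exists_min_lt h).choose) l)
        ⁅b i, b (exists_min_lt h).choose⁆
  else mon (i ::ₘ M)
termination_by M.card
decreasing_by
  all_goals first
    | exact _hQ
    | (rw [Multiset.card_erase_of_mem hj]; exact Nat.pred_lt (by
        have := Multiset.card_pos_iff_exists_mem.mpr ⟨_, hj⟩; omega))

/-- The operator by which `α : L` acts on polynomials. -/
def op (α : L) : Poly S ι →+ Poly S ι :=
  coeffLie α + (Finsupp.linearCombination S (fun M => b.constr S (opMon b M) α)).toAddMonoidHom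

lemma op_apply (α : L) (p : Poly S ι) : op b α p =
    coeffLie α p + Finsupp.linearCombination S (fun M => b.constr S (opMon b M) α) p := rfl

lemma op_add_left (α β : L) (p : Poly S ι) : op b (α + β) p = op b α p + op b β p := by
  have h1 : coeffLie (α + β) p = coeffLie α p + coeffLie β p := by
    ext M; simp [coeffLie_apply]
  simp only [op_apply, h1, map_add, Finsupp.linearCombination_apply, smul_add, Finsupp.sum_add]
  abel

/-- The polynomials of degree at most `n`. -/
def degLE (n : ℕ) : Submodule S (Poly S ι) := Finsupp.supported S S {M | M.card ≤ n}

lemma degLE_mono {m n : ℕ} (h : m ≤ n) : degLE (S := S) (ι := ι) m ≤ degLE n :=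
  Finsupp.supported_mono fun _ hM => le_trans hM h

lemma mon_mem_degLE {n : ℕ} {M : Multiset ι} (h : M.card ≤ n) : (mon M : Poly S ι) ∈ degLE n :=
  Finsupp.single_mem_supported S 1 h

lemma coeffLie_mem_degLE {n : ℕ} (α : L) {p : Poly S ι} (hp : p ∈ degLE n) :
    coeffLie α p ∈ degLE n :=
  fun _ hM => hp (Finsupp.support_mapRange (hf := map_zero _) hM)

lemma linearCombination_mem {P : Type*} [AddCommGroup P] [Module S P] (W : Submodule S P)
    {n : ℕ} {p : Poly S ι} (hp : p ∈ degLE n) (f : Multiset ι → P)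
    (hf : ∀ M, M.card ≤ n → f M ∈ W) : Finsupp.linearCombination S f p ∈ W :=
  Submodule.sum_mem _ fun M hM => W.smul_mem _ (hf M (hp hM))

lemma opMon_of_le {M : Multiset ι} {i : ι} (h : ∀ a ∈ M, i ≤ a) :
    opMon b M i = mon (i ::ₘ M) := by
  rw [opMon, dif_neg]
  rintro ⟨a, ha, hai⟩
  exact absurd (h a ha) (not_le.mpr hai)

lemma constr_mem (W : Submodule S (Poly S ι)) (f : ι → Poly S ι) (hf : ∀ i, f i ∈ W) (α : L) :
    b.constr S f α ∈ W := by
  rw [Module.Basis.constr_apply]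
  exact Submodule.sum_mem _ fun i _ => W.smul_mem _ (hf i)

/-- Every correction in the recursion applies an operator to something of degree below |M|, so none
exceeds degree |M|. This discharges the guard in `opMon` and isolates the leading monomial in later
inductions. -/
lemma opMon_sub_mem (M : Multiset ι) (i : ι) : opMon b M i - mon (i ::ₘ M) ∈ degLE M.card := by
  induction hn : M.card using Nat.strong_induction_on generalizing M i with
  | _ n ih =>
  subst hn
  have key : ∀ Q : Multiset ι, Q.card < M.card → ∀ l, opMon b Q l ∈ degLE (S := S) M.card := by
    intro Q hQ l
    have h1 := degLE_mono hQ.le (ih _ hQ Q l rfl)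
    simpa using Submodule.add_mem _ h1 (mon_mem_degLE (S := S)
      (M := l ::ₘ Q) (by rw [Multiset.card_cons]; exact hQ))
  by_cases h : ∃ a ∈ M, a < i
  · rw [opMon, dif_pos h]
    obtain ⟨hj, -, -⟩ := (exists_min_lt h).choose_spec
    have hc : (M.erase (exists_min_lt h).choose).card < M.card := by
      have := Multiset.card_pos_iff_exists_mem.mpr ⟨_, hj⟩
      rw [Multiset.card_erase_of_mem hj]; exact Nat.pred_lt (by omega)
    have hw := ih _ hc _ i rfl
    rw [add_assoc, add_sub_cancel_left]
    refine Submodule.add_mem _ (Submodule.add_mem _ (coeffLie_mem_degLE _ (degLE_mono hc.le hw))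
      (linearCombination_mem _ hw _ fun Q hQ => ?_)) (constr_mem b _ _ (fun l => key _ hc l) _)
    rw [dif_pos (hQ.trans_lt hc)]
    exact key _ (hQ.trans_lt hc) _
  · rw [opMon, dif_neg h, sub_self]
    exact Submodule.zero_mem _

variable [LieRinehartRing S L]

lemma lie_one_eq_zero (α : L) : ⁅α, (1 : S)⁆ = 0 := by
  simpa using LieRinehartRing.leibniz_mul_right α (1 : S) 1

lemma coeffLie_mon (α : L) (M : Multiset ι) : coeffLie α (mon M : Poly S ι) = 0 := by
  ext N
  rw [coeffLie_apply, Finsupp.single_apply]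
  split_ifs <;> simp [lie_one_eq_zero]

lemma op_mon (α : L) (M : Multiset ι) : op b α (mon M) = b.constr S (opMon b M) α := by
  rw [op_apply, coeffLie_mon, zero_add]
  simp

lemma op_basis_mon (i : ι) (M : Multiset ι) : op b (b i) (mon M) = opMon b M i := by
  rw [op_mon, Module.Basis.constr_basis]

lemma op_basis_mon_of_le {M : Multiset ι} {i : ι} (h : ∀ a ∈ M, i ≤ a) :
    op b (b i) (mon M) = mon (i ::ₘ M) := by
  rw [op_basis_mon, opMon_of_le b h]

lemma op_smul_left (s : S) (α : L) (p : Poly S ι) : op b (s • α) p = s • op b α p := by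
  have h1 : coeffLie (s • α) p = s • coeffLie α p := by
    ext M; simp [coeffLie_apply]
  simp only [op_apply, h1, map_smul, Finsupp.linearCombination_apply, smul_add, Finsupp.smul_sum,
    smul_comm s]

lemma op_smul (α : L) (s : S) (p : Poly S ι) : op b α (s • p) = s • op b α p + ⁅α, s⁆ • p := by
  have h1 : coeffLie α (s • p) = s • coeffLie α p + ⁅α, s⁆ • p := by
    ext M; simp [coeffLie_apply]
  simp only [op_apply, h1, map_smul, smul_add]
  abel

lemma op_sub_left (α β : L) (p : Poly S ι) : op b (α - β) p = op b α p - op b β p := by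
  rw [eq_sub_iff_add_eq, ← op_add_left, sub_add_cancel]

lemma op_mem_degLE (α : L) {n : ℕ} {p : Poly S ι} (hp : p ∈ degLE n) :
    op b α p ∈ degLE (n + 1) := by
  rw [op_apply]
  refine Submodule.add_mem _ (coeffLie_mem_degLE _ (degLE_mono n.le_succ hp))
    (linearCombination_mem _ hp _ fun M hM => constr_mem b _ _ (fun i => ?_) _)
  simpa using Submodule.add_mem _ (degLE_mono (hM.trans n.le_succ) (opMon_sub_mem b M i))
    (mon_mem_degLE (S := S) (n := n + 1) (M := i ::ₘ M) (by simpa using hM))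

/-- The recursion that defines the operators. -/
lemma op_op_mon_of_lt {N : Multiset ι} {i j : ι} (hN : ∀ a ∈ N, j ≤ a) (hji : j < i) :
    op b (b i) (op b (b j) (mon N)) =
      op b (b j) (op b (b i) (mon N)) + op b ⁅b i, b j⁆ (mon N) := by
  rw [op_basis_mon_of_le b hN, op_basis_mon, op_basis_mon]
  have h : ∃ a ∈ j ::ₘ N, a < i := ⟨j, Multiset.mem_cons_self _ _, hji⟩
  obtain ⟨h1, h2, h3⟩ := (exists_min_lt h).choose_spec
  have hj : (exists_min_lt h).choose = j := by
    refine le_antisymm (h2 j (Multiset.mem_cons_self _ _)) ?_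
    rcases Multiset.mem_cons.mp h1 with h | h
    · exact h.ge
    · exact hN _ h
  have hle : ∀ a ∈ i ::ₘ N, j ≤ a := by
    intro a ha
    rcases Multiset.mem_cons.mp ha with rfl | ha
    · exact hji.le
    · exact hN a ha
  -- Splitting off the leading monomial iN, on which j is minimal, leaves b_j applied to the
  -- remainder, which is the correction term of the definition.
  have hrec : op b (b j) (opMon b N i) = mon (i ::ₘ j ::ₘ N) +
      op b (b j) (opMon b N i - mon (i ::ₘ N)) := by
    rw [map_sub, op_basis_mon_of_le b hle, Multiset.cons_swap, add_sub_cancel]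
  have hw : (opMon b N i - mon (i ::ₘ N)) ∈ degLE N.card := opMon_sub_mem b N i
  rw [opMon, dif_pos h]
  dsimp only
  rw [hj, Multiset.erase_cons_head, hrec, op_mon, op_apply]
  congr 3
  rw [Finsupp.linearCombination_apply, Finsupp.linearCombination_apply]
  refine Finsupp.sum_congr fun Q hQ => ?_
  have hQ' : Q.card ≤ N.card := hw hQ
  rw [dif_pos (by rw [Multiset.card_cons]; exact Nat.lt_succ_of_le hQ'),
    Module.Basis.constr_basis]

/-- The failure of the operators to be compatible with brackets. -/
def defect (α β : L) (p : Poly S ι) : Poly S ι :=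
  op b α (op b β p) - op b β (op b α p) - op b ⁅α, β⁆ p

lemma defect_self (α : L) (p : Poly S ι) : defect b α α p = 0 := by
  have : op b (0 : L) p = 0 := by simpa using op_sub_left b (0 : L) 0 p
  rw [defect, lie_self, this, sub_self, sub_zero]

lemma defect_swap (α β : L) (p : Poly S ι) : defect b α β p = -defect b β α p := by
  have : op b ⁅β, α⁆ p = - op b ⁅α, β⁆ p := by
    rw [eq_neg_iff_add_eq_zero, ← op_add_left, ← lie_skew α β, add_neg_cancel]
    simpa using op_sub_left b (0 : L) 0 p
  simp only [defect, this]
  abel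

lemma defect_add_left (α α' β : L) (p : Poly S ι) :
    defect b (α + α') β p = defect b α β p + defect b α' β p := by
  simp only [defect, add_lie, op_add_left, map_add]
  abel

/-- The anchor term created when β moves past s cancels the one in [sα, β], so the defect is
tensorial although the operators are not. -/
lemma defect_smul_left (s : S) (α β : L) (p : Poly S ι) :
    defect b (s • α) β p = s • defect b α β p := by
  have h : ⁅s • α, β⁆ = s • ⁅α, β⁆ - ⁅β, s⁆ • α := by
    rw [← lie_skew, LieRinehartRing.leibniz_smul_right, ← lie_skew α β]
    simp only [smul_neg, neg_add]
    abel
  simp only [defect, h, op_sub_left, op_smul_left, op_smul, smul_sub]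
  abel

lemma defect_add (α β : L) (p q : Poly S ι) :
    defect b α β (p + q) = defect b α β p + defect b α β q := by
  simp only [defect, map_add]
  abel

/-- First-order terms cancel by antisymmetry. The terms where both α and β differentiate s cancel
because L acts on S through a morphism of Lie algebras. -/
lemma defect_smul (α β : L) (s : S) (p : Poly S ι) :
    defect b α β (s • p) = s • defect b α β p := by
  simp only [defect, map_add, op_smul, lie_lie, sub_smul, smul_sub]
  abel

/-- The submodule of the polynomials on which the operators are compatible with brackets. -/
def compatible : Submodule S (Poly S ι) where
  carrier := {p | ∀ α β, defect b α β p = 0}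
  add_mem' hp hq α β := by rw [defect_add, hp, hq, add_zero]
  zero_mem' α β := by simp [defect]
  smul_mem' s p hp α β := by rw [defect_smul, hp, smul_zero]

lemma mem_compatible_of_basis {p : Poly S ι} (h : ∀ i j, defect b (b i) (b j) p = 0) :
    p ∈ compatible b := by
  let B : L →ₗ[S] L →ₗ[S] Poly S ι := LinearMap.mk₂ S (fun α β => defect b α β p)
    (fun α α' β => defect_add_left b α α' β p) (fun s α β => defect_smul_left b s α β p)
    (fun α β β' => by
      rw [defect_swap, defect_add_left, neg_add, ← defect_swap, ← defect_swap])
    (fun s α β => by rw [defect_swap, defect_smul_left, ← smul_neg, ← defect_swap])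
  have hB : B = 0 := b.ext fun i => b.ext fun j => h i j
  intro α β
  exact LinearMap.congr_fun₂ hB α β

/-- For i above j this is the defining recursion. For i below j the index i is minimal too, and the
recursion applies with the roles exchanged. -/
lemma defect_mon_of_le {N : Multiset ι} {i j : ι} (hN : ∀ a ∈ N, j ≤ a) :
    defect b (b i) (b j) (mon N) = 0 := by
  rcases lt_trichotomy j i with h | rfl | h
  · rw [defect, op_op_mon_of_lt b hN h]
    abel
  · exact defect_self b _ _
  · rw [defect_swap, defect, op_op_mon_of_lt b (fun a ha => h.le.trans (hN a ha)) h]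
    abel

/-- Both x and y can be moved past t by `h1`, `h2` and the compatibility on p. What remains of the
defect cancels by the Jacobi identity for x, y, t. -/
lemma defect_op {x y t : L} {p : Poly S ι} (hp : p ∈ compatible b)
    (h1 : defect b x t (op b y p) = 0) (h2 : defect b y t (op b x p) = 0) :
    defect b x y (op b t p) = 0 := by
  have e : ∀ α β, op b α (op b β p) = op b β (op b α p) + op b ⁅α, β⁆ p := fun α β => by
    rw [← sub_eq_iff_eq_add', ← sub_eq_zero]; exact hp α β
  have e1 : op b x (op b t (op b y p)) = op b t (op b x (op b y p)) + op b ⁅x, t⁆ (op b y p) := by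
    rw [← sub_eq_iff_eq_add', ← sub_eq_zero]; exact h1
  have e2 : op b y (op b t (op b x p)) = op b t (op b y (op b x p)) + op b ⁅y, t⁆ (op b x p) := by
    rw [← sub_eq_iff_eq_add', ← sub_eq_zero]; exact h2
  rw [defect, e y t, e x t, map_add, map_add, e1, e2, e x ⁅y, t⁆, e y ⁅x, t⁆, e x y, map_add,
    e ⁅x, y⁆ t, lie_lie x y t, op_sub_left]
  abel

/-- The substance of PBW. If neither i nor j is minimal for N, the least element l of N = lQ lies
strictly below both. Writing N = b_l Q, `defect_op` trades the pair (i, j) for the pairs (i, l) and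
(j, l), acting on b_j Q and b_i Q. -/
lemma mon_mem_compatible (N : Multiset ι) : mon N ∈ compatible b := by
  induction hn : N.card using Nat.strong_induction_on generalizing N with
  | _ n ih =>
  subst hn
  refine mem_compatible_of_basis b fun i j => ?_
  by_cases hj : ∀ a ∈ N, j ≤ a
  · exact defect_mon_of_le b hj
  by_cases hi : ∀ a ∈ N, i ≤ a
  · rw [defect_swap, defect_mon_of_le b hi, neg_zero]
  have hN : N ≠ 0 := by rintro rfl; simp at hi
  obtain ⟨l, Q, rfl, hQ⟩ := eq_min_cons hN
  have hlt : ∀ {i : ι}, ¬ (∀ a ∈ l ::ₘ Q, i ≤ a) → l < i := by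
    intro i hi
    push Not at hi
    obtain ⟨a, ha, hai⟩ := hi
    rcases Multiset.mem_cons.mp ha with rfl | ha
    · exact hai
    · exact (hQ a ha).trans_lt hai
  have hc : Q.card < (l ::ₘ Q).card := by simp
  -- The polynomial b_j Q is the monomial jQ, for which l is minimal, plus terms of degree at most
  -- |Q|, which the induction covers.
  have hw : ∀ {i j : ι}, l < j → defect b (b i) (b l) (op b (b j) (mon Q)) = 0 := by
    intro i j hj
    have h1 : opMon b Q j - mon (j ::ₘ Q) ∈ compatible b := by
      have h := linearCombination_mem (compatible b) (opMon_sub_mem b Q j) mon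
        fun M hM => ih M.card (lt_of_le_of_lt hM hc) M rfl
      have e : Finsupp.linearCombination S (mon : Multiset ι → Poly S ι) = LinearMap.id :=
        Finsupp.lhom_ext' fun M => LinearMap.ext_ring (by simp)
      rwa [e] at h
    have h2 : defect b (b i) (b l) (mon (j ::ₘ Q)) = 0 := by
      refine defect_mon_of_le b fun a ha => ?_
      rcases Multiset.mem_cons.mp ha with rfl | ha
      · exact hj.le
      · exact hQ a ha
    have h3 := defect_add b (b i) (b l) (opMon b Q j - mon (j ::ₘ Q)) (mon (j ::ₘ Q))
    rw [sub_add_cancel, h1, h2, add_zero] at h3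
    rw [op_basis_mon, h3]
  rw [← op_basis_mon_of_le b hQ]
  exact defect_op b (ih _ hc Q rfl) (hw (hlt hj)) (hw (hlt hi))

lemma op_lie (α β : L) (p : Poly S ι) :
    op b ⁅α, β⁆ p = op b α (op b β p) - op b β (op b α p) := by
  have hp : p ∈ compatible b := by
    induction p using Finsupp.induction_linear with
    | zero => exact Submodule.zero_mem _
    | add p q hp hq => exact Submodule.add_mem _ hp hq
    | single M s =>
      rw [← mul_one s, ← smul_eq_mul, ← Finsupp.smul_single]
      exact Submodule.smul_mem _ _ (mon_mem_compatible b M)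
  exact (sub_eq_zero.mp (hp α β)).symm

end PBW

/-! ### Poincaré-Birkhoff-Witt: the enveloping algebra is free over S on both sides -/

namespace PBW

variable (k : Type u) {S L : Type u} [Field k] [CommRing S] [Algebra k S] [LieRing L]
  [LieAlgebra k L] [Module S L] [LieRingModule L S] [LieRinehartRing S L]
  [LieRinehartAlgebra k S L] {ι : Type u} [LinearOrder ι] (b : Module.Basis ι S L)

/-- The action of `L` on polynomials, as a linear map. -/
def opEnd : L →ₗ[k] Module.End k (Poly S ι) where
  toFun α :=
    { toFun := op b α
      map_add' := map_add _
      map_smul' := fun c p => by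
        have h : ⁅α, algebraMap k S c⁆ = 0 := by
          rw [Algebra.algebraMap_eq_smul_one]
          exact (lie_smul c α (1 : S)).trans (by rw [lie_one_eq_zero, smul_zero])
        rw [RingHom.id_apply, ← algebraMap_smul S c p, op_smul, h, zero_smul, add_zero,
          algebraMap_smul] }
  map_add' α β := LinearMap.ext fun p => op_add_left b α β p
  map_smul' c α := LinearMap.ext fun p => by
    change op b (c • α) p = c • op b α p
    rw [← algebraMap_smul S c α, op_smul_left, algebraMap_smul]

/-- The action of the enveloping algebra on polynomials. -/
def act : Enveloping k S L →ₐ[k] Module.End k (Poly S ι) :=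
  Enveloping.lift (A := Module.End k (Poly S ι)) (Algebra.lsmul k k (Poly S ι)) (opEnd k b)
    (fun α β => LinearMap.ext fun p => op_lie b α β p)
    (fun s α => LinearMap.ext fun p => (op_smul_left b s α p).symm)
    (fun α s => LinearMap.ext fun p => by
      change op b α (s • p) - s • op b α p = ⁅α, s⁆ • p
      rw [op_smul, add_sub_cancel_left])

@[simp]
lemma act_i (s : S) (p : Poly S ι) : act k b (Enveloping.i k S L s) p = s • p := by
  rw [act, Enveloping.lift_i]; rfl

@[simp]
lemma act_j (α : L) (p : Poly S ι) : act k b (Enveloping.j k S L α) p = op b α p := by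
  rw [act, Enveloping.lift_j]; rfl

/-- The product in the enveloping algebra of the basis elements in a multiset, in increasing
order. -/
def monU (M : Multiset ι) : Enveloping k S L :=
  ((M.sort (· ≤ ·)).map fun i => Enveloping.j k S L (b i)).prod

@[simp]
lemma monU_zero : monU k b 0 = 1 := by simp [monU]

lemma monU_cons {M : Multiset ι} {i : ι} (h : ∀ a ∈ M, i ≤ a) :
    monU k b (i ::ₘ M) = Enveloping.j k S L (b i) * monU k b M := by
  rw [monU, Multiset.sort_cons _ _ _ h, List.map_cons, List.prod_cons, monU]

lemma monU_induction {motive : Multiset ι → Prop} (zero : motive 0)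
    (cons : ∀ i M, (∀ a ∈ M, i ≤ a) → motive M → motive (i ::ₘ M)) (M : Multiset ι) : motive M := by
  induction hn : M.card generalizing M with
  | zero => rw [Multiset.card_eq_zero.mp hn]; exact zero
  | succ n ih =>
    obtain ⟨i, N, rfl, h⟩ := eq_min_cons (M := M) (by rintro rfl; simp at hn)
    exact cons i N h (ih N (by simpa using hn))

/-- In an increasing product each factor, applied after those to its right, has an index at most all
those already present. No correction appears. -/
lemma act_monU (M : Multiset ι) : act k b (monU k b M) (mon 0) = mon M := by
  induction M using monU_induction with
  | zero => simp
  | cons i M h ih =>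
    rw [monU_cons k b h, map_mul, Module.End.mul_apply, ih, act_j, op_basis_mon_of_le b h]

/-- The map that sends a polynomial `∑ s_M M` to the element `∑ s_M x_M` of the enveloping
algebra. -/
def toU : Poly S ι →+ Enveloping k S L :=
  Finsupp.liftAddHom fun M =>
    (AddMonoidHom.mulRight (monU k b M)).comp (Enveloping.i k S L : S →+ Enveloping k S L)

lemma toU_single (M : Multiset ι) (s : S) :
    toU k b (Finsupp.single M s) = Enveloping.i k S L s * monU k b M := by
  simp [toU]

@[simp]
lemma toU_mon (M : Multiset ι) : toU k b (mon M) = monU k b M := by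
  rw [toU_single, map_one, one_mul]

lemma toU_smul (s : S) (p : Poly S ι) : toU k b (s • p) = Enveloping.i k S L s * toU k b p := by
  induction p using Finsupp.induction_linear with
  | zero => simp
  | add p q hp hq => rw [smul_add, map_add, map_add, hp, hq, mul_add]
  | single M t => rw [Finsupp.smul_single, toU_single, toU_single, smul_eq_mul, map_mul, mul_assoc]

lemma toU_op_smul {α : L} {p : Poly S ι} (h : toU k b (op b α p) = Enveloping.j k S L α * toU k b p)
    (s : S) : toU k b (op b α (s • p)) = Enveloping.j k S L α * toU k b (s • p) := by
  have e := Enveloping.j_mul_i_sub k S L α s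
  rw [sub_eq_iff_eq_add] at e
  rw [op_smul, map_add, toU_smul, toU_smul, toU_smul, h, ← mul_assoc, ← mul_assoc, e, add_mul]
  abel

/-- The submodule of the polynomials on which the map to the enveloping algebra is compatible with
the actions of `L`. -/
def equivariant : Submodule S (Poly S ι) where
  carrier := {p | ∀ α, toU k b (op b α p) = Enveloping.j k S L α * toU k b p}
  add_mem' hp hq α := by rw [map_add, map_add, hp, hq, map_add, mul_add]
  zero_mem' α := by simp
  smul_mem' s p hp α := toU_op_smul k b (hp α) s

lemma mem_equivariant_of_basis {p : Poly S ι}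
    (h : ∀ i, toU k b (op b (b i) p) = Enveloping.j k S L (b i) * toU k b p) :
    p ∈ equivariant k b := by
  intro α
  induction b.mem_span α using Submodule.span_induction with
  | mem x hx => obtain ⟨i, rfl⟩ := hx; exact h i
  | zero =>
    have : op b (0 : L) p = 0 := by simpa using op_sub_left b (0 : L) 0 p
    rw [this, map_zero, map_zero, zero_mul]
  | add x y _ _ hx hy => rw [op_add_left, map_add, hx, hy, map_add, add_mul]
  | smul s x _ hx => rw [op_smul_left, toU_smul, hx, ← Enveloping.i_mul_j, mul_assoc]

lemma mem_of_mem_degLE {n : ℕ} (W : Submodule S (Poly S ι)) (h : ∀ M : Multiset ι, M.card ≤ n → mon M ∈ W)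
    {p : Poly S ι} (hp : p ∈ degLE n) : p ∈ W := by
  have h := linearCombination_mem W hp mon h
  have e : Finsupp.linearCombination S (mon : Multiset ι → Poly S ι) = LinearMap.id :=
    Finsupp.lhom_ext' fun M => LinearMap.ext_ring (by simp)
  rwa [e] at h

/-- The recursion for the operators holds in U as well, where it is the commutation relation for
`j`. Hence the same induction on the degree applies, peeling off the least element. -/
lemma mon_mem_equivariant (M : Multiset ι) : mon M ∈ equivariant k b := by
  induction hn : M.card using Nat.strong_induction_on generalizing M with
  | _ n ih =>
  subst hn
  refine mem_equivariant_of_basis k b fun i => ?_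
  by_cases hi : ∀ a ∈ M, i ≤ a
  · rw [op_basis_mon_of_le b hi, toU_mon, toU_mon, monU_cons k b hi]
  have hM : M ≠ 0 := by rintro rfl; simp at hi
  obtain ⟨l, Q, rfl, hQ⟩ := eq_min_cons hM
  have hli : l < i := by
    push Not at hi
    obtain ⟨a, ha, hai⟩ := hi
    rcases Multiset.mem_cons.mp ha with rfl | ha
    · exact hai
    · exact (hQ a ha).trans_lt hai
  have hc : Q.card < (l ::ₘ Q).card := by simp
  have hw : opMon b Q i - mon (i ::ₘ Q) ∈ equivariant k b :=
    mem_of_mem_degLE _ (fun M hM => ih _ (lt_of_le_of_lt hM hc) M rfl) (opMon_sub_mem b Q i)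
  have hle : ∀ a ∈ i ::ₘ Q, l ≤ a := by
    intro a ha
    rcases Multiset.mem_cons.mp ha with rfl | ha
    · exact hli.le
    · exact hQ a ha
  -- On the lower-degree part this is the induction hypothesis; on the leading monomial iQ both
  -- sides are the ordered product, since l is minimal there.
  have h1 : toU k b (op b (b l) (opMon b Q i)) = Enveloping.j k S L (b l) * toU k b (opMon b Q i) := by
    have h2 := hw (b l)
    rw [map_sub, map_sub, map_sub, op_basis_mon_of_le b hle, toU_mon, toU_mon, mul_sub,
      monU_cons k b hle, sub_left_inj] at h2
    exact h2
  have hQe := ih _ hc Q rfl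
  rw [← op_basis_mon_of_le b hQ, op_op_mon_of_lt b hQ hli, map_add, op_basis_mon, h1,
    ← op_basis_mon, hQe, hQe, hQe, Enveloping.j_lie, sub_mul, mul_assoc, mul_assoc, add_sub_cancel]

/-- Evaluated at the constant polynomial 1 = `mon 0`, this makes u ↦ u · 1 a right inverse of `toU`;
that it is also a left inverse is `act_toU`. -/
lemma toU_act (u : Enveloping k S L) (p : Poly S ι) : toU k b (act k b u p) = u * toU k b p := by
  induction u using Enveloping.induction generalizing p with
  | hi s => rw [act_i, toU_smul]
  | hj α =>
    rw [act_j]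
    have : p ∈ equivariant k b := mem_of_mem_degLE (n := p.support.sup Multiset.card) _
      (fun M _ => mon_mem_equivariant k b M) fun M hM => Finset.le_sup (f := Multiset.card) hM
    exact this α
  | hadd u v hu hv => rw [map_add, LinearMap.add_apply, map_add, hu, hv, add_mul]
  | hmul u v hu hv => rw [map_mul, Module.End.mul_apply, hu, hv, mul_assoc]

lemma act_toU (p : Poly S ι) : act k b (toU k b p) (mon 0) = p := by
  induction p using Finsupp.induction_linear with
  | zero => simp
  | add p q hp hq => rw [map_add, map_add, LinearMap.add_apply, hp, hq]
  | single M s =>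
    rw [toU_single, map_mul, Module.End.mul_apply, act_monU, act_i, Finsupp.smul_single,
      smul_eq_mul, mul_one]

/-- The Poincaré-Birkhoff-Witt theorem: the enveloping algebra is a free left `S`-module on the
ordered monomials. -/
lemma toU_bijective : Function.Bijective (toU k b) :=
  ⟨Function.LeftInverse.injective (g := fun u => act k b u (mon 0)) (act_toU k b),
    fun u => ⟨act k b u (mon 0), by rw [toU_act, toU_mon, monU_zero, mul_one]⟩⟩

/-- The map that sends a polynomial `∑ s_M M` to the element `∑ x_M s_M` of the enveloping
algebra. -/
def toURight : Poly S ι →+ Enveloping k S L :=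
  Finsupp.liftAddHom fun M =>
    (AddMonoidHom.mulLeft (monU k b M)).comp (Enveloping.i k S L : S →+ Enveloping k S L)

lemma toURight_single (M : Multiset ι) (s : S) :
    toURight k b (Finsupp.single M s) = monU k b M * Enveloping.i k S L s := by
  simp [toURight]

lemma toURight_smul (s : S) (p : Poly S ι) :
    toURight k b (s • p) = toURight k b p * Enveloping.i k S L s := by
  induction p using Finsupp.induction_linear with
  | zero => simp
  | add p q hp hq => rw [smul_add, map_add, map_add, hp, hq, add_mul]
  | single M t => rw [Finsupp.smul_single, toURight_single, toURight_single, smul_eq_mul, mul_comm,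
      map_mul, mul_assoc]

/-- The polynomials of degree less than `n`. -/
def degLT (n : ℕ) : Submodule S (Poly S ι) := Finsupp.supported S S {M | M.card < n}

/-- Moving a coefficient to the left through an ordered monomial costs only terms with fewer
factors, because a commutator of L with S lies in S. -/
lemma act_monU_single_sub_mem (M : Multiset ι) (s : S) :
    act k b (monU k b M) (Finsupp.single 0 s) - Finsupp.single M s ∈ degLT M.card := by
  induction M using monU_induction with
  | zero => simp
  | cons i M h ih =>
    have hlt : ∀ {n} {p : Poly S ι}, p ∈ degLT n → op b (b i) p ∈ degLT (n + 1) := by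
      intro n p hp
      cases n with
      | zero =>
        have : p = 0 := by
          ext M
          by_contra hM
          exact absurd (hp (by simpa using hM)) (Nat.not_lt_zero _)
        rw [this, map_zero]
        exact Submodule.zero_mem _
      | succ n =>
        have h := op_mem_degLE b (b i) (n := n) (p := p) fun M hM => Nat.lt_succ_iff.mp (hp hM)
        exact fun M hM => Nat.lt_succ_iff.mpr (h hM)
    -- The only term besides the leading one differentiates the coefficient and keeps M, which has
    -- one element fewer than iM.
    have e : op b (b i) (Finsupp.single M s) =
        Finsupp.single (i ::ₘ M) s + Finsupp.single M ⁅b i, s⁆ := by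
      have h1 := op_smul b (b i) s (mon M)
      rw [op_basis_mon_of_le b h] at h1
      simpa using h1
    have h2 := hlt ih
    rw [map_sub, e] at h2
    rw [monU_cons k b h, map_mul, Module.End.mul_apply, act_j, Multiset.card_cons]
    have h3 : (Finsupp.single M ⁅b i, s⁆ : Poly S ι) ∈ degLT (M.card + 1) :=
      Finsupp.single_mem_supported S _ (Nat.lt_succ_self _)
    convert Submodule.add_mem _ h2 h3 using 1
    abel

/-- The composite of `toURight` with the inverse of `toU` is unitriangular for the degree
filtration. Freeness on the right then follows from freeness on the left. -/
lemma act_toURight_sub_mem {n : ℕ} {p : Poly S ι} (hp : p ∈ degLT (n + 1)) :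
    act k b (toURight k b p) (mon 0) - p ∈ degLT n := by
  rw [← Finsupp.sum_single p, map_finsuppSum, map_finsuppSum, LinearMap.finsupp_sum_apply,
    Finsupp.sum, Finsupp.sum, ← Finset.sum_sub_distrib]
  refine Submodule.sum_mem _ fun M hM => ?_
  have h1 : M.card ≤ n := Nat.lt_succ_iff.mp (hp hM)
  rw [toURight_single, map_mul, Module.End.mul_apply, act_i, Finsupp.smul_single, smul_eq_mul, mul_one]
  exact Finsupp.supported_mono (fun Q hQ => lt_of_lt_of_le hQ h1) (act_monU_single_sub_mem k b M _)

lemma exists_mem_degLT (p : Poly S ι) : ∃ n, p ∈ degLT n :=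
  ⟨p.support.sup Multiset.card + 1, fun _ hM =>
    Nat.lt_succ_iff.mpr (Finset.le_sup (f := Multiset.card) hM)⟩

lemma eq_zero_of_mem_degLT_zero {p : Poly S ι} (hp : p ∈ degLT 0) : p = 0 := by
  ext M
  by_contra hM
  exact absurd (hp (by simpa using hM)) (Nat.not_lt_zero _)

lemma toURight_injective : Function.Injective (toURight k b) := by
  rw [injective_iff_map_eq_zero]
  intro p hp
  obtain ⟨n, hn⟩ := exists_mem_degLT p
  induction n with
  | zero => exact eq_zero_of_mem_degLT_zero hn
  | succ n ih =>
    have h := act_toURight_sub_mem k b hn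
    rw [hp, map_zero, LinearMap.zero_apply, zero_sub, Submodule.neg_mem_iff] at h
    exact ih h

lemma toURight_surjective : Function.Surjective (toURight k b) := by
  have key : ∀ n (p : Poly S ι), p ∈ degLT n → ∃ q, toURight k b q = toU k b p := by
    intro n
    induction n with
    | zero => exact fun p hp => ⟨0, by rw [eq_zero_of_mem_degLT_zero hp, map_zero, map_zero]⟩
    | succ n ih =>
      intro p hp
      -- Taking p as a first guess for its own preimage leaves an error of lower degree; q is a
      -- preimage of that error, so p - q is the correct choice.
      obtain ⟨q, hq⟩ := ih _ (act_toURight_sub_mem k b hp)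
      refine ⟨p - q, ?_⟩
      rw [map_sub, hq, map_sub, toU_act, toU_mon, monU_zero, mul_one, sub_sub_cancel]
  intro u
  obtain ⟨p, rfl⟩ := (toU_bijective k b).2 u
  obtain ⟨n, hn⟩ := exists_mem_degLT p
  exact key n p hn

end PBW

/-! ### From projective to free modules -/

section Swindle

variable {S L : Type u} [CommRing S] [AddCommGroup L] [Module S L]

/-- Finitely supported functions with values in a product. -/
def finsuppProdEquiv (J P Q : Type*) [AddCommGroup P] [Module S P] [AddCommGroup Q] [Module S Q] :
    (J →₀ P × Q) ≃ₗ[S] (J →₀ P) × (J →₀ Q) :=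
  LinearEquiv.ofLinearMap
    ((Finsupp.mapRange.linearMap (LinearMap.fst S P Q)).prod
      (Finsupp.mapRange.linearMap (LinearMap.snd S P Q)))
    ((Finsupp.mapRange.linearMap (LinearMap.inl S P Q)).coprod
      (Finsupp.mapRange.linearMap (LinearMap.inr S P Q)))
    (by
      refine LinearMap.ext fun x => Prod.ext ?_ ?_
      · ext j; simp
      · ext j; simp)
    (by
      refine LinearMap.ext fun x => ?_
      ext j <;> simp)

/-- The Eilenberg swindle: a projective module becomes free after adding a free module. -/
lemma exists_free_prod [Module.Projective S L] :
    ∃ J : Type u, Module.Free S (L × (J →₀ S)) := by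
  obtain ⟨s, hs⟩ := Module.projective_def'.mp (inferInstance : Module.Projective S L)
  let r : (L →₀ S) →ₗ[S] L := Finsupp.linearCombination S (id : L → L)
  have hrs (x : L) : r (s x) = x := LinearMap.congr_fun hs x
  -- The section s splits the canonical surjection from the free module on the set L, and K = ker r
  -- is the complement.
  let e₀ : (L →₀ S) ≃ₗ[S] L × LinearMap.ker r :=
    { toFun := fun x => (r x, ⟨x - s (r x), by
        rw [LinearMap.mem_ker, map_sub, hrs, sub_self]⟩)
      map_add' := fun x y => by
        refine Prod.ext (map_add _ _ _) (Subtype.ext ?_)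
        change x + y - s (r (x + y)) = x - s (r x) + (y - s (r y))
        rw [map_add, map_add]; abel
      map_smul' := fun c x => by
        refine Prod.ext (map_smul _ _ _) (Subtype.ext ?_)
        change c • x - s (r (c • x)) = c • (x - s (r x))
        rw [map_smul, map_smul, smul_sub]
      invFun := fun y => s y.1 + y.2
      left_inv := fun x => by simp
      right_inv := fun y => by
        have h : r y.2 = 0 := y.2.2
        refine Prod.ext ?_ (Subtype.ext ?_) <;> simp [hrs, h] }
  let e₁ : (ℕ →₀ (L →₀ S)) ≃ₗ[S] (ℕ →₀ L) × (ℕ →₀ LinearMap.ker r) :=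
    (Finsupp.mapRange.linearEquiv e₀).trans (finsuppProdEquiv ℕ L (LinearMap.ker r))
  -- A countable sum of copies of L absorbs one more copy.
  let e₂ : (L × (ℕ →₀ L)) ≃ₗ[S] (ℕ →₀ L) :=
    ((LinearEquiv.prodCongr (Finsupp.uniqueLinearEquiv S L ()).symm
      (LinearEquiv.refl S _)).trans (Finsupp.sumFinsuppLEquivProdFinsupp S).symm).trans
      (Finsupp.domLCongr ((Equiv.sumComm _ _).trans Equiv.natSumPUnitEquivNat))
  -- A countable sum of copies of the free module is L^(ℕ) ⊕ K^(ℕ), so it absorbs L as well and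
  -- stays free.
  let e₃ : (L × (ℕ →₀ (L →₀ S))) ≃ₗ[S] (ℕ →₀ (L →₀ S)) :=
    ((LinearEquiv.prodCongr (LinearEquiv.refl S L) e₁).trans
      (LinearEquiv.prodAssoc S _ _ _).symm).trans
      ((LinearEquiv.prodCongr e₂ (LinearEquiv.refl S _)).trans e₁.symm)
  refine ⟨ℕ × L, Module.Free.of_equiv (((LinearEquiv.prodCongr (LinearEquiv.refl S L)
    (Finsupp.curryLinearEquiv S)).trans e₃).symm)⟩

end Swindle

/-! ### The semidirect product of L with a free module -/

section Semidirect

variable (k S L J : Type u) [Field k] [CommRing S] [Algebra k S] [LieRing L]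
  [LieAlgebra k L] [Module S L] [LieRingModule L S]

variable {S L J} in
/-- The action of `L` on the coefficients of the elements of a free module. -/
def finsuppLie (α : L) : (J →₀ S) →+ (J →₀ S) :=
  Finsupp.mapRange.addMonoidHom (AddMonoidHom.mk' (fun s => ⁅α, s⁆) (lie_add α))

variable {S L J} in
@[simp]
lemma finsuppLie_apply (α : L) (p : J →₀ S) (j : J) : finsuppLie α p j = ⁅α, p j⁆ := rfl

/-- The semidirect product of `L` with a free `S`-module on which `L` acts coefficientwise. -/
@[ext]
structure Semidirect where
  /-- The component in `L`. -/
  fst : L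
  /-- The component in the free module. -/
  snd : J →₀ S

namespace Semidirect

/-- The underlying product. -/
def equiv : Semidirect S L J ≃ L × (J →₀ S) where
  toFun x := (x.fst, x.snd)
  invFun x := ⟨x.1, x.2⟩

instance : AddCommGroup (Semidirect S L J) := (equiv S L J).addCommGroup
instance : Module S (Semidirect S L J) := (equiv S L J).module S
instance : Module k (Semidirect S L J) := (equiv S L J).module k

variable {S L J}

@[simp] lemma fst_add (x y : Semidirect S L J) : (x + y).fst = x.fst + y.fst := rfl
@[simp] lemma snd_add (x y : Semidirect S L J) : (x + y).snd = x.snd + y.snd := rfl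
@[simp] lemma fst_zero : (0 : Semidirect S L J).fst = 0 := rfl
@[simp] lemma snd_zero : (0 : Semidirect S L J).snd = 0 := rfl
@[simp] lemma fst_smul (s : S) (x : Semidirect S L J) : (s • x).fst = s • x.fst := rfl
@[simp] lemma snd_smul (s : S) (x : Semidirect S L J) : (s • x).snd = s • x.snd := rfl
@[simp] lemma fst_ksmul (c : k) (x : Semidirect S L J) : (c • x).fst = c • x.fst := rfl
@[simp] lemma snd_ksmul (c : k) (x : Semidirect S L J) : (c • x).snd = c • x.snd := rfl

instance : Bracket (Semidirect S L J) (Semidirect S L J) where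
  bracket x y := ⟨⁅x.fst, y.fst⁆, finsuppLie x.fst y.snd - finsuppLie y.fst x.snd⟩

@[simp] lemma fst_lie (x y : Semidirect S L J) : ⁅x, y⁆.fst = ⁅x.fst, y.fst⁆ := rfl
@[simp] lemma snd_lie (x y : Semidirect S L J) :
    ⁅x, y⁆.snd = finsuppLie x.fst y.snd - finsuppLie y.fst x.snd := rfl

/-- The free summand is an abelian ideal and L acts on it coefficient by coefficient, so the Jacobi
identity reduces to that of L and to the fact that S is a representation of L. -/
instance : LieRing (Semidirect S L J) where
  add_lie x y z := by
    ext j <;> simp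
    abel
  lie_add x y z := by
    ext j <;> simp
    abel
  lie_self x := by ext j <;> simp
  leibniz_lie x y z := by
    ext j <;> simp
    abel

instance : LieRingModule (Semidirect S L J) S where
  bracket x s := ⁅x.fst, s⁆
  add_lie x y s := add_lie x.fst y.fst s
  lie_add x s t := lie_add x.fst s t
  leibniz_lie x y s := leibniz_lie x.fst y.fst s

lemma lie_coeff (x : Semidirect S L J) (s : S) : ⁅x, s⁆ = ⁅x.fst, s⁆ := rfl

variable [LieRinehartRing S L] [LieRinehartAlgebra k S L]

instance : LieAlgebra k (Semidirect S L J) where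
  lie_smul c x y := by
    ext j
    · simp
    · have h : ⁅c • y.fst, x.snd j⁆ = c • ⁅y.fst, x.snd j⁆ := smul_lie ..
      have h' : ⁅x.fst, c • y.snd j⁆ = c • ⁅x.fst, y.snd j⁆ :=
        LieModule.lie_smul c x.fst (y.snd j)
      simp [smul_sub, h, h']

instance : LieRinehartRing S (Semidirect S L J) where
  lie_smul_eq_mul' s t x := by simp [lie_coeff]
  leibniz_mul_right' x s t := by simp [lie_coeff]
  leibniz_smul_right' x y s := by
    ext j
    · simp [lie_coeff]
    · simp [lie_coeff, mul_sub]
      ring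

instance : LieRinehartAlgebra k S (Semidirect S L J) where
  smul_assoc c s x := by ext j <;> simp
  smul_lie c x s := smul_lie c x.fst s
  lie_smul c x s := lie_smul c x.fst s

variable (J) in
/-- The morphism of enveloping algebras induced by the inclusion of `L`. -/
def incl : Enveloping k S L →ₐ[k] Enveloping k S (Semidirect S L J) :=
  Enveloping.lift (Enveloping.i k S _)
    { toFun := fun α => Enveloping.j k S _ ⟨α, 0⟩
      map_add' := fun α β => by
        rw [← map_add]; congr 1; ext j <;> simp
      map_smul' := fun c α => by
        rw [RingHom.id_apply, ← map_smul]; congr 1; ext j <;> simp }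
    (fun α β => by
      refine Eq.trans ?_ (Enveloping.j_lie k S _ _ _)
      change Enveloping.j k S _ _ = _
      congr 1; ext j <;> simp)
    (fun s α => by
      refine (Enveloping.i_mul_j k S _ _ _).trans ?_
      change Enveloping.j k S _ _ = Enveloping.j k S _ _
      congr 1; ext j <;> simp)
    (fun α s => Enveloping.j_mul_i_sub k S _ _ _)

/-- The morphism of enveloping algebras induced by the projection to `L`. -/
def proj : Enveloping k S (Semidirect S L J) →ₐ[k] Enveloping k S L :=
  Enveloping.lift (Enveloping.i k S _)
    { toFun := fun x => Enveloping.j k S _ x.fst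
      map_add' := fun _ _ => map_add (Enveloping.j k S L) _ _
      map_smul' := fun c _ => map_smul (Enveloping.j k S L) c _ }
    (fun _ _ => Enveloping.j_lie k S L _ _)
    (fun _ _ => Enveloping.i_mul_j k S L _ _)
    (fun _ _ => Enveloping.j_mul_i_sub k S L _ _)

@[simp] lemma incl_i (s : S) : incl k J (Enveloping.i k S L s) = Enveloping.i k S _ s :=
  Enveloping.lift_i ..

@[simp] lemma proj_i (s : S) :
    proj k (Enveloping.i k S (Semidirect S L J) s) = Enveloping.i k S L s :=
  Enveloping.lift_i ..

/-- U(S, L) is a retract of the larger enveloping algebra by algebra maps that respect S. This is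
how dual bases are transferred to it. -/
lemma proj_incl (u : Enveloping k S L) : proj k (incl k J u) = u := by
  induction u using Enveloping.induction with
  | hi s => simp
  | hj α =>
    rw [incl, Enveloping.lift_j, proj]
    exact Enveloping.lift_j ..
  | hadd u v hu hv => rw [map_add, map_add, hu, hv]
  | hmul u v hu hv => rw [map_mul, map_mul, hu, hv]

end Semidirect

end Semidirect

/-! ### Dual bases of U over S for projective L -/

section DualBasis

variable (k S L : Type u) [Field k] [CommRing S] [Algebra k S] [LieRing L]
  [LieAlgebra k L] [Module S L] [LieRingModule L S]

/-- A dual basis of the enveloping algebra as a right `S`-module. -/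
structure RightDualBasis where
  /-- The index set. -/
  X : Type u
  /-- The generators. -/
  e : X → Enveloping k S L
  /-- The coordinates. -/
  coord : Enveloping k S L →+ (X →₀ S)
  coord_mul (u : Enveloping k S L) (s : S) : coord (u * Enveloping.i k S L s) = s • coord u
  sum_coord (u : Enveloping k S L) : (coord u).sum (fun x s => e x * Enveloping.i k S L s) = u

/-- A dual basis of the enveloping algebra as a left `S`-module. -/
structure LeftDualBasis where
  /-- The index set. -/
  X : Type u
  /-- The generators. -/
  e : X → Enveloping k S L
  /-- The coordinates. -/
  coord : Enveloping k S L →+ (X →₀ S)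
  coord_mul (s : S) (u : Enveloping k S L) : coord (Enveloping.i k S L s * u) = s • coord u
  sum_coord (u : Enveloping k S L) : (coord u).sum (fun x s => Enveloping.i k S L s * e x) = u

variable [LieRinehartRing S L] [LieRinehartAlgebra k S L]

variable {S L} in
/-- The dual basis given by the ordered monomials. -/
def RightDualBasis.ofBasis {ι : Type u} [LinearOrder ι] (b : Module.Basis ι S L) :
    RightDualBasis k S L where
  X := Multiset ι
  e := PBW.monU k b
  coord := (AddEquiv.ofBijective (PBW.toURight k b)
    ⟨PBW.toURight_injective k b, PBW.toURight_surjective k b⟩).symm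
  coord_mul u s := by
    obtain ⟨p, rfl⟩ := PBW.toURight_surjective k b u
    rw [← PBW.toURight_smul]
    exact ((AddEquiv.symm_apply_apply (AddEquiv.ofBijective _ _) _).trans
      (congrArg (s • ·) (AddEquiv.symm_apply_apply (AddEquiv.ofBijective _ _) _).symm))
  sum_coord u := by
    obtain ⟨p, rfl⟩ := PBW.toURight_surjective k b u
    exact congrArg (fun q : PBW.Poly S ι => q.sum _) (AddEquiv.symm_apply_apply (AddEquiv.ofBijective _ _) _)

variable {S L} in
/-- The dual basis given by the ordered monomials. -/
def LeftDualBasis.ofBasis {ι : Type u} [LinearOrder ι] (b : Module.Basis ι S L) :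
    LeftDualBasis k S L where
  X := Multiset ι
  e := PBW.monU k b
  coord := (AddEquiv.ofBijective (PBW.toU k b) (PBW.toU_bijective k b)).symm
  coord_mul s u := by
    obtain ⟨p, rfl⟩ := (PBW.toU_bijective k b).2 u
    rw [← PBW.toU_smul]
    exact ((AddEquiv.symm_apply_apply (AddEquiv.ofBijective _ _) _).trans
      (congrArg (s • ·) (AddEquiv.symm_apply_apply (AddEquiv.ofBijective _ _) _).symm))
  sum_coord u := by
    obtain ⟨p, rfl⟩ := (PBW.toU_bijective k b).2 u
    exact congrArg (fun q : PBW.Poly S ι => q.sum _) (AddEquiv.symm_apply_apply (AddEquiv.ofBijective _ _) _)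

variable [Module.Projective S L]

lemma exists_basis_semidirect :
    ∃ (J ι : Type u) (_ : LinearOrder ι), Nonempty (Module.Basis ι S (Semidirect S L J)) := by
  obtain ⟨J, hJ⟩ := exists_free_prod (S := S) (L := L)
  let e : Semidirect S L J ≃ₗ[S] L × (J →₀ S) := (Semidirect.equiv S L J).linearEquiv S
  -- Ordered monomials need some linear order on the index set; any will do, and a well-ordering
  -- supplies one.
  refine ⟨J, _, IsWellOrder.linearOrder WellOrderingRel, ⟨(Module.Free.chooseBasis S _).map e.symm⟩⟩

/-- Coordinates are restricted along `Semidirect.incl` and generators are pushed down by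
`Semidirect.proj`. Applying the projection to the expansion of the included element recovers the
element, as the composite is the identity. -/
lemma nonempty_rightDualBasis : Nonempty (RightDualBasis k S L) := by
  obtain ⟨J, ι, _, ⟨b⟩⟩ := exists_basis_semidirect S L
  let B := RightDualBasis.ofBasis k b
  exact ⟨{
    X := B.X
    e := fun x => Semidirect.proj k (B.e x)
    coord := B.coord.comp (Semidirect.incl k J).toRingHom.toAddMonoidHom
    coord_mul := fun u s => by
      have h := B.coord_mul (Semidirect.incl k J u) s
      rw [← Semidirect.incl_i, ← map_mul] at h
      exact h
    sum_coord := fun u => by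
      have h := congrArg (Semidirect.proj k) (B.sum_coord (Semidirect.incl k J u))
      rw [Semidirect.proj_incl, map_finsuppSum] at h
      refine Eq.trans (Finsupp.sum_congr fun x _ => ?_) h
      rw [map_mul, Semidirect.proj_i] }⟩

lemma nonempty_leftDualBasis : Nonempty (LeftDualBasis k S L) := by
  obtain ⟨J, ι, _, ⟨b⟩⟩ := exists_basis_semidirect S L
  let B := LeftDualBasis.ofBasis k b
  exact ⟨{
    X := B.X
    e := fun x => Semidirect.proj k (B.e x)
    coord := B.coord.comp (Semidirect.incl k J).toRingHom.toAddMonoidHom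
    coord_mul := fun s u => by
      have h := B.coord_mul s (Semidirect.incl k J u)
      rw [← Semidirect.incl_i, ← map_mul] at h
      exact h
    sum_coord := fun u => by
      have h := congrArg (Semidirect.proj k) (B.sum_coord (Semidirect.incl k J u))
      rw [Semidirect.proj_incl, map_finsuppSum] at h
      refine Eq.trans (Finsupp.sum_congr fun x _ => ?_) h
      rw [map_mul, Semidirect.proj_i] }⟩

end DualBasis

/-! ### Restriction of scalars and injective modules -/

section Restriction

variable {R A : Type u} [CommRing R] [Ring A] (φ : R →+* A)

/-- A copy of `A` on which `A` acts by left multiplication and `R` by right multiplication. -/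
@[nolint unusedArguments]
def RightCopy (_ : R →+* A) : Type u := A

namespace RightCopy

instance : AddCommGroup (RightCopy φ) := inferInstanceAs (AddCommGroup A)

instance : Module A (RightCopy φ) := inferInstanceAs (Module A A)

variable {φ}

/-- An element of `A` regarded in the copy. -/
def of (a : A) : RightCopy φ := a

/-- An element of the copy regarded in `A`. -/
def val (a : RightCopy φ) : A := a

instance : Module R (RightCopy φ) where
  smul r a := of (a.val * φ r)
  one_smul a := by
    change a.val * φ 1 = a.val
    rw [map_one, mul_one]
  mul_smul r t a := by
    change a.val * φ (r * t) = a.val * φ t * φ r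
    rw [mul_comm, map_mul, mul_assoc]
  smul_zero r := zero_mul (φ r)
  smul_add r a b := add_mul a.val b.val (φ r)
  add_smul r t a := by
    change a.val * φ (r + t) = a.val * φ r + a.val * φ t
    rw [map_add, mul_add]
  zero_smul a := by
    change a.val * φ 0 = 0
    rw [map_zero, mul_zero]

instance : SMulCommClass R A (RightCopy φ) where
  smul_comm r b a := mul_assoc b a.val (φ r)

end RightCopy

/-- If `A` is flat as a right `R`-module, then injective `A`-modules are injective over `R`. -/
lemma injective_restrictScalars [Module.Flat R (RightCopy φ)] (M : ModuleCat.{u} A) [Injective M] :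
    Injective ((ModuleCat.restrictScalars φ).obj M) := by
  let M' := (ModuleCat.restrictScalars φ).obj M
  have hM : Module.Injective A M := Module.injective_module_of_injective_object A M
  suffices h : Module.Injective R M' from
    Module.injective_object_of_injective_module R M' (inj := h)
  refine ⟨fun X Y _ _ _ _ f hf g => ?_⟩
  -- The extension problem over R is carried to one over A by A ⊗_R -, which keeps f injective by
  -- flatness.
  let f' : RightCopy φ ⊗[R] X →ₗ[A] RightCopy φ ⊗[R] Y :=
    { TensorProduct.map (LinearMap.id : RightCopy φ →ₗ[R] _) f with
      map_smul' := fun a x => by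
        change (TensorProduct.map LinearMap.id f) (a • x) = a • (TensorProduct.map LinearMap.id f) x
        induction x using TensorProduct.induction_on with
        | zero => rw [smul_zero, map_zero, smul_zero]
        | tmul b x => rfl
        | add x y hx hy => rw [smul_add, map_add, hx, hy, map_add, smul_add] }
  have hf' : Function.Injective f' :=
    Module.Flat.lTensor_preserves_injective_linearMap (M := RightCopy φ) f hf
  let t : RightCopy φ ⊗[R] X →+ M := TensorProduct.liftAddHom
    (AddMonoidHom.mk' (fun a : RightCopy φ => AddMonoidHom.mk'
        (fun x : X => a.val • (g x : M)) (fun x y => by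
          have h : (g (x + y) : M) = (g x : M) + (g y : M) := map_add g x y
          exact (congrArg (a.val • ·) h).trans (smul_add a.val (g x : M) (g y : M))))
      (fun a b => AddMonoidHom.ext fun x => add_smul a.val b.val (g x : M)))
    (fun r a x => by
      have h : (g (r • x) : M) = φ r • (g x : M) := map_smul g r x
      change (a.val * φ r) • (g x : M) = a.val • (g (r • x) : M)
      rw [h, mul_smul])
  let g' : RightCopy φ ⊗[R] X →ₗ[A] M :=
    { t with
      map_smul' := fun a x => by
        change t (a • x) = a • t x
        induction x using TensorProduct.induction_on with
        | zero => rw [smul_zero, map_zero, smul_zero]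
        | tmul b x => exact mul_smul a b.val (g x : M)
        | add x y hx hy => rw [smul_add, map_add, hx, hy, map_add, smul_add] }
  obtain ⟨h, hh⟩ := hM.out f' hf' g'
  -- The A-linear extension h is restricted along y ↦ 1 ⊗ y. This is R-linear because the scalar r
  -- passes through the tensor sign and 1 · φ(r) = φ(r) · 1.
  let e : Y →ₗ[R] M' :=
    { toFun := fun y => h (RightCopy.of (1 : A) ⊗ₜ y)
      map_add' := fun y z => (congrArg h (TensorProduct.tmul_add _ _ _)).trans (map_add h _ _)
      map_smul' := fun r y => by
        have h1 : (RightCopy.of (1 : A) : RightCopy φ) ⊗ₜ[R] (r • y) =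
            φ r • (RightCopy.of (1 : A) : RightCopy φ) ⊗ₜ[R] y := by
          rw [← TensorProduct.smul_tmul]
          refine congrArg (· ⊗ₜ[R] y) ?_
          change (1 : A) * φ r = φ r * 1
          rw [one_mul, mul_one]
        exact (congrArg h h1).trans (map_smul h _ _) }
  exact ⟨e, fun x => (hh (RightCopy.of 1 ⊗ₜ x)).trans (one_smul A (g x : M))⟩

end Restriction

/-! ### Flatness of U over S and of Uᵉ over Sᵉ -/

section Flatness

variable {k S L : Type u} [Field k] [CommRing S] [Algebra k S] [LieRing L]
  [LieAlgebra k L] [Module S L] [LieRingModule L S]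

/-- The coordinates of a right dual basis as a linear map. -/
def RightDualBasis.coordₗ (B : RightDualBasis k S L) : Enveloping k S L →ₗ[k] (B.X →₀ S) :=
  { B.coord with
    map_smul' := fun c u => by
      have h := B.coord_mul u (algebraMap k S c)
      rw [AlgHom.commutes, ← Algebra.commutes, ← Algebra.smul_def, algebraMap_smul] at h
      exact h }

/-- The coordinates of a left dual basis as a linear map with values in the opposite algebra. -/
def LeftDualBasis.coordₗ (B : LeftDualBasis k S L) :
    (Enveloping k S L)ᵐᵒᵖ →ₗ[k] (B.X →₀ Sᵐᵒᵖ) :=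
  { (Finsupp.mapRange.addMonoidHom (MulOpposite.opAddEquiv : S ≃+ Sᵐᵒᵖ).toAddMonoidHom).comp
      (B.coord.comp (MulOpposite.opAddEquiv (α := Enveloping k S L)).symm.toAddMonoidHom) with
    map_smul' := fun c u => by
      have h := B.coord_mul (algebraMap k S c) u.unop
      rw [AlgHom.commutes, ← Algebra.smul_def, algebraMap_smul] at h
      change Finsupp.mapRange.addMonoidHom _ (B.coord (c • u.unop)) = _
      rw [h]
      ext x
      rfl }

lemma RightDualBasis.coordₗ_mul (B : RightDualBasis k S L) (u : Enveloping k S L) (s : S) :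
    B.coordₗ (u * Enveloping.i k S L s) = s • B.coordₗ u := B.coord_mul u s

lemma LeftDualBasis.coordₗ_mul_apply (B : LeftDualBasis k S L) (u : (Enveloping k S L)ᵐᵒᵖ) (s : S)
    (x : B.X) :
    B.coordₗ (u * MulOpposite.op (Enveloping.i k S L s)) x = MulOpposite.op s * B.coordₗ u x := by
  have h := B.coord_mul s u.unop
  change MulOpposite.op (B.coord (Enveloping.i k S L s * u.unop) x) =
    MulOpposite.op s * MulOpposite.op (B.coord u.unop x)
  rw [h, ← MulOpposite.op_mul, Finsupp.smul_apply, smul_eq_mul, mul_comm]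

lemma RightDualBasis.sum_coordₗ (B : RightDualBasis k S L) (u : Enveloping k S L) :
    (B.coordₗ u).sum (fun x s => B.e x * Enveloping.i k S L s) = u := B.sum_coord u

lemma LeftDualBasis.sum_coordₗ (B : LeftDualBasis k S L) (u : (Enveloping k S L)ᵐᵒᵖ) :
    (B.coordₗ u).sum (fun x s => MulOpposite.op (B.e x) * (Enveloping.i k S L).op s) = u := by
  refine MulOpposite.unop_injective ((Eq.trans ?_ (B.sum_coord u.unop)))
  refine (congrArg MulOpposite.unop (Finsupp.sum_mapRange_index (f := MulOpposite.op) (hf := rfl)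
    (g := B.coord u.unop) (fun x => by simp))).trans ?_
  exact map_finsuppSum (MulOpposite.opAddEquiv (α := Enveloping k S L)).symm _ _

lemma projective_uRight (B : RightDualBasis k S L) : Module.Projective S (URight k S L) := by
  let σ : URight k S L →ₗ[S] (B.X →₀ S) :=
    { toFun := fun u => B.coord u.val
      map_add' := fun u v => map_add B.coord u.val v.val
      map_smul' := fun s u => B.coord_mul u.val s }
  refine Module.Projective.of_split σ
    (Finsupp.linearCombination S (fun x => URight.of (B.e x))) (LinearMap.ext fun u => ?_)
  refine Eq.trans ?_ (B.sum_coord u.val)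
  rw [LinearMap.comp_apply, Finsupp.linearCombination_apply]
  rfl

/-- A left dual basis of U is a right dual basis of the opposite algebra. Tensoring it over k with a
right dual basis of U produces one for Uᵉ over Sᵉ. -/
lemma projective_env (B : RightDualBasis k S L) (B' : LeftDualBasis k S L) :
    Module.Projective (Env k S) (RightCopy (envMap k S L).toRingHom) := by
  let σ₀ : Env k (Enveloping k S L) →ₗ[k] (B.X × B'.X →₀ Env k S) :=
    (finsuppTensorFinsupp k k S Sᵐᵒᵖ B.X B'.X).toLinearMap ∘ₗ TensorProduct.map B.coordₗ B'.coordₗ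
  let σ : RightCopy (envMap k S L).toRingHom →ₗ[Env k S] (B.X × B'.X →₀ Env k S) :=
    { toFun := fun u => σ₀ u.val
      map_add' := fun u v => map_add σ₀ u.val v.val
      map_smul' := fun c u => by
        change σ₀ (u.val * envMap k S L c) = c • σ₀ u.val
        generalize u.val = w
        induction c using TensorProduct.induction_on with
        | zero => rw [map_zero, mul_zero, map_zero]; exact (zero_smul (Env k S) (σ₀ w)).symm
        | add c d hc hd => rw [map_add, mul_add, map_add, hc, hd, add_smul]
        | tmul s t =>
          induction w using TensorProduct.induction_on with
          | zero => rw [zero_mul, map_zero, smul_zero]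
          | add v w hv hw => rw [add_mul, map_add, hv, hw, map_add, smul_add]
          | tmul v w =>
            ext ⟨x, y⟩
            rw [envMap, Algebra.TensorProduct.map_tmul, Algebra.TensorProduct.tmul_mul_tmul,
              Finsupp.smul_apply]
            change finsuppTensorFinsupp k k S Sᵐᵒᵖ B.X B'.X (B.coordₗ _ ⊗ₜ B'.coordₗ _) (x, y) =
              (s ⊗ₜ t : Env k S) *
                finsuppTensorFinsupp k k S Sᵐᵒᵖ B.X B'.X (B.coordₗ v ⊗ₜ B'.coordₗ w) (x, y)
            rw [finsuppTensorFinsupp_apply, finsuppTensorFinsupp_apply,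
              Algebra.TensorProduct.tmul_mul_tmul, RightDualBasis.coordₗ_mul]
            congr 1
            exact B'.coordₗ_mul_apply w t.unop y }
  let π := Finsupp.linearCombination (Env k S) (fun x : B.X × B'.X =>
    (RightCopy.of (B.e x.1 ⊗ₜ[k] MulOpposite.op (B'.e x.2)) :
      RightCopy (envMap k S L).toRingHom))
  -- Reassembling a pure tensor of coordinate vectors can be done in each factor separately, so the
  -- two expansions in U and its opposite suffice.
  have key (f : B.X →₀ S) (g : B'.X →₀ Sᵐᵒᵖ) :
      (π (finsuppTensorFinsupp k k S Sᵐᵒᵖ B.X B'.X (f ⊗ₜ g))).val =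
      (f.sum (fun x s => B.e x * Enveloping.i k S L s)) ⊗ₜ[k]
      (g.sum (fun x s => MulOpposite.op (B'.e x) * (Enveloping.i k S L).op s)) := by
    induction f using Finsupp.induction_linear with
    | zero =>
      rw [TensorProduct.zero_tmul, map_zero, map_zero, Finsupp.sum_zero_index,
        TensorProduct.zero_tmul]
      rfl
    | add f f' hf hf' =>
      rw [TensorProduct.add_tmul, map_add, map_add, Finsupp.sum_add_index' (by simp)
        (by simp [mul_add]), TensorProduct.add_tmul, ← hf, ← hf']
      rfl
    | single x s =>
      induction g using Finsupp.induction_linear with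
      | zero =>
        rw [TensorProduct.tmul_zero, map_zero, map_zero, Finsupp.sum_zero_index,
          TensorProduct.tmul_zero]
        rfl
      | add g g' hf hf' =>
        rw [TensorProduct.tmul_add, map_add, map_add, Finsupp.sum_add_index' (f := g) (by simp)
          (fun _ _ _ => by rw [map_add, mul_add]), TensorProduct.tmul_add, ← hf, ← hf']
        rfl
      | single y t =>
        rw [finsuppTensorFinsupp_single, Finsupp.linearCombination_single,
          Finsupp.sum_single_index (by simp), Finsupp.sum_single_index (by simp)]
        change (B.e x ⊗ₜ[k] MulOpposite.op (B'.e y)) * envMap k S L (s ⊗ₜ t) = _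
        rw [envMap, Algebra.TensorProduct.map_tmul, Algebra.TensorProduct.tmul_mul_tmul]
  refine Module.Projective.of_split σ π (LinearMap.ext fun u => ?_)
  change π (σ₀ u.val) = u
  have h : ∀ w : Env k (Enveloping k S L), (π (σ₀ w)).val = w := fun w => by
    induction w using TensorProduct.induction_on with
    | zero => rw [map_zero, map_zero]; rfl
    | add v w hv hw => 
      conv_rhs => rw [← hv, ← hw]
      rw [map_add, map_add]; rfl
    | tmul v w =>
      refine (key _ _).trans ?_
      rw [RightDualBasis.sum_coordₗ, LeftDualBasis.sum_coordₗ]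
  exact h u.val

variable [LieRinehartRing S L] [LieRinehartAlgebra k S L] [Module.Projective S L]

variable (k S L) in
lemma flat_uRight : Module.Flat S (URight k S L) := by
  obtain ⟨B⟩ := nonempty_rightDualBasis k S L
  have := projective_uRight B
  infer_instance

variable (k S L) in
lemma flat_env : Module.Flat (Env k S) (RightCopy (envMap k S L).toRingHom) := by
  obtain ⟨B⟩ := nonempty_rightDualBasis k S L
  obtain ⟨B'⟩ := nonempty_leftDualBasis k S L
  have := projective_env B B'
  infer_instance

/-- This is why Hochschild cohomology of S can be computed with resolutions by injective Uᵉ-modules.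
-/
instance (M : ModuleCat.{u} (Env k (Enveloping k S L))) [Injective M] :
    Injective ((res k S L).obj M) :=
  haveI := flat_env k S L
  injective_restrictScalars _ M

end Flatness

/-! ### The adjunction between F and G -/

section Adjunction

variable {k S L : Type u} [Field k] [CommRing S] [Algebra k S] [LieRing L]
  [LieAlgebra k L] [Module S L] [LieRingModule L S]

/-- An additive map between `Uᵉ`-modules that commutes with the actions of the `u ⊗ 1` and of the
generators of the second factor is `Uᵉ`-linear. -/
def envHom {X Y : ModuleCat.{u} (Env k (Enveloping k S L))} (f : X →+ Y)
    (hlam : ∀ (u : Enveloping k S L) x, f (lam u • x) = lam u • f x)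
    (hi : ∀ s x, f (rho (Enveloping.i k S L s) • x) = rho (Enveloping.i k S L s) • f x)
    (hj : ∀ α x, f (rho (Enveloping.j k S L α) • x) = rho (Enveloping.j k S L α) • f x) :
    X ⟶ Y :=
  ModuleCat.ofHom { f with
    map_smul' := fun c x => by
      change f (c • x) = c • f x
      -- S and L generate U, so linearity extends from generators; `rho` reverses products, hence
      -- the order in the last case.
      have hrho : ∀ (u : Enveloping k S L) (x : X), f (rho u • x) = rho u • f x := fun u => by
        induction u using Enveloping.induction with
        | hi s => exact hi s
        | hj α => exact hj α
        | hadd u v hu hv => intro x; rw [rho_add, add_smul, map_add, hu, hv, add_smul]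
        | hmul u v hu hv => intro x; rw [rho_mul, mul_smul, hv, hu, mul_smul]
      induction c using TensorProduct.induction_on with
      | zero => 
        refine (congrArg f (zero_smul (Env k (Enveloping k S L)) x)).trans ?_
        exact (map_zero f).trans (zero_smul (Env k (Enveloping k S L)) (f x)).symm
      | add c d hc hd => rw [add_smul, map_add, hc, hd, add_smul]
      | tmul v w =>
        have h := lam_mul_rho v w.unop
        rw [MulOpposite.op_unop] at h
        rw [← h, mul_smul, hlam, hrho, mul_smul] }

section

variable [LieRinehartRing S L] [LieRinehartAlgebra k S L]

lemma F.add_tmul {N : ModuleCat.{u} (Enveloping k S L)} (u v : Enveloping k S L) (n : N) :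
    (F.tmul (u + v) n : F N) = F.tmul u n + F.tmul v n := add_ftmul u v n

lemma F.tmul_add {N : ModuleCat.{u} (Enveloping k S L)} (u : Enveloping k S L) (n n' : N) :
    (F.tmul u (n + n') : F N) = F.tmul u n + F.tmul u n' := ftmul_add u n n'

lemma F.tmul_i_smul {N : ModuleCat.{u} (Enveloping k S L)} (u : Enveloping k S L) (s : S) (n : N) :
    (F.tmul u (Enveloping.i k S L s • n) : F N) = F.tmul (u * Enveloping.i k S L s) n :=
  ftmul_i_smul u s n

lemma F.induction_on {N : ModuleCat.{u} (Enveloping k S L)} {P : F N → Prop} (x : F N)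
    (h0 : P 0) (htmul : ∀ u n, P (F.tmul u n)) (hadd : ∀ x y, P x → P y → P (x + y)) : P x :=
  TensorProduct.induction_on (motive := P) x h0 (fun u n => htmul u.val n) hadd

/-- Constructor for additive maps on `F N`. -/
def F.liftAdd {N : ModuleCat.{u} (Enveloping k S L)} {X : Type*} [AddCommGroup X]
    (b : Enveloping k S L → N → X)
    (h₁ : ∀ u u' n, b (u + u') n = b u n + b u' n)
    (h₂ : ∀ u n n', b u (n + n') = b u n + b u n')
    (h₃ : ∀ u s n, b (u * Enveloping.i k S L s) n = b u (Enveloping.i k S L s • n)) :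
    F N →+ X :=
  TensorProduct.liftAddHom
    (AddMonoidHom.mk' (fun u : URight k S L => AddMonoidHom.mk'
        (fun n : (ModuleCat.restrictScalars (Enveloping.i k S L).toRingHom).obj N => b u.val n)
        (fun n n' => h₂ u.val n n'))
      (fun u u' => AddMonoidHom.ext fun n => h₁ u.val u'.val n))
    (fun s u n => h₃ u.val s n)

@[simp]
lemma F.liftAdd_tmul {N : ModuleCat.{u} (Enveloping k S L)} {X : Type*} [AddCommGroup X]
    (b : Enveloping k S L → N → X) (h₁ h₂ h₃) (u : Enveloping k S L) (n : N) :
    F.liftAdd b h₁ h₂ h₃ (F.tmul u n) = b u n := rfl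

/-- The `Uᵉ`-linear map `F N → X` determined by its values on the elements `u ⊗ n`. -/
def F.lift {N : ModuleCat.{u} (Enveloping k S L)} {X : ModuleCat.{u} (Env k (Enveloping k S L))}
    (b : Enveloping k S L → N → X)
    (h₁ : ∀ u u' n, b (u + u') n = b u n + b u' n)
    (h₂ : ∀ u n n', b u (n + n') = b u n + b u n')
    (h₃ : ∀ u s n, b (u * Enveloping.i k S L s) n = b u (Enveloping.i k S L s • n))
    (h₄ : ∀ v u n, b (v * u) n = lam v • b u n)
    (h₅ : ∀ u s n, b u (Enveloping.i k S L s • n) = rho (Enveloping.i k S L s) • b u n)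
    (h₆ : ∀ u α n, b (u * Enveloping.j k S L α) n - b u (Enveloping.j k S L α • n) =
      rho (Enveloping.j k S L α) • b u n) : F N ⟶ X :=
  envHom (X := F N) (Y := X) (F.liftAdd b h₁ h₂ h₃)
    (fun v x => by
      induction x using F.induction_on with
      | h0 => rw [smul_zero, map_zero, smul_zero]
      | htmul u n => rw [F.lam_smul, F.liftAdd_tmul, F.liftAdd_tmul, h₄]
      | hadd x y hx hy => rw [smul_add, map_add, map_add, smul_add, hx, hy])
    (fun s x => by
      induction x using F.induction_on with
      | h0 => rw [smul_zero, map_zero, smul_zero]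
      | htmul u n => rw [F.rho_i_smul, F.liftAdd_tmul, F.liftAdd_tmul, h₅]
      | hadd x y hx hy => rw [smul_add, map_add, map_add, smul_add, hx, hy])
    (fun α x => by
      induction x using F.induction_on with
      | h0 => rw [smul_zero, map_zero, smul_zero]
      | htmul u n => 
        rw [F.rho_j_smul, map_sub, F.liftAdd_tmul, F.liftAdd_tmul, F.liftAdd_tmul, h₆]
      | hadd x y hx hy => rw [smul_add, map_add, map_add, smul_add, hx, hy])

@[simp]
lemma F.lift_tmul {N : ModuleCat.{u} (Enveloping k S L)}
    {X : ModuleCat.{u} (Env k (Enveloping k S L))}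
    (b : Enveloping k S L → N → X) (h₁ h₂ h₃ h₄ h₅ h₆) (u : Enveloping k S L) (n : N) :
    (F.lift b h₁ h₂ h₃ h₄ h₅ h₆).hom (F.tmul u n) = b u n := rfl

/-- The elements 1 ⊗ n generate F(N) already under left multiplication by U. -/
lemma F.hom_ext {N : ModuleCat.{u} (Enveloping k S L)}
    {X : ModuleCat.{u} (Env k (Enveloping k S L))} {f g : F N ⟶ X}
    (h : ∀ n, f.hom (F.tmul 1 n) = g.hom (F.tmul 1 n)) : f = g := by
  refine ModuleCat.hom_ext (LinearMap.ext fun x => ?_)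
  induction x using F.induction_on with
  | h0 => rw [map_zero, map_zero]
  | htmul u n =>
    have h1 : (F.tmul u n : F N) = lam u • F.tmul 1 n := by rw [F.lam_smul, mul_one]
    rw [h1, map_smul, map_smul, h]
  | hadd x y hx hy => rw [map_add, map_add, hx, hy]

/-- The map `U ⊗_S f`. -/
def F.map {N N' : ModuleCat.{u} (Enveloping k S L)} (f : N ⟶ N') : F N ⟶ F N' :=
  F.lift (X := F N') (fun u n => F.tmul u (f.hom n))
    (fun u u' n => F.add_tmul _ _ _)
    (fun u n n' => by rw [map_add, F.tmul_add])
    (fun u s n => by rw [map_smul, F.tmul_i_smul])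
    (fun v u n => (F.lam_smul _ _ _).symm)
    (fun u s n => by rw [map_smul, F.rho_i_smul])
    (fun u α n => by rw [map_smul, F.rho_j_smul])

variable (k S L) in
/-- The functor `F = U ⊗_S -` from `U`-modules to `Uᵉ`-modules. -/
def FFunctor : ModuleCat.{u} (Enveloping k S L) ⥤ ModuleCat.{u} (Env k (Enveloping k S L)) where
  obj := F
  map := F.map
  map_id _ := F.hom_ext fun _ => rfl
  map_comp _ _ := F.hom_ext fun _ => rfl

/-- The element of `G X` that corresponds to `n : N` under the adjoint of `f : F N ⟶ X`. -/
def adjointAt {N : ModuleCat.{u} (Enveloping k S L)}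
    {X : ModuleCat.{u} (Env k (Enveloping k S L))} (f : F N ⟶ X) (n : N) : GHom X :=
  GHom.mk (fun s => f.hom (F.tmul (Enveloping.i k S L s) n))
    (fun s t => by rw [map_add, F.add_tmul, map_add])
    (fun a s b => by
      rw [← lam_mul_rho, ← map_smul, mul_smul, F.rho_i_smul, F.lam_smul, F.tmul_i_smul, map_mul,
        map_mul])

lemma adjointAt_ev {N : ModuleCat.{u} (Enveloping k S L)}
    {X : ModuleCat.{u} (Env k (Enveloping k S L))} (f : F N ⟶ X) (n : N) (s : S) :
    (adjointAt f n).ev s = f.hom (F.tmul (Enveloping.i k S L s) n) := rfl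

/-- For α in L, the term with α_S(s) in the action on G(X) is what the commutator of α with s
contributes when α is moved past s in U ⊗ N. -/
lemma adjointAt_smul {N : ModuleCat.{u} (Enveloping k S L)}
    {X : ModuleCat.{u} (Env k (Enveloping k S L))} (f : F N ⟶ X) (u : Enveloping k S L) (n : N) :
    adjointAt f (u • n) = u • adjointAt f n := by
  have hadd (n n' : N) : adjointAt f (n + n') = adjointAt f n + adjointAt f n' :=
    GHom.ext' fun s => by
      rw [GHom.add_ev, adjointAt_ev, adjointAt_ev, adjointAt_ev, F.tmul_add, map_add]
  induction u using Enveloping.induction generalizing n with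
  | hi t =>
    refine GHom.ext' fun s => ?_
    rw [GHom.i_smul_ev, adjointAt_ev, adjointAt_ev, F.tmul_i_smul, ← map_smul, F.lam_smul,
      ← map_mul, ← map_mul, mul_comm]
  | hj α =>
    refine GHom.ext' fun s => ?_
    rw [GHom.j_smul_ev, adjointAt_ev, adjointAt_ev, adjointAt_ev, ← map_smul, ← map_smul,
      F.lam_smul, F.rho_j_smul, ← Enveloping.j_mul_i_sub, ← map_sub, ← map_sub]
    congr 1
    have h := F.add_tmul (Enveloping.j k S L α * Enveloping.i k S L s -
      Enveloping.i k S L s * Enveloping.j k S L α)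
      (Enveloping.i k S L s * Enveloping.j k S L α) n
    rw [sub_add_cancel] at h
    rw [h]
    abel
  | hadd u v hu hv => rw [add_smul, hadd, hu, hv, add_smul]
  | hmul u v hu hv => rw [mul_smul, hu, hv, mul_smul]

/-- The adjunction between `F` and `G` on morphisms. -/
def homEquiv (N : ModuleCat.{u} (Enveloping k S L)) (X : ModuleCat.{u} (Env k (Enveloping k S L))) :
    (F N ⟶ X) ≃ (N ⟶ (G k S L).obj X) where
  toFun f := ModuleCat.ofHom (Y := GHom X)
    { toFun := adjointAt f
      map_add' := fun n n' => GHom.ext' fun s => by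
        rw [GHom.add_ev, adjointAt_ev, adjointAt_ev, adjointAt_ev, F.tmul_add, map_add]
      map_smul' := fun u n => adjointAt_smul f u n }
  invFun g :=
    letI g' : N →ₗ[Enveloping k S L] GHom X := g.hom
    -- An element of G(X) is determined by its value at 1, which must be the image of 1 ⊗ n.
    F.lift (fun u n => lam u • (g' n).ev 1)
      (fun u u' n => by rw [lam_add, add_smul])
      (fun u n n' => by rw [map_add, GHom.add_ev, smul_add])
      (fun u s n => by rw [map_smul, GHom.i_smul_ev, lam_mul, mul_smul])
      (fun v u n => by rw [lam_mul, mul_smul])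
      (fun u s n => by
        rw [map_smul, GHom.i_smul_ev, smul_smul (rho _), rho_mul_lam, mul_smul,
          ← GHom.ev_mul_right, ← GHom.ev_mul_left])
      (fun u α n => by
        -- Derivations kill 1, so at s = 1 the action of α loses its third term and matches the
        -- right action on F(N).
        have h0 : (g' n).ev ⁅α, (1 : S)⁆ = 0 := by
          rw [PBW.lie_one_eq_zero]
          exact map_zero (g' n)
        rw [map_smul, GHom.j_smul_ev, h0, lam_mul, mul_smul, sub_zero, smul_sub, sub_sub_cancel,
          smul_smul, smul_smul, rho_mul_lam])
  left_inv f := F.hom_ext fun n => by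
    rw [F.lift_tmul]
    change lam 1 • f.hom (F.tmul (Enveloping.i k S L 1) n) = _
    rw [map_one, ← map_smul, F.lam_smul, mul_one]
  right_inv g := by
    refine ModuleCat.hom_ext (LinearMap.ext fun n => GHom.ext' fun s => ?_)
    have h := GHom.ev_mul_left (M := X) (g.hom n) s 1
    rw [mul_one] at h
    exact h.symm

lemma homEquiv_comp {N : ModuleCat.{u} (Enveloping k S L)}
    {X Y : ModuleCat.{u} (Env k (Enveloping k S L))} (f : F N ⟶ X) (g : X ⟶ Y) :
    homEquiv N Y (f ≫ g) = homEquiv N X f ≫ (G k S L).map g := rfl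

lemma homEquiv_add {N : ModuleCat.{u} (Enveloping k S L)}
    {X : ModuleCat.{u} (Env k (Enveloping k S L))} (f g : F N ⟶ X) :
    homEquiv N X (f + g) = homEquiv N X f + homEquiv N X g := rfl

lemma homEquiv_smul {N : ModuleCat.{u} (Enveloping k S L)}
    {X : ModuleCat.{u} (Env k (Enveloping k S L))} (c : k) (f : F N ⟶ X) :
    homEquiv N X (c • f) = c • homEquiv N X f := by
  refine ModuleCat.hom_ext (LinearMap.ext fun n => GHom.ext' fun s => ?_)
  change _ = GHom.ev (algebraMap k (Enveloping k S L) c • adjointAt f n) s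
  rw [← AlgHom.commutes (Enveloping.i k S L), GHom.i_smul_ev, AlgHom.commutes, lam_algebraMap]
  rfl

variable (k S L) in
/-- The functor `F` is left adjoint to `G`. -/
def adjunction : FFunctor k S L ⊣ G k S L :=
  Adjunction.mkOfHomEquiv
    { homEquiv := fun N X => homEquiv N X
      homEquiv_naturality_left_symm := fun _ _ => F.hom_ext fun _ => rfl
      homEquiv_naturality_right := fun _ _ => rfl }

instance : (G k S L).Additive where
  map_add := rfl

variable [Module.Projective S L]

/-- On underlying groups the functor is U ⊗_S -, and U is flat as a right S-module. -/
instance : (FFunctor k S L).PreservesMonomorphisms where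
  preserves {N N'} f hf := by
    rw [ModuleCat.mono_iff_injective] at hf ⊢
    have := flat_uRight k S L
    let f' := ((ModuleCat.restrictScalars (Enveloping.i k S L).toRingHom).map f).hom
    have h := Module.Flat.lTensor_preserves_injective_linearMap (M := URight k S L) f' hf
    have h2 : ∀ x : F N, (F.map f).hom x = f'.lTensor (URight k S L) x := fun x => by
      induction x using F.induction_on with
      | h0 => exact (map_zero _).trans (map_zero (f'.lTensor (URight k S L))).symm
      | htmul u n => rfl
      | hadd x y hx hy =>
        exact (map_add _ _ _).trans ((congrArg₂ (· + ·) hx hy).trans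
          (map_add (f'.lTensor (URight k S L)) x y).symm)
    intro x y hxy
    exact h (((h2 x).symm.trans hxy).trans (h2 y))

/-- A right adjoint of a functor that preserves monomorphisms preserves injectives. -/
instance (X : ModuleCat.{u} (Env k (Enveloping k S L))) [Injective X] :
    Injective ((G k S L).obj X) :=
  Injective.injective_of_adjoint (adjunction k S L) X

end

end Adjunction

/-! ### The U-module structure on Hochschild cohomology -/

open CochainComplex.HomComplex in
/-- The class of a cocycle vanishes if and only if it is a coboundary. In degree `0` the
incoming differential `d 0 0` is zero. -/
lemma extMk_eq_zero_iff_pred {C : Type*} [Category* C] [Abelian C] [HasExt.{u} C] {X Y : C}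
    (R : InjectiveResolution Y) {n : ℕ} (f : X ⟶ R.cocomplex.X n)
    (hf : f ≫ R.cocomplex.d n (n + 1) = 0) :
    R.extMk f (n + 1) rfl hf = 0 ↔
      ∃ g : X ⟶ R.cocomplex.X (n - 1), g ≫ R.cocomplex.d (n - 1) n = f := by
  obtain _ | n := n
  · have h0 : R.cocomplex.d (0 - 1) 0 = 0 := R.cocomplex.shape _ _ (by simp)
    simp only [← R.extEquivCohomologyClass.apply_eq_iff_eq,
      InjectiveResolution.extEquivCohomologyClass_extMk,
      InjectiveResolution.extEquivCohomologyClass_zero, CohomologyClass.mk_eq_zero_iff]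
    rw [Cocycle.fromSingleMk_mem_coboundaries_iff _ _ _ _ _ (-1) (by simp), h0]
    -- In the complex indexed by the integers a coboundary of degree 0 comes from degree -1, where
    -- the term is zero. With truncated subtraction it comes through the zero map `d 0 0`. Either
    -- way f must vanish.
    have hz : Limits.IsZero (R.cochainComplex.X (-1)) :=
      R.cochainComplex.isZero_of_isStrictlyGE 0 (-1) (by simp)
    constructor
    · rintro ⟨g, hg⟩
      refine ⟨0, ?_⟩
      rw [Limits.comp_zero, ← cancel_mono (R.cochainComplexXIso (0 : ℕ) 0 rfl).inv,
        Limits.zero_comp, ← hg, hz.eq_of_tgt g 0, Limits.zero_comp]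
    · rintro ⟨g, hg⟩
      exact ⟨0, by rw [← hg]; simp⟩
  · exact R.extMk_eq_zero_iff f _ rfl hf n rfl

section

variable {k S L : Type u} [Field k] [CommRing S] [Algebra k S] [LieRing L] [LieAlgebra k L]
  [Module S L] [LieRingModule L S] [LieRinehartRing S L] [LieRinehartAlgebra k S L]
  [Module.Projective S L]

instance : (res k S L).PreservesHomology :=
  Functor.preservesHomology_of_map_exact _ fun T hT => by
    rw [ShortComplex.moduleCat_exact_iff] at hT ⊢
    exact hT

variable {M : ModuleCat.{u} (Env k (Enveloping k S L))}

/-- An injective resolution by `Uᵉ`-modules, regarded as a resolution by `Sᵉ`-modules. -/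
def resResolution (I : InjectiveResolution M) : InjectiveResolution ((res k S L).obj M) where
  cocomplex := ((res k S L).mapHomologicalComplex _).obj I.cocomplex
  injective n := inferInstanceAs (Injective ((res k S L).obj (I.cocomplex.X n)))
  ι := (HomologicalComplex.singleMapHomologicalComplex _ _ _).inv.app _ ≫
    ((res k S L).mapHomologicalComplex _).map I.ι
  quasiIso := inferInstance

lemma augmentation_resResolution (I : InjectiveResolution M) :
    augmentation (resResolution I) = (res k S L).map (augmentation I) := by
  have h := HomologicalComplex.singleMapHomologicalComplex_inv_app_self (res k S L)
    (ComplexShape.up ℕ) 0 M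
  refine (congrArg (· ≫ (res k S L).map (I.ι.f 0)) h).trans ?_
  rfl

/-- The morphism of resolutions given by a comparison. -/
def Comparison.toHom {I : InjectiveResolution M} {J : InjectiveResolution ((res k S L).obj M)}
    (f : Comparison I J) : InjectiveResolution.Hom (resResolution I) J (𝟙 _) where
  hom :=
    { f := f.f
      comm' := fun i j hij => by
        obtain rfl : i + 1 = j := hij
        exact f.comm i }
  ι_f_zero_comp_hom_f_zero := by
    rw [CategoryTheory.Functor.map_id, HomologicalComplex.id_f, Category.id_comp]
    exact (congrArg (· ≫ f.f 0) (augmentation_resResolution I)).trans f.augmentation_comm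

/-- The morphism of resolutions by `Sᵉ`-modules induced by a morphism of resolutions by
`Uᵉ`-modules. -/
def resHom (I I' : InjectiveResolution M) :
    InjectiveResolution.Hom (resResolution I) (resResolution I') (𝟙 _) where
  hom := ((res k S L).mapHomologicalComplex _).map (InjectiveResolution.desc (𝟙 M) I' I)
  ι_f_zero_comp_hom_f_zero := by
    rw [CategoryTheory.Functor.map_id, HomologicalComplex.id_f, Category.id_comp]
    have h : I.ι.f 0 ≫ (InjectiveResolution.desc (𝟙 M) I' I).f 0 = I'.ι.f 0 :=
      (InjectiveResolution.desc_commutes_zero (𝟙 M) I' I).trans (Category.id_comp _)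
    refine (congrArg (· ≫ (res k S L).map ((InjectiveResolution.desc (𝟙 M) I' I).f 0))
      (augmentation_resResolution I)).trans ?_
    refine Eq.trans ?_ (augmentation_resResolution I').symm
    exact ((res k S L).map_comp _ _).symm.trans (congrArg (res k S L).map h)

lemma GHom.toHom_comp_d {X Y : ModuleCat.{u} (Env k (Enveloping k S L))} (d : X ⟶ Y) (φ : GHom X)
    (hφ : GHom.map d φ = 0) : GHom.toHom φ ≫ (res k S L).map d = 0 :=
  ModuleCat.hom_ext hφ

/-- The class in `H^q(S, M)` of a `q`-cocycle of `G(I)`. -/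
def cocycleClass (I : InjectiveResolution M) (q : ℕ) (φ : GHom (I.cocomplex.X q))
    (hφ : GHom.map (I.cocomplex.d q (q + 1)) φ = 0) :
    HochschildCohomology k S ((res k S L).obj M) q :=
  (resResolution I).extMk (GHom.toHom φ) (q + 1) rfl (GHom.toHom_comp_d _ φ hφ)

/-- A comparison is a morphism of injective resolutions over the identity of M, and such morphisms
preserve the classes of cocycles. The class thus depends neither on J nor on the comparison. -/
lemma Comparison.cls_eq {I : InjectiveResolution M} {J : InjectiveResolution ((res k S L).obj M)}
    (f : Comparison I J) (q : ℕ) (φ : GHom (I.cocomplex.X q))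
    (hφ : GHom.map (I.cocomplex.d q (q + 1)) φ = 0) :
    f.cls q φ hφ = cocycleClass I q φ hφ := by
  have h := InjectiveResolution.extMk_comp_mk₀ (R := resResolution I) (GHom.toHom φ) (q + 1) rfl
    (GHom.toHom_comp_d _ φ hφ) f.toHom
  rw [Abelian.Ext.comp_mk₀_id] at h
  exact h.symm

lemma map_desc_eq_zero (I I' : InjectiveResolution M) (q : ℕ) (φ : GHom (I.cocomplex.X q))
    (hφ : GHom.map (I.cocomplex.d q (q + 1)) φ = 0) :
    GHom.map (I'.cocomplex.d q (q + 1))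
      (GHom.map ((InjectiveResolution.desc (𝟙 M) I' I).f q) φ) = 0 := by
  have h := (InjectiveResolution.desc (𝟙 M) I' I).comm q (q + 1)
  change GHom.map ((InjectiveResolution.desc (𝟙 M) I' I).f q ≫ _) φ = 0
  rw [h]
  change GHom.map _ (GHom.map (I.cocomplex.d q (q + 1)) φ) = 0
  rw [hφ, map_zero]

/-- The map between two Uᵉ-resolutions lifts the identity of M, so it preserves classes after
restriction to Sᵉ. Being Uᵉ-linear, it acts on G by a U-linear map. -/
lemma cocycleClass_eq (I I' : InjectiveResolution M) (q : ℕ) (φ : GHom (I.cocomplex.X q))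
    (hφ : GHom.map (I.cocomplex.d q (q + 1)) φ = 0) :
    cocycleClass I q φ hφ =
      cocycleClass I' q (GHom.map ((InjectiveResolution.desc (𝟙 M) I' I).f q) φ)
        (map_desc_eq_zero I I' q φ hφ) := by
  have h := InjectiveResolution.extMk_comp_mk₀ (R := resResolution I) (GHom.toHom φ) (q + 1) rfl
    (GHom.toHom_comp_d _ φ hφ) (resHom I I')
  rw [Abelian.Ext.comp_mk₀_id] at h
  exact h

/-- The identity as a comparison. -/
def Comparison.self (I : InjectiveResolution M) : Comparison I (resResolution I) where
  f _ := 𝟙 _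
  comm _ := (Category.id_comp _).trans (Category.comp_id _).symm
  augmentation_comm := (Category.comp_id _).trans (augmentation_resResolution I).symm

/-- The `q`-cocycles of `G(I)`. -/
abbrev cocycles (I : InjectiveResolution M) (q : ℕ) :
    Submodule (Enveloping k S L) (GHom (I.cocomplex.X q)) :=
  LinearMap.ker (GHom.map (I.cocomplex.d q (q + 1)))

/-- The `q`-coboundaries of `G(I)`. -/
abbrev coboundaries (I : InjectiveResolution M) (q : ℕ) :
    Submodule (Enveloping k S L) (GHom (I.cocomplex.X q)) :=
  LinearMap.range (GHom.map (I.cocomplex.d (q - 1) q))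

lemma cocycleClass_add (I : InjectiveResolution M) (q : ℕ) (φ ψ : GHom (I.cocomplex.X q))
    (hφ : GHom.map (I.cocomplex.d q (q + 1)) φ = 0) (hψ : GHom.map (I.cocomplex.d q (q + 1)) ψ = 0)
    (h : GHom.map (I.cocomplex.d q (q + 1)) (φ + ψ) = 0) :
    cocycleClass I q (φ + ψ) h = cocycleClass I q φ hφ + cocycleClass I q ψ hψ := by
  have h1 := (resResolution I).add_extMk (GHom.toHom φ) (GHom.toHom ψ) (q + 1) rfl
    (GHom.toHom_comp_d _ φ hφ) (GHom.toHom_comp_d _ ψ hψ)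
  exact h1.symm

/-- The map that sends a cocycle to its class. -/
def classHom (I : InjectiveResolution M) (q : ℕ) :
    cocycles I q →+ HochschildCohomology k S ((res k S L).obj M) q :=
  AddMonoidHom.mk' (fun φ => cocycleClass I q φ.1 φ.2) (fun φ ψ =>
    cocycleClass_add I q φ.1 ψ.1 φ.2 ψ.2 _)

lemma classHom_surjective (I : InjectiveResolution M) (q : ℕ) :
    Function.Surjective (classHom I q) := fun x => by
  obtain ⟨f, hf, rfl⟩ := (resResolution I).extMk_surjective x (q + 1) rfl
  exact ⟨⟨f.hom, congrArg ModuleCat.Hom.hom hf⟩, rfl⟩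

lemma classHom_eq_zero_iff (I : InjectiveResolution M) (q : ℕ) (φ : cocycles I q) :
    classHom I q φ = 0 ↔ φ.1 ∈ coboundaries I q := by
  refine (extMk_eq_zero_iff_pred (resResolution I) (GHom.toHom φ.1)
    (GHom.toHom_comp_d _ φ.1 φ.2)).trans ⟨?_, ?_⟩
  · rintro ⟨g, hg⟩
    exact ⟨g.hom, congrArg ModuleCat.Hom.hom hg⟩
  · rintro ⟨g, hg⟩
    exact ⟨GHom.toHom g, ModuleCat.hom_ext hg⟩

/-- The quotient of the cocycles by the coboundaries is the Hochschild cohomology. -/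
def classEquiv (I : InjectiveResolution M) (q : ℕ) :
    (cocycles I q ⧸ (coboundaries I q).submoduleOf (cocycles I q)) ≃+
      HochschildCohomology k S ((res k S L).obj M) q :=
  AddEquiv.ofBijective
    (QuotientAddGroup.lift _ (classHom I q) (fun φ hφ => (classHom_eq_zero_iff I q φ).2 hφ))
    ⟨by
      refine (injective_iff_map_eq_zero _).2 fun x hx => ?_
      obtain ⟨φ, rfl⟩ := QuotientAddGroup.mk_surjective x
      exact (QuotientAddGroup.eq_zero_iff φ).2 ((classHom_eq_zero_iff I q φ).1 hx),
    fun x => by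
      obtain ⟨φ, rfl⟩ := classHom_surjective I q x
      exact ⟨QuotientAddGroup.mk φ, rfl⟩⟩

/-- One resolution is enough: cocycles of any other are carried to it by a U-linear map that keeps
their classes. -/
lemma isInduced_iff (I : InjectiveResolution M) (q : ℕ)
    (μ : Module (Enveloping k S L) (HochschildCohomology k S ((res k S L).obj M) q)) :
    IsInduced M q μ ↔ ∀ (u : Enveloping k S L) (φ : cocycles I q),
      u • classHom I q φ = classHom I q (u • φ) := by
  refine ⟨fun h u φ => ?_, fun h I' J f u φ hφ => ?_⟩
  · have h1 := h I (resResolution I) (Comparison.self I) u φ.1 φ.2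
    exact ((congrArg (u • ·) (Comparison.cls_eq _ q φ.1 φ.2)).symm.trans h1).trans
      (Comparison.cls_eq ..)
  · rw [Comparison.cls_eq, Comparison.cls_eq, cocycleClass_eq I' I, cocycleClass_eq I' I]
    have h1 : u • (⟨_, map_desc_eq_zero I' I q φ hφ⟩ : cocycles I q) =
        ⟨_, map_desc_eq_zero I' I q (u • φ) (by rw [map_smul, hφ, smul_zero])⟩ :=
      Subtype.ext (map_smul _ u φ).symm
    have h2 := h u ⟨_, map_desc_eq_zero I' I q φ hφ⟩
    rw [h1] at h2
    exact h2

/-- Cocycles and coboundaries of G(I) are U-submodules, so the structure is transported from their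
quotient. Uniqueness holds since every class has a cocycle representing it. -/
theorem existsUnique_isInduced (M : ModuleCat.{u} (Env k (Enveloping k S L))) (q : ℕ) :
    ∃! μ : Module (Enveloping k S L) (HochschildCohomology k S ((res k S L).obj M) q),
      IsInduced M q μ := by
  obtain ⟨I⟩ : Nonempty (InjectiveResolution M) := HasInjectiveResolution.out
  refine ⟨(classEquiv I q).symm.module (Enveloping k S L), ?_, fun μ hμ => ?_⟩
  · refine (isInduced_iff I q _).2 fun u φ => ?_
    have h : (classEquiv I q).symm (classHom I q φ) = Submodule.Quotient.mk φ :=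
      (classEquiv I q).symm_apply_apply (Submodule.Quotient.mk φ)
    change classEquiv I q (u • (classEquiv I q).symm (classHom I q φ)) = _
    rw [h]
    rfl
  · refine Module.ext' _ _ fun u x => ?_
    obtain ⟨φ, rfl⟩ := classHom_surjective I q x
    refine ((isInduced_iff I q μ).1 hμ u φ).trans ?_
    have h : (classEquiv I q).symm (classHom I q φ) = Submodule.Quotient.mk φ :=
      (classEquiv I q).symm_apply_apply (Submodule.Quotient.mk φ)
    change _ = classEquiv I q (u • (classEquiv I q).symm (classHom I q φ))
    rw [h]
    rfl

end

/-! ### Convergence of the spectral sequence of a first-quadrant spectral object -/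

section Convergence

open Abelian ComposableArrows Limits

variable {k : Type u} [Field k] (Y : SpectralObject (ModuleCat.{u} k) EInt)

/-- The map `H^n(a → b) → H^n(a' → b')` of a spectral object for `a ≤ a'` and `b ≤ b'`. -/
def hMap (n : ℤ) {a b a' b' : EInt} (hab : a ≤ b) (hab' : a' ≤ b') (ha : a ≤ a') (hb : b ≤ b') :
    (Y.H n).obj (mk₁ (homOfLE hab)) ⟶ (Y.H n).obj (mk₁ (homOfLE hab')) :=
  (Y.H n).map (homMk₁ (homOfLE ha) (homOfLE hb))

lemma eq_of_thin {a b a' b' : EInt} {hab : a ≤ b} {hab' : a' ≤ b'}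
    (f g : mk₁ (homOfLE hab) ⟶ mk₁ (homOfLE hab')) : f = g :=
  hom_ext₁ (Subsingleton.elim _ _) (Subsingleton.elim _ _)

lemma hMap_eq (n : ℤ) {a b a' b' : EInt} {hab : a ≤ b} {hab' : a' ≤ b'} (ha : a ≤ a') (hb : b ≤ b')
    (f : mk₁ (homOfLE hab) ⟶ mk₁ (homOfLE hab')) :
    (Y.H n).map f = hMap Y n hab hab' ha hb :=
  congrArg (Y.H n).map (eq_of_thin _ _)

lemma hMap_comp (n : ℤ) {a b a' b' a'' b'' : EInt} (hab : a ≤ b) (hab' : a' ≤ b')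
    (hab'' : a'' ≤ b'') (ha : a ≤ a') (hb : b ≤ b') (ha' : a' ≤ a'') (hb' : b' ≤ b'') :
    hMap Y n hab hab' ha hb ≫ hMap Y n hab' hab'' ha' hb' =
      hMap Y n hab hab'' (ha.trans ha') (hb.trans hb') := by
  rw [hMap, hMap, ← Functor.map_comp]
  exact hMap_eq Y n _ _ _

lemma hMap_range_eq_ker (n : ℤ) {a b c : EInt} (hab : a ≤ b) (hbc : b ≤ c) :
    LinearMap.range (hMap Y n hab (hab.trans hbc) le_rfl hbc).hom =
      LinearMap.ker (hMap Y n (hab.trans hbc) hbc hab le_rfl).hom := by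
  have h := (ShortComplex.moduleCat_exact_iff_range_eq_ker _).1
    (Y.exact₂ (homOfLE hab) (homOfLE hbc) (homOfLE (hab.trans hbc)) rfl n)
  refine Eq.trans ?_ (h.trans ?_)
  · exact congrArg (fun f => LinearMap.range (ModuleCat.Hom.hom f))
      (hMap_eq Y n le_rfl hbc _).symm
  · exact congrArg (fun f => LinearMap.ker (ModuleCat.Hom.hom f)) (hMap_eq Y n hab le_rfl _)

lemma mono_hMap (n₀ n : ℤ) (hn : n₀ + 1 = n) {a b c : EInt} (hab : a ≤ b) (hbc : b ≤ c)
    (h : IsZero ((Y.H n₀).obj (mk₁ (homOfLE hbc)))) :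
    Mono (hMap Y n hab (hab.trans hbc) le_rfl hbc) := by
  have h1 := (Y.exact₁ (homOfLE hab) (homOfLE hbc) (homOfLE (hab.trans hbc)) rfl n₀ n
    hn).mono_g (h.eq_of_src _ _)
  exact (congrArg (fun f => Mono f) (hMap_eq Y n le_rfl hbc _)).mp h1

lemma epi_hMap (n n₁ : ℤ) (hn : n + 1 = n₁) {a b c : EInt} (hab : a ≤ b) (hbc : b ≤ c)
    (h : IsZero ((Y.H n₁).obj (mk₁ (homOfLE hab)))) :
    Epi (hMap Y n (hab.trans hbc) hbc hab le_rfl) := by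
  have h1 := (Y.exact₃ (homOfLE hab) (homOfLE hbc) (homOfLE (hab.trans hbc)) rfl n n₁
    hn).epi_f (h.eq_of_tgt _ _)
  exact (congrArg (fun f => Epi f) (hMap_eq Y n hab le_rfl _)).mp h1

/-- Exactness makes H^n(a → i₂) surject onto H^n(i₀ → i₂) and H^n(i₁ → i₃) inject into H^n(i₁ → b)
under the two vanishing hypotheses. Since the term E is the image of H^n(i₀ → i₂) in H^n(i₁ → i₃),
it is also the image of the longer map. -/
lemma e_factorization (n₀ n n₁ : ℤ) (hn₀ : n₀ + 1 = n) (hn₁ : n + 1 = n₁) {a i₀ i₁ i₂ i₃ b : EInt}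
    (ha : a ≤ i₀) (h₀₁ : i₀ ≤ i₁) (h₁₂ : i₁ ≤ i₂) (h₂₃ : i₂ ≤ i₃) (hb : i₃ ≤ b)
    (hza : IsZero ((Y.H n₁).obj (mk₁ (homOfLE ha))))
    (hzb : IsZero ((Y.H n₀).obj (mk₁ (homOfLE hb)))) :
    ∃ (s : (Y.H n).obj (mk₁ (homOfLE (ha.trans (h₀₁.trans h₁₂)))) ⟶
        Y.E (homOfLE h₀₁) (homOfLE h₁₂) (homOfLE h₂₃) n₀ n n₁ hn₀ hn₁)
      (t : Y.E (homOfLE h₀₁) (homOfLE h₁₂) (homOfLE h₂₃) n₀ n n₁ hn₀ hn₁ ⟶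
        (Y.H n).obj (mk₁ (homOfLE (h₁₂.trans (h₂₃.trans hb))))),
      Epi s ∧ Mono t ∧ s ≫ t = hMap Y n (ha.trans (h₀₁.trans h₁₂)) (h₁₂.trans (h₂₃.trans hb))
        (ha.trans h₀₁) (h₂₃.trans hb) := by
  have := epi_hMap Y n n₁ hn₁ ha (h₀₁.trans h₁₂) hza
  have := mono_hMap Y n₀ n hn₀ (h₁₂.trans h₂₃) hb hzb
  refine ⟨hMap Y n (ha.trans (h₀₁.trans h₁₂)) (h₀₁.trans h₁₂) ha le_rfl ≫
      Y.toCycles (homOfLE h₀₁) (homOfLE h₁₂) (homOfLE (h₀₁.trans h₁₂)) rfl n ≫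
      Y.πE (homOfLE h₀₁) (homOfLE h₁₂) (homOfLE h₂₃) n₀ n n₁ hn₀ hn₁,
    Y.ιE (homOfLE h₀₁) (homOfLE h₁₂) (homOfLE h₂₃) n₀ n n₁ hn₀ hn₁ ≫
      Y.fromOpcycles (homOfLE h₁₂) (homOfLE h₂₃) (homOfLE (h₁₂.trans h₂₃)) rfl n ≫
      hMap Y n (h₁₂.trans h₂₃) (h₁₂.trans (h₂₃.trans hb)) le_rfl hb,
    inferInstance, inferInstance, ?_⟩
  simp only [Category.assoc]
  rw [Y.πE_ιE_assoc (homOfLE h₀₁) (homOfLE h₁₂) (homOfLE h₂₃) n₀ n n₁ hn₀ hn₁,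
    Y.toCycles_i_assoc, Y.p_fromOpcycles_assoc,
    hMap_eq Y n h₀₁ le_rfl (twoδ₁Toδ₀ _ _ _ _), hMap_eq Y n le_rfl h₂₃ (twoδ₂Toδ₁ _ _ _ _),
    hMap_comp, hMap_comp, hMap_comp]

/-- A subquotient description of the image of a composition. -/
def subquotientEquiv {A₀ A₁ T Q E : ModuleCat.{u} k} (j₀ : A₀ ⟶ T) (j₁ : A₁ ⟶ T) (r : T ⟶ Q)
    (s : A₁ ⟶ E) (t : E ⟶ Q) [Epi s] [Mono t] (h : s ≫ t = j₁ ≫ r)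
    (hj : LinearMap.range j₀.hom = LinearMap.ker r.hom) :
    (LinearMap.range j₁.hom ⧸ (LinearMap.range j₀.hom).submoduleOf (LinearMap.range j₁.hom)) ≃ₗ[k]
      E :=
  letI f := r.hom ∘ₗ (LinearMap.range j₁.hom).subtype
  have hker : (LinearMap.range j₀.hom).submoduleOf (LinearMap.range j₁.hom) = LinearMap.ker f := by
    rw [hj]
    rfl
  have hrange : LinearMap.range f = LinearMap.range t.hom := by
    rw [LinearMap.range_comp, Submodule.range_subtype, ← LinearMap.range_comp]
    have h1 : r.hom ∘ₗ j₁.hom = t.hom ∘ₗ s.hom := (congrArg ModuleCat.Hom.hom h).symm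
    rw [h1, LinearMap.range_comp_of_range_eq_top _
      (LinearMap.range_eq_top.2 ((ModuleCat.epi_iff_surjective s).1 inferInstance))]
  (Submodule.quotEquivOfEq _ _ hker).trans <| f.quotKerEquivRange.trans <|
    (LinearEquiv.ofEq _ _ hrange).trans
      (LinearEquiv.ofInjective t.hom ((ModuleCat.mono_iff_injective t).1 inferInstance)).symm

/-- The image of a subquotient under a linear equivalence. -/
def quotientSubmoduleOfMapEquiv {T A : Type*} [AddCommGroup T] [AddCommGroup A] [Module k T]
    [Module k A] (e : T ≃ₗ[k] A) (P Q : Submodule k T) :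
    (P.map e.toLinearMap ⧸ (Q.map e.toLinearMap).submoduleOf (P.map e.toLinearMap)) ≃ₗ[k]
      (P ⧸ Q.submoduleOf P) :=
  (Submodule.Quotient.equiv (Q.submoduleOf P) ((Q.map e.toLinearMap).submoduleOf _)
    (e.submoduleMap P) (by
      ext x
      simp only [Submodule.mem_map, Submodule.submoduleOf, Submodule.mem_comap]
      constructor
      · rintro ⟨y, hy, rfl⟩
        exact ⟨y.1, hy, rfl⟩
      · rintro ⟨y, hy, hyx⟩
        obtain ⟨z, hz, hzx⟩ := x.2
        obtain rfl : y = z := e.injective (hyx.trans hzx.symm)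
        exact ⟨⟨y, hz⟩, hy, Subtype.ext hyx⟩)).symm

variable [Y.IsFirstQuadrant]

/-- The terms of the filtration of the abutment of a spectral object. -/
def filtration (n i : ℤ) : Submodule k ((Y.H n).obj (mk₁ (homOfLE (bot_le : (⊥ : EInt) ≤ ⊤)))) :=
  LinearMap.range (hMap Y n (bot_le : (⊥ : EInt) ≤ (i : EInt)) bot_le le_rfl le_top).hom

lemma filtration_mono (n : ℤ) : Monotone (filtration Y n) := fun i j hij => by
  have h : (i : EInt) ≤ (j : EInt) := WithBotTop.coe_le_coe.2 hij
  have h1 := hMap_comp Y n (bot_le : (⊥ : EInt) ≤ (i : EInt)) (bot_le : (⊥ : EInt) ≤ (j : EInt))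
    (bot_le : (⊥ : EInt) ≤ ⊤) le_rfl h le_rfl le_top
  rw [filtration, ← h1]
  exact LinearMap.range_comp_le_range _ _

/-- The obstruction to surjectivity lies in H^n(n + 1 → ⊤), which vanishes in the first quadrant. -/
lemma filtration_eq_top (n : ℤ) : filtration Y n (n + 1) = ⊤ := by
  have h := hMap_range_eq_ker Y n (bot_le : (⊥ : EInt) ≤ ((n + 1 : ℤ) : EInt)) le_top
  refine h.trans (LinearMap.ker_eq_top.2 ?_)
  have hz := Y.isZero₂_of_isFirstQuadrant ((n + 1 : ℤ) : EInt) ⊤ le_top n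
    (WithBotTop.coe_lt_coe.2 (lt_add_one n))
  exact congrArg ModuleCat.Hom.hom (hz.eq_of_tgt _ 0)

lemma filtration_eq_bot (n : ℤ) : filtration Y n 0 = ⊥ := by
  have hz := Y.isZero₁_of_isFirstQuadrant ⊥ ((0 : ℤ) : EInt) bot_le le_rfl n
  refine LinearMap.range_eq_bot.2 ?_
  exact congrArg ModuleCat.Hom.hom (hz.eq_of_src _ 0)

/-- On the page r = p + q + 2 the outer indices are q - r + 2 = -p and q + r - 1 = p + 2q + 1. They
are far enough out for both vanishing conditions of `e_factorization`, so E_∞ is the image of H^n(⊥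
→ q + 1) in H^n(q → ⊤). The kernel of H^n(⊥ → ⊤) → H^n(q → ⊤) is the previous step of the
filtration. -/
lemma nonempty_filtration_quotient_equiv (p q : ℕ) (n : ℤ) (hn : n = p + q) :
    Nonempty ((filtration Y n (q + 1) ⧸
      (filtration Y n q).submoduleOf (filtration Y n (q + 1))) ≃ₗ[k]
        pageInfinity Y.E₂SpectralSequenceNat p q) := by
  let e := Y.spectralSequencePageXIso SpectralObject.coreE₂CohomologicalNat (p + q + 2)
    (by omega) (p, q) ((-p : ℤ) : EInt) ((q : ℤ) : EInt) ((q + 1 : ℤ) : EInt)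
    ((p + 2 * q + 1 : ℤ) : EInt)
    (by simp only [SpectralObject.coreE₂CohomologicalNat_i₀]; congr 1; omega) rfl rfl
    (by simp only [SpectralObject.coreE₂CohomologicalNat_i₃]; congr 1; omega)
    (n - 1) n (n + 1) hn (by omega) rfl
  obtain ⟨s, t, hs, ht, hst⟩ := e_factorization Y (n - 1) n (n + 1) (by omega) rfl
    (a := ⊥) (i₀ := ((-p : ℤ) : EInt)) (i₁ := ((q : ℤ) : EInt)) (i₂ := ((q + 1 : ℤ) : EInt))
    (i₃ := ((p + 2 * q + 1 : ℤ) : EInt)) (b := ⊤) bot_le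
    (WithBotTop.coe_le_coe.2 (by omega)) (WithBotTop.coe_le_coe.2 (by omega))
    (WithBotTop.coe_le_coe.2 (by omega)) le_top
    (Y.isZero₁_of_isFirstQuadrant _ _ _ (WithBotTop.coe_le_coe.2 (by omega)) _)
    (Y.isZero₂_of_isFirstQuadrant _ _ _ _ (WithBotTop.coe_lt_coe.2 (by omega)))
  refine ⟨(subquotientEquiv
    (hMap Y n (bot_le : (⊥ : EInt) ≤ ((q : ℤ) : EInt)) bot_le le_rfl le_top)
    (hMap Y n (bot_le : (⊥ : EInt) ≤ ((q + 1 : ℤ) : EInt)) bot_le le_rfl le_top)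
    (hMap Y n bot_le (le_top : ((q : ℤ) : EInt) ≤ ⊤) bot_le le_rfl) s t ?_
    (hMap_range_eq_ker Y n _ _)).trans e.symm.toLinearEquiv⟩
  rw [hst, hMap_comp]

theorem convergesTo {A : ℕ → Type u} [∀ n, AddCommGroup (A n)] [∀ n, Module k (A n)]
    (e : ∀ n : ℕ, (Y.H n).obj (mk₁ (homOfLE (bot_le : (⊥ : EInt) ≤ ⊤))) ≃ₗ[k] A n) :
    ConvergesTo Y.E₂SpectralSequenceNat A := fun n => by
  -- The filtration of the spectral object increases with the truncation index; the shift n + 1 - p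
  -- makes it decrease in p, with the step from q to q + 1 at p = n - q.
  refine ⟨fun p => (filtration Y n (n + 1 - p)).map (e n).toLinearMap, fun p p' hpp' => ?_, ?_, ?_,
    fun p q hpq => ?_⟩
  · exact Submodule.map_mono (filtration_mono Y n (by omega))
  · have h : ((n : ℤ) + 1 - (0 : ℕ)) = n + 1 := by omega
    simp only [h, filtration_eq_top]
    rw [Submodule.map_top]
    exact LinearEquiv.range _
  · have h : ((n : ℤ) + 1 - (n + 1 : ℕ)) = 0 := by omega
    simp only [h, filtration_eq_bot, Submodule.map_bot]
  · have h₁ : ((n : ℤ) + 1 - p) = q + 1 := by omega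
    have h₂ : ((n : ℤ) + 1 - (p + 1 : ℕ)) = q := by omega
    beta_reduce
    rw [h₁, h₂]
    exact nonempty_filtration_quotient_equiv Y p q n (by omega) |>.map
      (quotientSubmoduleOfMapEquiv (e n) _ _).trans

end Convergence

/-! ### Spectral objects from Hom functors on a triangulated category -/

section Homological

open Limits Pretriangulated ComposableArrows

variable {C : Type*} [Category* C] [HasZeroObject C]
  [HasShift C ℤ] [Preadditive C] [∀ (n : ℤ), (shiftFunctor C n).Additive] [Pretriangulated C]

/-- The spectral object in an abelian category obtained by applying a homological functor to
a spectral object in a triangulated category. -/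
def mapHomologicalFunctor {ι A : Type*} [Category* ι] [Category* A] [Abelian A]
    (X : Triangulated.SpectralObject C ι) (Φ : C ⥤ A) [Φ.IsHomological] [Φ.ShiftSequence ℤ] :
    Abelian.SpectralObject A ι where
  H n := X.ω₁ ⋙ Φ.shift n
  δ' n₀ n₁ h :=
    { app D := Φ.homologySequenceδ (X.ω₂.obj D) n₀ n₁ h
      naturality _ _ f := Φ.homologySequenceδ_naturality _ _ (X.ω₂.map f) n₀ n₁ h }
  exact₁' n₀ n₁ h D :=
    (Φ.homologySequence_exact₁ _ (X.distinguished' D) n₀ n₁ h).exact_toComposableArrows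
  exact₂' n D := (Φ.homologySequence_exact₂ _ (X.distinguished' D) n).exact_toComposableArrows
  exact₃' n₀ n₁ h D :=
    (Φ.homologySequence_exact₃ _ (X.distinguished' D) n₀ n₁ h).exact_toComposableArrows

variable (k : Type u) [Field k] [Linear k C] (A : C) [∀ X, Small.{u} (A ⟶ X)]

/-- The functor `Hom(A, -)` with values in small `k`-modules. -/
def shrinkHom : C ⥤ ModuleCat.{u} k where
  obj X := ModuleCat.of k (Shrink.{u} (A ⟶ X))
  map f := ModuleCat.ofHom ((Shrink.linearEquiv k _).symm.toLinearMap ∘ₗ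
    Linear.rightComp k A f ∘ₗ (Shrink.linearEquiv k _).toLinearMap)
  map_id X := by
    ext x
    simp
  map_comp f g := by
    ext x
    simp

/-- The elements of `shrinkHom k A` are morphisms. -/
def shrinkHomEquiv (X : C) : (shrinkHom k A).obj X ≃ₗ[k] (A ⟶ X) :=
  Shrink.linearEquiv k (A ⟶ X)

lemma shrinkHomEquiv_map {X Y : C} (f : X ⟶ Y) (x : (shrinkHom k A).obj X) :
    shrinkHomEquiv k A Y ((shrinkHom k A).map f x) = shrinkHomEquiv k A X x ≫ f :=
  (Shrink.linearEquiv k _).apply_symm_apply _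

instance : (shrinkHom k A).Additive where
  map_add {X Y f g} := by
    ext x
    apply (shrinkHomEquiv k A Y).injective
    rw [shrinkHomEquiv_map, ModuleCat.hom_add, LinearMap.add_apply, map_add,
      Preadditive.comp_add]
    exact (congrArg₂ (· + ·) (shrinkHomEquiv_map k A f x) (shrinkHomEquiv_map k A g x)).symm

instance : (shrinkHom k A).IsHomological where
  exact T hT := by
    rw [ShortComplex.moduleCat_exact_iff]
    intro x hx
    have h : shrinkHomEquiv k A _ x ≫ T.mor₂ = 0 := 
      (shrinkHomEquiv_map k A T.mor₂ x).symm.trans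
        ((congrArg (shrinkHomEquiv k A _) hx).trans (map_zero _))
    obtain ⟨y, hy⟩ := Triangle.coyoneda_exact₂ T hT _ h
    refine ⟨(shrinkHomEquiv k A _).symm y, (shrinkHomEquiv k A _).injective ?_⟩
    exact (shrinkHomEquiv_map k A T.mor₁ _).trans
      ((congrArg (· ≫ T.mor₁) (LinearEquiv.apply_symm_apply _ y)).trans hy.symm)

instance : (shrinkHom k A).ShiftSequence ℤ := Functor.ShiftSequence.tautological _ _

/-- The objects of the spectral object obtained from a functor `Hom(A, -)`. -/
def mapShrinkHomEquiv {ι : Type*} [Category* ι]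
    (X : Triangulated.SpectralObject C ι) (n : ℤ) (D : ComposableArrows ι 1) :
    ((mapHomologicalFunctor X (shrinkHom k A)).H n).obj D ≃ₗ[k] (A ⟶ (X.ω₁.obj D)⟦n⟧) :=
  shrinkHomEquiv k A _

end Homological

/-! ### The hyperext spectral sequence -/

section Derived

open Limits Pretriangulated ComposableArrows DerivedCategory

universe w

variable {C : Type v} [Category.{u} C] [Abelian C] [HasDerivedCategory.{w} C]

/-- A projective resolution of N is K-projective, so these morphisms are homotopy classes of chain
maps, which form a quotient of a small set. Smallness lets the spectral sequence live in vector
spaces of the original universe. -/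
lemma small_singleFunctor_hom [EnoughProjectives C] (N : C) (X : DerivedCategory C) :
    Small.{u} ((singleFunctor C 0).obj N ⟶ X) := by
  let P := ProjectiveResolution.of N
  let e : (singleFunctor C 0).obj N ≅
      Qh.obj ((HomotopyCategory.quotient _ _).obj P.cochainComplex) :=
    (singleFunctorIsoCompQ C 0).app N ≪≫ (asIso (Q.map P.π')).symm ≪≫
      (quotientCompQhIso C).symm.app _
  obtain ⟨Z, ⟨e'⟩⟩ : ∃ Z, Nonempty (Qh.obj Z ≅ X) := ⟨_, ⟨Qh.objObjPreimageIso X⟩⟩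
  have : Small.{u} ((HomotopyCategory.quotient _ _).obj P.cochainComplex ⟶ Z) :=
    small_of_surjective (HomotopyCategory.quotient C (ComplexShape.up ℤ)).map_surjective
  exact small_of_injective (e.homCongr e'.symm |>.trans
    (Equiv.ofBijective _ (CochainComplex.IsKProjective.Qh_map_bijective
      P.cochainComplex Z)).symm).injective

lemma isIso_homologyFunctor_map_mor₁ {T : Triangle (DerivedCategory C)} (hT : T ∈ distTriang _)
    (n₀ n₁ : ℤ) (h : n₀ + 1 = n₁) (h₀ : IsZero ((homologyFunctor C n₀).obj T.obj₃))
    (h₁ : IsZero ((homologyFunctor C n₁).obj T.obj₃)) :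
    IsIso ((homologyFunctor C n₁).map T.mor₁) :=
  have := (HomologySequence.mono_homologyMap_mor₁_iff T hT n₀ n₁ h).2 (h₀.eq_of_src _ _)
  have := (HomologySequence.epi_homologyMap_mor₁_iff T hT n₁).2 (h₁.eq_of_tgt _ _)
  isIso_of_mono_of_epi _

lemma isIso_homologyFunctor_map_mor₂ {T : Triangle (DerivedCategory C)} (hT : T ∈ distTriang _)
    (n₀ n₁ : ℤ) (h : n₀ + 1 = n₁) (h₀ : IsZero ((homologyFunctor C n₀).obj T.obj₁))
    (h₁ : IsZero ((homologyFunctor C n₁).obj T.obj₁)) :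
    IsIso ((homologyFunctor C n₀).map T.mor₂) :=
  have := (HomologySequence.mono_homologyMap_mor₂_iff T hT n₀).2 (h₀.eq_of_src _ _)
  have := (HomologySequence.epi_homologyMap_mor₂_iff T hT n₀ n₁ h).2 (h₁.eq_of_tgt _ _)
  isIso_of_mono_of_epi _

/-- The truncation to a single degree of an object of the derived category is concentrated in this
degree, with the same cohomology as this object. -/
lemma nonempty_truncation_iso (X : DerivedCategory C) (q : ℤ) :
    Nonempty ((TStructure.t.truncGE q).obj ((TStructure.t.truncLT (q + 1)).obj X) ≅
      (singleFunctor C q).obj ((homologyFunctor C q).obj X)) := by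
  let t := TStructure.t (C := C)
  let Y := (t.truncLT (q + 1)).obj X
  have hY : IsLE Y q := by
    have := t.isLE_of_le Y (q + 1 - 1) q (by omega)
    exact this
  have : IsLE ((t.truncGE q).obj Y) q := inferInstance
  have : IsGE ((t.truncGE q).obj Y) q := inferInstance
  obtain ⟨Z, ⟨e⟩⟩ := exists_iso_singleFunctor_obj_of_isGE_of_isLE ((t.truncGE q).obj Y) q
  have h₃ : IsGE ((t.triangleLTGE (q + 1)).obj X).obj₃ (q + 1) := inferInstance
  have h₁ : IsLE ((t.triangleLTGE q).obj Y).obj₁ (q - 1) := inferInstance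
  -- The third vertex lives in degrees at least q + 1, so it contributes nothing to the long exact
  -- sequence around degree q.
  have hi₁ := isIso_homologyFunctor_map_mor₁ (t.triangleLTGE_distinguished (q + 1) X)
    (q - 1) q (by omega) (isZero_of_isGE _ (q + 1) _ (by omega))
    (isZero_of_isGE _ (q + 1) _ (by omega))
  -- Here the first vertex lives in degrees at most q - 1, so it has no cohomology in degrees q and
  -- q + 1.
  have hi₂ := isIso_homologyFunctor_map_mor₂ (t.triangleLTGE_distinguished q Y)
    q (q + 1) rfl (isZero_of_isLE _ (q - 1) _ (by omega))
    (isZero_of_isLE _ (q - 1) _ (by omega))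
  let e₁ : (homologyFunctor C q).obj Y ≅ (homologyFunctor C q).obj X :=
    @asIso _ _ _ _ _ hi₁
  let e₂ : (homologyFunctor C q).obj Y ≅ (homologyFunctor C q).obj ((t.truncGE q).obj Y) :=
    @asIso _ _ _ _ _ hi₂
  exact ⟨e ≪≫ (singleFunctor C q).mapIso (((singleFunctorCompHomologyFunctorIso C q).app Z).symm ≪≫
    (homologyFunctor C q).mapIso e.symm ≪≫ e₂.symm ≪≫ e₁)⟩

variable {k : Type u} [Field k] [Linear k C]

variable (k) in
/-- The linear equivalence on morphisms with a fixed source induced by an isomorphism. -/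
def homPostcompEquiv {D : Type*} [Category* D] [Preadditive D] [Linear k D] (A : D) {X Y : D}
    (e : X ≅ Y) : (A ⟶ X) ≃ₗ[k] (A ⟶ Y) :=
  Linear.homCongr k (Iso.refl A) e

/-- Morphisms to a shifted single object are `Ext` groups. -/
def homSingleShiftEquiv [HasExt.{u} C] (N Y : C) (p : ℕ) (q n : ℤ) (h : n = p + q) :
    ((singleFunctor C 0).obj N ⟶ ((singleFunctor C q).obj Y)⟦n⟧) ≃ₗ[k] Abelian.Ext.{u} N Y p :=
  -- Shifting by n = p + q from degree q and shifting by p from degree 0 both end in degree -p.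
  (homPostcompEquiv k _ (((singleFunctors C).shiftIso n (-p) q (by omega)).app Y ≪≫
    (((singleFunctors C).shiftIso (p : ℤ) (-p) 0 (by omega)).app Y).symm)).trans
    Abelian.Ext.homLinearEquiv.symm

section SpectralObject

variable (k) [EnoughProjectives C]

instance (N : C) (X : DerivedCategory C) : Small.{u} ((singleFunctor C 0).obj N ⟶ X) :=
  small_singleFunctor_hom N X

/-- The spectral object of the hyperext spectral sequence. -/
def hyperextSpectralObject (N : C) (X : DerivedCategory C) :
    Abelian.SpectralObject (ModuleCat.{u} k) EInt :=
  mapHomologicalFunctor (TStructure.t.spectralObject X) (shrinkHom k ((singleFunctor C 0).obj N))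

variable (N : C) (X : DerivedCategory C)

/-- The terms of the spectral object of the hyperext spectral sequence. -/
def hyperextSpectralObjectEquiv (n : ℤ) {i j : EInt} (hij : i ≤ j) :
    ((hyperextSpectralObject k N X).H n).obj (mk₁ (homOfLE hij)) ≃ₗ[k]
      ((singleFunctor C 0).obj N ⟶
        ((TStructure.t.eTruncGE.obj i).obj ((TStructure.t.eTruncLT.obj j).obj X))⟦n⟧) :=
  mapShrinkHomEquiv k _ _ n _

/-- The abutment of the hyperext spectral sequence. -/
def hyperextAbutmentEquiv (n : ℤ) :
    ((hyperextSpectralObject k N X).H n).obj (mk₁ (homOfLE (bot_le : (⊥ : EInt) ≤ ⊤))) ≃ₗ[k]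
      ((singleFunctor C 0).obj N ⟶ X⟦n⟧) :=
  hyperextSpectralObjectEquiv k N X n bot_le

/-- Truncating an object of degrees at least 0 below some j ≤ 0 gives zero. For i > n, the part in
degrees at least i shifted by n lies in degrees at least 1, where N in degree 0 has no morphisms to
it. -/
instance isFirstQuadrant_hyperextSpectralObject [X.IsGE 0] :
    (hyperextSpectralObject k N X).IsFirstQuadrant where
  isZero₁ i j hij hj n := by
    have h : IsZero ((TStructure.t.eTruncLT.obj j).obj X) :=
      TStructure.t.isZero_eTruncLT_obj_obj X 0 j hj
    have h' : IsZero (((TStructure.t.eTruncGE.obj i).obj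
        ((TStructure.t.eTruncLT.obj j).obj X))⟦n⟧) :=
      Functor.map_isZero _ (Functor.map_isZero _ h)
    have : Subsingleton (((hyperextSpectralObject k N X).H n).obj (mk₁ (homOfLE hij))) :=
      ⟨fun x y => (hyperextSpectralObjectEquiv k N X n hij).injective (h'.eq_of_tgt _ _)⟩
    exact ModuleCat.isZero_of_subsingleton _
  isZero₂ i j hij n hi := by
    have h := TStructure.t.isGE_eTruncGE_obj_obj (n + 1) i
      (by
        induction i using WithBotTop.rec with
        | bot => simp at hi
        | coe i => exact WithBotTop.coe_le_coe.2 (WithBotTop.coe_lt_coe.1 hi)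
        | top => exact le_top) ((TStructure.t.eTruncLT.obj j).obj X)
    have h' := TStructure.t.isGE_shift
      ((TStructure.t.eTruncGE.obj i).obj ((TStructure.t.eTruncLT.obj j).obj X)) (n + 1) n 1
    have : Subsingleton (((hyperextSpectralObject k N X).H n).obj (mk₁ (homOfLE hij))) :=
      ⟨fun x y => (hyperextSpectralObjectEquiv k N X n hij).injective
        ((TStructure.t.zero _ 0 1 (by omega)).trans (TStructure.t.zero _ 0 1 (by omega)).symm)⟩
    exact ModuleCat.isZero_of_subsingleton _

/-- The term at (p, q) is Hom of N into the (p + q)-th shift of the truncation to degree q alone,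
that is, into H^q(X) shifted by p. -/
lemma nonempty_page_two_equiv [X.IsGE 0] [HasExt.{u} C] (p q : ℕ) (Y : C)
    (e : (homologyFunctor C q).obj X ≅ Y) :
    Nonempty ((((hyperextSpectralObject k N X).E₂SpectralSequenceNat).page 2 le_rfl).X (p, q) ≃ₗ[k]
      Abelian.Ext.{u} N Y p) := by
  obtain ⟨e'⟩ := nonempty_truncation_iso X q
  exact ⟨((hyperextSpectralObject k N X).spectralSequenceFirstPageXIso
    Abelian.SpectralObject.coreE₂CohomologicalNat (p, q) ((q : ℤ) : EInt) ((q + 1 : ℤ) : EInt)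
    rfl rfl (p + q) rfl).toLinearEquiv.trans <|
    (hyperextSpectralObjectEquiv k N X (p + q) _).trans <|
    (homPostcompEquiv k _ ((shiftFunctor _ (p + q : ℤ)).mapIso
      (e' ≪≫ (singleFunctor C q).mapIso e))).trans <|
    homSingleShiftEquiv N Y p q (p + q) rfl⟩

end SpectralObject

end Derived

/-! ### Morphisms from an object to a K-injective complex -/

section HomSingle

open Limits DerivedCategory CochainComplex.HomComplex

universe w

variable {C : Type v} [Category.{u} C] [Abelian C] [HasDerivedCategory.{w} C]

section

variable (N : C) (K : CochainComplex C ℤ) (n : ℤ)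

/-- The morphism in the derived category given by a cocycle `N ⟶ K.X n`. -/
def derivedClass (f : N ⟶ K.X n) (hf : f ≫ K.d n (n + 1) = 0) :
    (singleFunctor C 0).obj N ⟶ (Q.obj K)⟦n⟧ :=
  (singleFunctorIsoCompQ C 0).hom.app N ≫
    Q.map (Cocycle.equivHomShift.symm (Cocycle.fromSingleMk f (zero_add n) (n + 1) rfl hf)) ≫
    (Q.commShiftIso n).hom.app K

lemma derivedClass_add (f g : N ⟶ K.X n) (hf : f ≫ K.d n (n + 1) = 0)
    (hg : g ≫ K.d n (n + 1) = 0) :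
    derivedClass N K n (f + g) (by rw [Preadditive.add_comp, hf, hg, add_zero]) =
      derivedClass N K n f hf + derivedClass N K n g hg := by
  rw [derivedClass, Cocycle.fromSingleMk_add _ _ _ _ _ hf hg, map_add, Functor.map_add,
    Preadditive.add_comp, Preadditive.comp_add]
  rfl

lemma derivedClass_precomp {N' : C} (g : N' ⟶ N) (f : N ⟶ K.X n) (hf : f ≫ K.d n (n + 1) = 0) :
    derivedClass N' K n (g ≫ f) (by rw [Category.assoc, hf, comp_zero]) =
      (singleFunctor C 0).map g ≫ derivedClass N K n f hf := by
  rw [derivedClass, Cocycle.fromSingleMk_precomp g f _ _ _ hf, Cocycle.equivHomShift_symm_precomp,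
    Functor.map_comp, Category.assoc]
  exact ((singleFunctorIsoCompQ C 0).hom.naturality_assoc g _).symm

/-- Into a K-injective complex, morphisms in the derived category are homotopy classes of chain
maps. A chain map from an object placed in one degree is a cocycle, and it is null-homotopic exactly
when that cocycle is a coboundary. -/
lemma derivedClass_eq_zero_iff [K.IsKInjective] (f : N ⟶ K.X n) (hf : f ≫ K.d n (n + 1) = 0) :
    derivedClass N K n f hf = 0 ↔ ∃ g : N ⟶ K.X (n - 1), g ≫ K.d (n - 1) n = f := by
  rw [← Cocycle.fromSingleMk_mem_coboundaries_iff f (zero_add n) (n + 1) rfl hf (n - 1) (by omega),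
    ← CohomologyClass.toHom_mk_eq_zero_iff, CohomologyClass.toHom_mk, derivedClass,
    Preadditive.IsIso.comp_left_eq_zero, Preadditive.IsIso.comp_right_eq_zero,
    ← (CochainComplex.IsKInjective.Qh_map_bijective _ _).injective.eq_iff, Functor.map_zero,
    ← Preadditive.IsIso.comp_right_eq_zero _ ((quotientCompQhIso C).hom.app _),
    quotientCompQhIso_hom_naturality, Preadditive.IsIso.comp_left_eq_zero]

lemma derivedClass_surjective [K.IsKInjective]
    (x : (singleFunctor C 0).obj N ⟶ (Q.obj K)⟦n⟧) :
    ∃ (f : N ⟶ K.X n) (hf : f ≫ K.d n (n + 1) = 0), derivedClass N K n f hf = x := by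
  obtain ⟨y, hy⟩ := (CochainComplex.IsKInjective.Qh_map_bijective
    ((HomotopyCategory.quotient _ _).obj ((CochainComplex.singleFunctor C 0).obj N))
    (K⟦n⟧)).surjective ((quotientCompQhIso C).hom.app _ ≫ (singleFunctorIsoCompQ C 0).inv.app N ≫
      x ≫ (Q.commShiftIso n).inv.app K ≫ (quotientCompQhIso C).inv.app _)
  obtain ⟨z, rfl⟩ := (CohomologyClass.toHom_bijective _ _ _).surjective y
  obtain ⟨z, rfl⟩ := z.mk_surjective
  obtain ⟨f, hf, rfl⟩ := Cocycle.fromSingleMk_surjective z n (zero_add n) (n + 1) rfl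
  refine ⟨f, hf, ?_⟩
  rw [CohomologyClass.toHom_mk] at hy
  have h := (quotientCompQhIso_inv_naturality
    (Cocycle.equivHomShift.symm (Cocycle.fromSingleMk f (zero_add n) (n + 1) rfl hf))).symm
  rw [hy, Iso.inv_hom_id_app_assoc, ← Category.assoc, ← Category.assoc, cancel_mono] at h
  rw [derivedClass, ← h]
  simp

end

variable (k : Type u) [Field k] [Linear k C] (N : C) (K : CochainComplex C ℤ) (n : ℤ)

/-- The cocycles of degree `n` of the complex `Hom(N, K)`. -/
def homCocycles : Submodule k (N ⟶ K.X n) := LinearMap.ker (Linear.rightComp k N (K.d n (n + 1)))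

/-- The coboundaries of degree `n` of the complex `Hom(N, K)`. -/
def homCoboundaries : Submodule k (N ⟶ K.X n) :=
  LinearMap.range (Linear.rightComp k N (K.d (n - 1) n))

/-- The morphism in the derived category given by a cocycle, as a linear map. -/
def derivedClassHom :
    homCocycles k N K n →ₗ[k] ((singleFunctor C 0).obj N ⟶ (Q.obj K)⟦n⟧) where
  toFun f := derivedClass N K n f.1 f.2
  map_add' f g := derivedClass_add N K n f.1 g.1 f.2 g.2
  map_smul' r f := by
    -- Scalars are treated as precomposition with r times the identity of N, so homogeneity follows
    -- from naturality in N.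
    have h := derivedClass_precomp N K n (r • 𝟙 N) f.1 f.2
    have h' : (r • 𝟙 N) ≫ f.1 = (r • f).1 := by
      rw [Linear.smul_comp, Category.id_comp]
      rfl
    have h'' : (singleFunctor C 0).map (r • 𝟙 N) ≫ derivedClass N K n f.1 f.2 =
        r • derivedClass N K n f.1 f.2 := by
      rw [Functor.map_smul, CategoryTheory.Functor.map_id, Linear.smul_comp, Category.id_comp]
    refine Eq.trans ?_ (h.trans h'')
    simp only [h']

/-- Morphisms to a shift of a K-injective complex in the derived category are cohomology classes of
the complex of morphisms. -/
def homSingleEquiv [K.IsKInjective] :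
    (homCocycles k N K n ⧸ (homCoboundaries k N K n).submoduleOf (homCocycles k N K n)) ≃ₗ[k]
      ((singleFunctor C 0).obj N ⟶ (Q.obj K)⟦n⟧) :=
  (Submodule.quotEquivOfEq _ _ (by
    ext f
    exact (derivedClass_eq_zero_iff N K n f.1 f.2).symm)).trans <|
  (derivedClassHom k N K n).quotKerEquivOfSurjective fun x => by
    obtain ⟨f, hf, h⟩ := derivedClass_surjective N K n x
    exact ⟨⟨f, hf⟩, h⟩

end HomSingle

/-! ### The complex G(I): its cohomology and the abutment -/

section Main

open Limits DerivedCategory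

lemma nonempty_homology_iso {R : Type*} [Ring R] (T : ShortComplex (ModuleCat.{u} R))
    (H : ModuleCat.{u} R) (f : LinearMap.ker T.g.hom →ₗ[R] H) (hf : Function.Surjective f)
    (h : ∀ x, f x = 0 ↔ ∃ y, T.f.hom y = x.1) : Nonempty (T.homology ≅ H) := by
  have hker : LinearMap.range T.moduleCatToCycles = LinearMap.ker f := by
    ext x
    rw [LinearMap.mem_ker, h]
    exact exists_congr fun y => Subtype.ext_iff
  exact ⟨T.moduleCatHomologyIso ≪≫ LinearEquiv.toModuleIso
    ((Submodule.quotEquivOfEq _ _ hker).trans (f.quotKerEquivOfSurjective hf))⟩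

variable {k S L : Type u} [Field k] [CommRing S] [Algebra k S]
    [LieRing L] [LieAlgebra k L] [Module S L] [LieRingModule L S]
    [LieRinehartRing S L] [LieRinehartAlgebra k S L] [Module.Projective S L]
    {M : ModuleCat.{u} (Env k (Enveloping k S L))} (I : InjectiveResolution M)

/-- The complex `G(I)` indexed by the integers. -/
def gComplex : CochainComplex (ModuleCat.{u} (Enveloping k S L)) ℤ :=
  ((G k S L).mapHomologicalComplex _).obj I.cochainComplex

instance : (gComplex I).IsStrictlyGE 0 :=
  inferInstanceAs (CochainComplex.IsStrictlyGE
    (((G k S L).mapHomologicalComplex _).obj I.cochainComplex) 0)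

/-- The complex is bounded below and its terms are injective because `G` preserves injectives. -/
instance : (gComplex I).IsKInjective :=
  have (n : ℤ) : Injective ((gComplex I).X n) :=
    inferInstanceAs (Injective ((G k S L).obj (I.cochainComplex.X n)))
  CochainComplex.isKInjective_of_injective _ 0

section Homology

variable (q : ℕ)

/-- The components of `G(I)`. -/
def gComplexXIso : (gComplex I).X q ≅ (G k S L).obj (I.cocomplex.X q) :=
  (G k S L).mapIso (I.cochainComplexXIso q q rfl)

lemma gComplexXIso_hom_comp_map_d (q' : ℕ) :
    (gComplexXIso I q).hom ≫ (G k S L).map (I.cocomplex.d q q') =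
      (gComplex I).d q q' ≫ (gComplexXIso I q').hom := by
  have h : (I.cochainComplexXIso q q rfl).hom ≫ I.cocomplex.d q q' =
      I.cochainComplex.d q q' ≫ (I.cochainComplexXIso q' q' rfl).hom := by
    rw [I.cochainComplex_d q q' q q' rfl rfl, Category.assoc, Category.assoc, Iso.inv_hom_id,
      Category.comp_id]
  exact ((G k S L).map_comp _ _).symm.trans ((congrArg (G k S L).map h).trans
    ((G k S L).map_comp _ _))

lemma gComplexXIso_hom_map_d_apply (q' : ℕ) (x : (gComplex I).X q) :
    GHom.map (I.cocomplex.d q q') ((gComplexXIso I q).hom.hom x) =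
      (gComplexXIso I q').hom.hom (((gComplex I).d q q').hom x) :=
  congrArg (fun f => ModuleCat.Hom.hom f x) (gComplexXIso_hom_comp_map_d I q q')

lemma gComplexXIso_hom_bijective : Function.Bijective (gComplexXIso I q).hom.hom :=
  (gComplexXIso I q).toLinearEquiv.bijective

/-- The cocycles of `G(I)`. -/
def gCocyclesEquiv :
    LinearMap.ker ((gComplex I).d q (q + 1 : ℕ)).hom ≃ₗ[Enveloping k S L] cocycles I q :=
  (gComplexXIso I q).toLinearEquiv.ofSubmodules _ _ (by
    ext y
    obtain ⟨x, rfl⟩ := (gComplexXIso_hom_bijective I q).2 y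
    have h := gComplexXIso_hom_map_d_apply I q (q + 1) x
    constructor
    · rintro ⟨x', hx', hxx'⟩
      obtain rfl := (gComplexXIso_hom_bijective I q).1 hxx'
      exact h.trans ((congrArg _ hx').trans (map_zero _))
    · intro hx
      exact ⟨x, (gComplexXIso_hom_bijective I (q + 1)).1
        (h.symm.trans (Eq.trans hx (map_zero _).symm)), rfl⟩)

lemma gCocyclesEquiv_mem_coboundaries_iff
    (x : LinearMap.ker ((gComplex I).d q (q + 1 : ℕ)).hom) :
    (gCocyclesEquiv I q x).1 ∈ coboundaries I q ↔
      ∃ y, ((gComplex I).d ((q : ℤ) - 1) q).hom y = x.1 := by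
  have hx : (gCocyclesEquiv I q x).1 = (gComplexXIso I q).hom.hom x.1 := rfl
  rw [hx]
  cases q with
  | zero =>
    -- In degree 0 the predecessor is 0 for natural numbers and -1 for integers; the incoming
    -- differential is zero in both cases.
    have h : I.cocomplex.d (0 - 1) 0 = 0 := I.cocomplex.shape _ _ (by simp)
    have h' : (gComplex I).d ((0 : ℕ) - 1 : ℤ) (0 : ℕ) = 0 :=
      ((gComplex I).isZero_of_isStrictlyGE 0 _ (by simp)).eq_of_src _ _
    rw [coboundaries, h, h']
    constructor
    · rintro ⟨y, hy⟩
      exact ⟨0, (gComplexXIso_hom_bijective I 0).1 (Eq.trans (map_zero _) (Eq.trans rfl hy))⟩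
    · rintro ⟨y, hy⟩
      exact ⟨0, (map_zero _).trans ((map_zero (gComplexXIso I 0).hom.hom).symm.trans
        (congrArg _ hy))⟩
  | succ q =>
    have hq : ((q + 1 : ℕ) : ℤ) - 1 = q := by simp
    rw [hq]
    constructor
    · rintro ⟨z, hz⟩
      obtain ⟨y, rfl⟩ := (gComplexXIso_hom_bijective I q).2 z
      exact ⟨y, (gComplexXIso_hom_bijective I (q + 1)).1
        ((gComplexXIso_hom_map_d_apply I q (q + 1) y).symm.trans hz)⟩
    · rintro ⟨y, hy⟩
      exact ⟨(gComplexXIso I q).hom.hom y, (gComplexXIso_hom_map_d_apply I q (q + 1) y).trans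
        (congrArg _ hy)⟩

/-- The condition `IsInduced` says exactly that the class map on cocycles is U-linear; its kernel is
the coboundaries and it is surjective. -/
lemma nonempty_homology_gComplex_iso
    (μ : Module (Enveloping k S L) (HochschildCohomology k S ((res k S L).obj M) q))
    (hμ : IsInduced M q μ) :
    Nonempty ((gComplex I).homology q ≅ hochschildModule M q μ) := by
  let f : LinearMap.ker ((gComplex I).d q (q + 1 : ℕ)).hom →ₗ[Enveloping k S L]
      hochschildModule M q μ :=
    { toFun := fun x => classHom I q (gCocyclesEquiv I q x)
      map_add' := fun x y => by rw [map_add, map_add]; rfl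
      map_smul' := fun u x => by
        rw [map_smul]
        exact ((isInduced_iff I q μ).1 hμ u _).symm }
  obtain ⟨e⟩ := nonempty_homology_iso ((gComplex I).sc' ((q : ℤ) - 1) q (q + 1 : ℕ)) _ f
    ((classHom_surjective I q).comp (gCocyclesEquiv I q).surjective)
    (fun x => (classHom_eq_zero_iff I q _).trans (gCocyclesEquiv_mem_coboundaries_iff I q x))
  exact ⟨(gComplex I).homologyIsoSc' _ _ _ (by simp) (by simp) ≪≫ e⟩

end Homology

section Abutment

universe w

variable [HasDerivedCategory.{w} (ModuleCat.{u} (Enveloping k S L))]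
  [HasDerivedCategory.{w} (ModuleCat.{u} (Env k (Enveloping k S L)))]
  (N : ModuleCat.{u} (Enveloping k S L))

/-- The adjunction between `F` and `G`, as a linear equivalence. -/
def homLinearEquiv (X : ModuleCat.{u} (Env k (Enveloping k S L))) :
    (F N ⟶ X) ≃ₗ[k] (N ⟶ (G k S L).obj X) :=
  { homEquiv N X with
    map_add' := fun f g => homEquiv_add f g
    map_smul' := fun c f => homEquiv_smul c f }

/-- The complexes `Hom(F(N), I)` and `Hom(N, G(I))` have the same cocycles. -/
def homCocyclesEquiv (n : ℤ) :
    homCocycles k (F N) I.cochainComplex n ≃ₗ[k] homCocycles k N (gComplex I) n :=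
  (homLinearEquiv N (I.cochainComplex.X n)).ofSubmodules _ _ (by
    ext y
    obtain ⟨x, rfl⟩ := (homLinearEquiv N (I.cochainComplex.X n)).surjective y
    constructor
    · rintro ⟨x', hx', hxx'⟩
      obtain rfl := (homLinearEquiv N (I.cochainComplex.X n)).injective hxx'
      exact (homEquiv_comp x' (I.cochainComplex.d n (n + 1))).symm.trans
        ((congrArg _ hx').trans (map_zero (homLinearEquiv N _)))
    · intro hx
      refine ⟨x, (homLinearEquiv N (I.cochainComplex.X (n + 1))).injective ?_, rfl⟩
      exact (homEquiv_comp x (I.cochainComplex.d n (n + 1))).trans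
        (Eq.trans hx (map_zero (homLinearEquiv N _)).symm))

/-- The complexes `Hom(F(N), I)` and `Hom(N, G(I))` have the same cohomology. -/
def homCohomologyEquiv (n : ℤ) :
    (homCocycles k (F N) I.cochainComplex n ⧸
      (homCoboundaries k (F N) I.cochainComplex n).submoduleOf
        (homCocycles k (F N) I.cochainComplex n)) ≃ₗ[k]
    (homCocycles k N (gComplex I) n ⧸
      (homCoboundaries k N (gComplex I) n).submoduleOf (homCocycles k N (gComplex I) n)) :=
  Submodule.Quotient.equiv _ _ (homCocyclesEquiv I N n) (by
    ext y
    obtain ⟨x, rfl⟩ := (homCocyclesEquiv I N n).surjective y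
    constructor
    · rintro ⟨x', ⟨z, hz⟩, hxx'⟩
      obtain rfl := (homCocyclesEquiv I N n).injective hxx'
      exact ⟨homEquiv N _ z, (homEquiv_comp z (I.cochainComplex.d (n - 1) n)).symm.trans
        (congrArg (homEquiv N _) hz)⟩
    · rintro ⟨z, hz⟩
      obtain ⟨z, rfl⟩ := (homEquiv N _).surjective z
      exact ⟨x, ⟨z, (homEquiv N _).injective
        ((homEquiv_comp z (I.cochainComplex.d (n - 1) n)).trans hz)⟩, rfl⟩)

/-- The hyperext groups of `G(I)` are the `Ext` groups of `F(N)`. -/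
def homGComplexEquivExt (n : ℕ) :
    ((singleFunctor _ 0).obj N ⟶ (Q.obj (gComplex I))⟦(n : ℤ)⟧) ≃ₗ[k] Abelian.Ext.{u} (F N) M n :=
  -- Both G(I) and I are K-injective, so each side is the cohomology of a complex of morphisms. The
  -- adjunction identifies these two complexes, and the resolution map then replaces I by M.
  (homSingleEquiv k N (gComplex I) n).symm.trans <|
    (homCohomologyEquiv I N n).symm.trans <|
    (homSingleEquiv k (F N) I.cochainComplex n).trans <|
    (homPostcompEquiv k _ ((shiftFunctor _ (n : ℤ)).mapIso ((asIso (Q.map I.ι')).symm ≪≫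
      (singleFunctorIsoCompQ _ 0).symm.app M))).trans Abelian.Ext.homLinearEquiv.symm

end Abutment

end Main

end LieRinehart

end

open LieRinehart in
theorem mainTheorem2 (k S L : Type u) [Field k] [CommRing S] [Algebra k S]
    [LieRing L] [LieAlgebra k L] [Module S L] [LieRingModule L S]
    [LieRinehartRing S L] [LieRinehartAlgebra k S L] [Module.Projective S L]
    (N : ModuleCat.{u} (Enveloping k S L)) (M : ModuleCat.{u} (Env k (Enveloping k S L))) :
    (∀ q : ℕ, ∃! μ : Module (Enveloping k S L)
        (HochschildCohomology k S ((res k S L).obj M) q), IsInduced M q μ) ∧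
    ∀ μ : ∀ q : ℕ, Module (Enveloping k S L)
        (HochschildCohomology k S ((res k S L).obj M) q), (∀ q, IsInduced M q (μ q)) →
      ∃ E : E₂CohomologicalSpectralSequenceNat (ModuleCat.{u} k),
        (∀ p q : ℕ, Nonempty ((E.page 2).X (p, q) ≃ₗ[k]
          Abelian.Ext.{u} N (hochschildModule M q (μ q)) p)) ∧
        ConvergesTo E (fun n => Abelian.Ext.{u} (F N) M n) := by
  refine ⟨fun q => existsUnique_isInduced M q, fun μ hμ => ?_⟩
  let := HasDerivedCategory.standard (ModuleCat.{u} (Enveloping k S L))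
  let := HasDerivedCategory.standard (ModuleCat.{u} (Env k (Enveloping k S L)))
  obtain ⟨I⟩ : Nonempty (InjectiveResolution M) := HasInjectiveResolution.out
  -- This is the value at M of the right derived functor of `G`; the spectral sequence is the
  -- hyperext one for N and this object.
  let X := DerivedCategory.Q.obj (gComplex I)
  refine ⟨(hyperextSpectralObject k N X).E₂SpectralSequenceNat, fun p q => ?_,
    convergesTo _ fun n => (hyperextAbutmentEquiv k N X n).trans (homGComplexEquivExt I N n)⟩
  obtain ⟨e⟩ := nonempty_homology_gComplex_iso I q (μ q) (hμ q)
  exact nonempty_page_two_equiv k N X p q _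
    ((DerivedCategory.homologyFunctorFactors _ q).app (gComplex I) ≪≫ e)
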